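/- A Gauss diagram is a disjoint union of oriented circles with finitely many oriented signed chords; a chord of sign $\varepsilon=\pm1$ gives the sign $-\varepsilon$ to its initial and $\varepsilon$ to its terminal endpoint. An oriented 2-component virtual link $L=K_1\cup K_2$ (components ordered) is an equivalence class of Gauss diagrams on two circles $C_1,C_2$ under the Reidemeister moves R1–R3. For such a diagram $G$ of $L$: - $\mathrm{Lk}(K_i,K_j)$ $(i\neq j)$ is the sum of the signs of the chords oriented from $C_i$ to $C_j$, and $\lambda(L)=\mathrm{Lk}(K_1,K_2)-\mathrm{Lk}(K_2,K_1)$. - The index of a self-chord $\gamma$ on $C_i$ (both endpoints on $C_i$) is the sum of the signs of all chord endpoints in the interior of the arc of $C_i$ oriented from the initial to the terminal endpoint of $\gamma$. $J_n(K_i;L)$ is the sum of the signs of the self-chords on $C_i$ of index $n$. It is independent of the choice of $G$ for $n\neq 0,-\lambda(L)$ if $i=1$, and for $n\neq 0,\lambda(L)$ if $i=2$. A shell for a chord is a self-chord that closely surrounds one endpoint $e$ of that chord and is directed as the circle if the sign of $e$ is $+$, and against it if the sign is $-$. The shell move S1 slides a shell from one endpoint of the chord to the other, keeping the sign of the shell.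 The shell move S2 takes adjacent endpoints $a,b$ (in this order along the circle) of two distinct chords, exchanges them, and adds a shell around each: one of sign $\delta$ around $a$ and one of sign $-\delta$ around $b$, where $\delta$ is the product of the signs of $a$ and $b$. Two Gauss diagrams are S-equivalent if they are related by a finite sequence of Reidemeister moves R1–R3, moves S1 and S2, and their inverses; two virtual links are S-equivalent if they have S-equivalent Gauss diagrams. **Theorem.** Let $L=K_1\cup K_2$ and $L'=K_1'\cup K_2'$ be oriented 2-component virtual links with $\lambda(L)=\lambda(L')=1$. Then $L$ and $L'$ are S-equivalent if and only if (i) $J_n(K_1;L)=J_n(K_1';L')$ for every integer $n\neq 0,1,-1$; (ii) $J_n(K_2;L)=J_n(K_2';L')$ for every integer $n\neq 0,1,2$; and (iii) $F(L)=F(L')$, where $F(L)$, the linking class, is for $\lambda(L)=1$ the pair $(\mathrm{Lk}(K_1,K_2),\mathrm{Lk}(K_2,K_1))\in\mathbb Z\times\mathbb Z$. -/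

import Mathlib

/-- An endpoint of a signed oriented chord: the name of the chord, whether this is its terminal
(`true`) or its initial (`false`) endpoint, and the sign `±1` of the chord. -/
structure Endpoint where
  chord : ℕ
  isTerminal : Bool
  chordSign : ℤˣ
deriving DecidableEq

namespace Endpoint

/-- The sign of an endpoint of a chord of sign `ε` is `ε` at the terminal endpoint and `-ε` at the
initial endpoint. -/
def sign (e : Endpoint) : ℤˣ := if e.isTerminal then e.chordSign else -e.chordSign

/-- The other endpoint of the same chord. -/
def opp (e : Endpoint) : Endpoint := ⟨e.chord, !e.isTerminal, e.chordSign⟩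

/-- Rename the chords. -/
def relabel (f : Equiv.Perm ℕ) (e : Endpoint) : Endpoint := ⟨f e.chord, e.isTerminal, e.chordSign⟩

/-- The endpoint `e` surrounded by one shell, named `c` and of sign `σ`: the shell is directed as
the circle when `e` is a positive endpoint, and against the circle when `e` is negative. -/
def withShell (c : ℕ) (σ : ℤˣ) (e : Endpoint) : List Endpoint :=
  if e.sign = 1 then [⟨c, false, σ⟩, e, ⟨c, true, σ⟩] else [⟨c, true, σ⟩, e, ⟨c, false, σ⟩]

end Endpoint

/-- A Gauss diagram on `μ` (ordered) oriented circles. The circle `i` is recorded by the list of the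
endpoints that one meets along it, read in the direction of the circle from some base point; lists
that differ by a rotation or by the names of the chords give isomorphic diagrams
(see `GaussDiagram.Iso`). Each chord has exactly one initial and exactly one terminal endpoint. -/
structure GaussDiagram (μ : ℕ) where
  circle : Fin μ → List Endpoint
  nodup : ∀ i, (circle i).Nodup
  disjoint : ∀ i j, i ≠ j → List.Disjoint (circle i) (circle j)
  opp_mem : ∀ i, ∀ e ∈ circle i, ∃ j, e.opp ∈ circle j
  sign_eq : ∀ i j, ∀ e ∈ circle i, ∀ f ∈ circle j, e.chord = f.chord → e.chordSign = f.chordSign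

namespace GaussDiagram

variable {μ : ℕ}

/-- The diagrams agree up to the choice of the base points and the names of the chords. -/
def Iso (G H : GaussDiagram μ) : Prop :=
  ∃ f : Equiv.Perm ℕ, ∀ i, (H.circle i).IsRotated ((G.circle i).map (Endpoint.relabel f))

/-- On some circle of `G`, the endpoint `f` comes immediately after `e`. -/
def Adjacent (G : GaussDiagram μ) (e f : Endpoint) : Prop :=
  ∃ i l, (G.circle i).IsRotated (e :: f :: l)

/-- `e` is immediately followed by `f` if `κ = 1`, and immediately preceded by `f` if `κ = -1`. -/
def AdjacentBy (G : GaussDiagram μ) (κ : ℤˣ) (e f : Endpoint) : Prop :=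
  if κ = 1 then G.Adjacent e f else G.Adjacent f e

/-- The first Reidemeister move: `H` is obtained from `G` by deleting a free chord, that is, a
self-chord (of any sign and orientation) whose two endpoints are adjacent. -/
def R1 (G H : GaussDiagram μ) : Prop :=
  ∃ e : Endpoint, G.Adjacent e e.opp ∧
    ∀ i, H.circle i = (G.circle i).filter (fun x => x.chord ≠ e.chord)

/-- The second Reidemeister move: `H` is obtained from `G` by deleting two chords of opposite signs
whose initial endpoints `a`, `b` are adjacent and whose terminal endpoints are adjacent (the latter
in either order). -/
def R2 (G H : GaussDiagram μ) : Prop :=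
  ∃ a b : Endpoint, a.isTerminal = false ∧ b.isTerminal = false ∧ b.chordSign = -a.chordSign ∧
    G.Adjacent a b ∧ (G.Adjacent a.opp b.opp ∨ G.Adjacent b.opp a.opp) ∧
    ∀ i, H.circle i = (G.circle i).filter (fun x => x.chord ≠ a.chord ∧ x.chord ≠ b.chord)

/-- The third Reidemeister move, in all its oriented versions. The three strands involved are a top,
a middle and a bottom one; the chord `x` of sign `εx` goes from top to middle, `y` of sign `εy` from
top to bottom, `z` of sign `εz` from middle to bottom. The two endpoints on each strand are adjacent,
and the move exchanges the two endpoints on each of the three strands. The order of the endpoints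
along the strands is the one realized by three oriented lines in the plane: the signs of the three
crossings and the side `κ` of the move determine it. -/
def R3 (G H : GaussDiagram μ) : Prop :=
  ∃ (x y z : ℕ) (εx εy εz κ : ℤˣ), x ≠ y ∧ x ≠ z ∧ y ≠ z ∧
    G.AdjacentBy (κ * εy) ⟨x, false, εx⟩ ⟨y, false, εy⟩ ∧
    G.AdjacentBy (κ * εz) ⟨x, true, εx⟩ ⟨z, false, εz⟩ ∧
    G.AdjacentBy (κ * (εx * εy * εz)) ⟨y, true, εy⟩ ⟨z, true, εz⟩ ∧
    ∀ i, H.circle i = (G.circle i).map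
      (Equiv.swap (⟨x, false, εx⟩ : Endpoint) ⟨y, false, εy⟩ *
        Equiv.swap (⟨x, true, εx⟩ : Endpoint) ⟨z, false, εz⟩ *
        Equiv.swap (⟨y, true, εy⟩ : Endpoint) ⟨z, true, εz⟩)

/-- Isomorphisms and Reidemeister moves of Gauss diagrams. -/
inductive ReidemeisterMove : GaussDiagram μ → GaussDiagram μ → Prop
  | iso {G H} : Iso G H → ReidemeisterMove G H
  | r1 {G H} : R1 G H → ReidemeisterMove G H
  | r2 {G H} : R2 G H → ReidemeisterMove G H
  | r3 {G H} : R3 G H → ReidemeisterMove G H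

/-- The shell move S1: a shell for a chord slides from the endpoint `e` of the chord to the other
endpoint, keeping the sign `σ` of the shell. Here `G₀` is the diagram without that shell. -/
def S1 (G H : GaussDiagram μ) : Prop :=
  ∃ (G₀ : GaussDiagram μ) (e : Endpoint) (c : ℕ) (σ : ℤˣ), (∃ i, e ∈ G₀.circle i) ∧
    (∀ i, G.circle i =
      (G₀.circle i).flatMap (fun x => if x = e then e.withShell c σ else [x])) ∧
    (∀ i, H.circle i =
      (G₀.circle i).flatMap (fun x => if x = e.opp then e.opp.withShell c σ else [x]))

/-- The shell move S2: adjacent endpoints `a`, `b` of two distinct chords, in this order along the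
circle, are exchanged, and each of the two chords receives a shell around the endpoint that has
moved. With `δ` the product of the signs of the endpoints `a` and `b`, the shell of the chord of `a`
has sign `δ` and the shell of the chord of `b` has sign `-δ`. -/
def S2 (G H : GaussDiagram μ) : Prop :=
  ∃ (a b : Endpoint) (c d : ℕ), a.chord ≠ b.chord ∧ G.Adjacent a b ∧
    ∀ i, H.circle i = (G.circle i).flatMap (fun x =>
      if x = a then b.withShell c (-(a.sign * b.sign))
      else if x = b then a.withShell d (a.sign * b.sign)
      else [x])

/-- Isomorphisms, Reidemeister moves and shell moves of Gauss diagrams. -/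
inductive SMove : GaussDiagram μ → GaussDiagram μ → Prop
  | reidemeister {G H} : ReidemeisterMove G H → SMove G H
  | s1 {G H} : S1 G H → SMove G H
  | s2 {G H} : S2 G H → SMove G H

/-- S-equivalence of Gauss diagrams: a finite sequence of Reidemeister moves, shell moves and their
inverses. -/
def SEquiv (G H : GaussDiagram μ) : Prop := Relation.EqvGen SMove G H

/-- The sum of the signs of all chords that go from the circle `i` to the circle `j`; for `i ≠ j`
this is the linking number `Lk(K_i, K_j)`. -/
def linkingNumber (G : GaussDiagram μ) (i j : Fin μ) : ℤ :=
  (((G.circle i).filter (fun e => e.isTerminal = false ∧ e.opp ∈ G.circle j)).map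
    (fun e => (e.chordSign : ℤ))).sum

/-- The index of a self-chord on the circle `i`, given by its initial endpoint `e`: the sum of the
signs of all endpoints (of self- and nonself-chords) in the interior of the arc of the circle that
runs, along the orientation of the circle, from `e` to the terminal endpoint of the chord. -/
def index (G : GaussDiagram μ) (i : Fin μ) (e : Endpoint) : ℤ :=
  (((((G.circle i).rotate ((G.circle i).idxOf e)).tail).takeWhile (fun x => x ≠ e.opp)).map
    (fun x => (x.sign : ℤ))).sum

/-- The sum of the signs of all self-chords on the circle `i` of index `n`. -/
def writhe (G : GaussDiagram μ) (i : Fin μ) (n : ℤ) : ℤ :=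
  (((G.circle i).filter (fun e =>
      e.isTerminal = false ∧ e.opp ∈ G.circle i ∧ G.index i e = n)).map
    (fun e => (e.chordSign : ℤ))).sum

/-- The virtual linking number `λ = Lk(K_1, K_2) - Lk(K_2, K_1)` of a diagram on two circles. -/
def virtualLinkingNumber (G : GaussDiagram 2) : ℤ := G.linkingNumber 0 1 - G.linkingNumber 1 0

/-- The pair `(Lk(K_1, K_2), Lk(K_2, K_1))`, which is the linking class when `λ = 1`. -/
def linkingClass (G : GaussDiagram 2) : ℤ × ℤ := (G.linkingNumber 0 1, G.linkingNumber 1 0)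

end GaussDiagram

/-- Oriented virtual links with `μ` (ordered) components: Gauss diagrams up to isomorphism and
Reidemeister moves. -/
def VirtualLink (μ : ℕ) : Type :=
  Quotient (Relation.EqvGen.setoid (GaussDiagram.ReidemeisterMove (μ := μ)))

/-- `G` is a Gauss diagram of the virtual link `L`. -/
def GaussDiagram.Presents {μ : ℕ} (G : GaussDiagram μ) (L : VirtualLink μ) : Prop :=
  L = Quotient.mk _ G

/-- Virtual links are S-equivalent if they have S-equivalent Gauss diagrams. -/
def VirtualLink.SEquiv {μ : ℕ} (L L' : VirtualLink μ) : Prop :=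
  ∃ G G' : GaussDiagram μ, G.Presents L ∧ G'.Presents L' ∧ G.SEquiv G'

/-!
The conditions are necessary because they are invariants. This is checked for weighted diagrams,
that is, pairs of cyclic words together with an integer `m x` for every chord `x`: the number, with
signs, of shells of `x` that are not drawn. A shell of sign `σ` for a chord `x` of sign `ε` changes
the index of `x` by `-εσ` and changes no other index, so `weightedIndex` is the index in the diagram
with all the shells drawn, and S1 does not affect it. The move S2 exchanges two neighbouring
endpoints and adds just the shells that keep all the weighted indices (`weightedIndex_swap`). What
the moves do change are the numbers of free chords and of shells, whose indices are `0`, `1`, the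
total sign `T` of the circle, and `T + 1`; on the two circles of a diagram with `λ = 1` one has
`T = -1` and `T = 1`. Hence `SEquiv.sameInvariants`.

For the converse, shells slide along their chords (S1), pass each other, and cancel in pairs, so
that the S-class of a diagram with shells depends only on the words and the weights
(`sClass_shelled_eq_of_beadWeight`); this is `weightedClass`. By S2 an endpoint may pass any
endpoint of another chord at the cost of weights. Carrying an endpoint of a shell around a circle of
total sign `-1` shows that the weights may be changed by the vector of the chords on this circle;
carrying an endpoint of a nonself-chord around then shows that the weights of nonself-chords are
immaterial (`weightedClass_eq_of_eq_on_self`). So the S-class depends only on which endpoints lie on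
which circle and on the weighted indices of the self-chords (`weightedClass_eq_of_hasIndex`), and it
can be written as `indexClass W w`.

In this description the chords have become independent of each other. By R1, a self-chord whose
index is that of a free chord or of a shell may be deleted (`indexClass_delete`). By R2, two
self-chords on the same circle with opposite signs and the same index cancel: they are put parallel,
with endpoints of the required total sign between them, which auxiliary free chords provide
(`indexClass_cancel_self`). Two nonself-chords of the same direction and opposite signs cancel as
well (`indexClass_cancel_cross`). What remains are the signed numbers of chords of each kind, and
these are the invariants; a renamed copy of one diagram together with a copy of opposite signs
mediates between the two diagrams (`indexClass_chordWords_eq_renamed`).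
-/

/-! ### Signs, and the arcs of a cyclic word -/

namespace Endpoint

@[simp] theorem opp_opp (e : Endpoint) : e.opp.opp = e := by cases e; simp [opp]
@[simp] theorem chord_opp (e : Endpoint) : e.opp.chord = e.chord := rfl
@[simp] theorem chordSign_opp (e : Endpoint) : e.opp.chordSign = e.chordSign := rfl
@[simp] theorem isTerminal_opp (e : Endpoint) : e.opp.isTerminal = !e.isTerminal := rfl

@[simp] theorem sign_opp (e : Endpoint) : e.opp.sign = -e.sign := by
  rcases e with ⟨c, t, s⟩; cases t <;> simp [sign, opp]

@[simp] theorem opp_ne (e : Endpoint) : e.opp ≠ e := by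
  rcases e with ⟨c, t, s⟩; cases t <;> simp [opp]

@[simp] theorem ne_opp (e : Endpoint) : e ≠ e.opp := (opp_ne e).symm

theorem opp_injective : Function.Injective opp := fun a b h => by
  rw [← opp_opp a, h, opp_opp]

theorem opp_eq_iff {e f : Endpoint} : e.opp = f ↔ e = f.opp :=
  ⟨fun h => by rw [← h, opp_opp], fun h => by rw [h, opp_opp]⟩

theorem eq_or_eq_opp {e f : Endpoint} (hc : f.chord = e.chord) (hs : f.chordSign = e.chordSign) :
    f = e ∨ f = e.opp := by
  rcases e with ⟨c, t, s⟩; rcases f with ⟨c', t', s'⟩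
  simp only at hc hs; subst hc hs
  cases t <;> cases t' <;> simp [opp]

theorem sign_mul_self (e : Endpoint) : (e.sign : ℤ) * e.sign = 1 := by
  rcases Int.units_eq_one_or e.sign with h | h <;> simp [h]

theorem sign_of_initial {e : Endpoint} (h : e.isTerminal = false) : e.sign = -e.chordSign := by
  simp [sign, h]

theorem sign_of_terminal {e : Endpoint} (h : e.isTerminal = true) : e.sign = e.chordSign := by
  simp [sign, h]

end Endpoint

namespace GaussDiagram

/-- The sum of the signs of the endpoints in a word. -/
def signSum (w : List Endpoint) : ℤ := (w.map fun x => (x.sign : ℤ)).sum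

@[simp] theorem signSum_nil : signSum [] = 0 := rfl
@[simp] theorem signSum_cons (x : Endpoint) (w : List Endpoint) :
    signSum (x :: w) = x.sign + signSum w := by simp [signSum]
@[simp] theorem signSum_append (u v : List Endpoint) :
    signSum (u ++ v) = signSum u + signSum v := by simp [signSum]
theorem signSum_perm {u v : List Endpoint} (h : u.Perm v) : signSum u = signSum v :=
  (h.map _).sum_eq

/-- The sum of the signs of the endpoints that lie on the arc of the cyclic word `w` from `e` to the
opposite endpoint. -/
def arcSum (w : List Endpoint) (e : Endpoint) : ℤ :=
  signSum (((w.rotate (w.idxOf e)).tail).takeWhile (fun x => x ≠ e.opp))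

theorem index_eq_arcSum {μ : ℕ} (G : GaussDiagram μ) (i : Fin μ) (e : Endpoint) :
    G.index i e = arcSum (G.circle i) e := rfl

theorem eq_of_isRotated_cons {α : Type*} {e : α} {s t : List α} (hn : (e :: t).Nodup)
    (h : (e :: t).IsRotated (e :: s)) : t = s := by
  obtain ⟨n, hnr⟩ := h
  have hlt : n % (e :: t).length < (e :: t).length := Nat.mod_lt _ (by simp)
  rw [← List.rotate_mod] at hnr
  have h0 : ((e :: t).rotate (n % (e :: t).length))[0]? = some e := by rw [hnr]; rfl
  rw [List.getElem?_rotate (by simp)] at h0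
  rw [Nat.zero_add, Nat.mod_eq_of_lt hlt, List.getElem?_eq_getElem hlt, Option.some.injEq] at h0
  have h1 : n % (e :: t).length = 0 := by
    have := (List.Nodup.getElem_inj_iff hn (hi := hlt) (hj := by simp)
      (i := n % (e :: t).length) (j := 0)).1 (by simpa using h0)
    exact this
  rw [h1, List.rotate_zero] at hnr
  simpa using hnr

theorem isRotated_append_comm {α : Type*} (u v : List α) : (u ++ v).IsRotated (v ++ u) :=
  List.isRotated_append

theorem arcSum_of_isRotated {w u v : List Endpoint} {e : Endpoint} (hn : w.Nodup)
    (h : w.IsRotated (e :: (u ++ e.opp :: v))) : arcSum w e = signSum u := by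
  have he : e ∈ w := h.mem_iff.2 (by simp)
  have hlt : w.idxOf e < w.length := List.idxOf_lt_length_iff.2 he
  have h1 : w.rotate (w.idxOf e) = e :: (u ++ e.opp :: v) := by
    have h2 : w.rotate (w.idxOf e) = e :: (w.drop (w.idxOf e + 1) ++ w.take (w.idxOf e)) := by
      rw [List.rotate_eq_drop_append_take hlt.le, List.drop_eq_getElem_cons hlt,
        List.getElem_idxOf hlt, List.cons_append]
    have h3 : (w.rotate (w.idxOf e)).IsRotated (e :: (u ++ e.opp :: v)) :=
      (List.IsRotated.symm ⟨_, rfl⟩).trans h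
    have hn' := (List.nodup_rotate (n := w.idxOf e)).2 hn
    rw [h2] at h3 hn' ⊢
    rw [eq_of_isRotated_cons hn' h3]
  have hn2 : (e :: (u ++ e.opp :: v)).Nodup := h.perm.nodup_iff.1 hn
  have hu : e.opp ∉ u := by
    intro hu
    have := (List.nodup_cons.1 hn2).2
    rw [List.nodup_append] at this
    exact this.2.2 _ hu _ (by simp) rfl
  rw [arcSum, h1, List.tail_cons, List.takeWhile_append_of_pos]
  · simp
  · intro a ha
    have : a ≠ e.opp := fun h => hu (by rwa [← h])
    simpa using this

theorem exists_isRotated {w : List Endpoint} {e f : Endpoint} (he : e ∈ w) (hf : f ∈ w)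
    (hne : e ≠ f) : ∃ u v, w.IsRotated (e :: (u ++ f :: v)) := by
  obtain ⟨p, q, rfl⟩ := List.append_of_mem he
  have : f ∈ q ++ p := by
    simp only [List.mem_append, List.mem_cons] at hf ⊢
    rcases hf with h | h | h
    · exact .inr h
    · exact absurd h.symm hne
    · exact .inl h
  obtain ⟨u, v, h⟩ := List.append_of_mem this
  refine ⟨u, v, ?_⟩
  rw [← h]
  exact isRotated_append_comm p (e :: q)

theorem arcSum_congr {w w' : List Endpoint} {e : Endpoint} (hn : w.Nodup) (h : w.IsRotated w')
    (he : e ∈ w) (he' : e.opp ∈ w) : arcSum w e = arcSum w' e := by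
  obtain ⟨u, v, huv⟩ := exists_isRotated he he' e.ne_opp
  rw [arcSum_of_isRotated hn huv,
    arcSum_of_isRotated (h.perm.nodup_iff.1 hn) (h.symm.trans huv)]

/-- The sum of the signs of the endpoints that precede `x` in the word. -/
def prefixSum : List Endpoint → Endpoint → ℤ
  | [], _ => 0
  | y :: w, x => if y = x then 0 else y.sign + prefixSum w x

/-- It is `1` if `f` occurs in the word before `e` does, and `0` otherwise. -/
def precedes : List Endpoint → Endpoint → Endpoint → ℤ
  | [], _, _ => 0
  | y :: w, f, e => if y = f then 1 else if y = e then 0 else precedes w f e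

theorem prefixSum_append {p : List Endpoint} {x : Endpoint} (h : x ∉ p) (l : List Endpoint) :
    prefixSum (p ++ l) x = signSum p + prefixSum l x := by
  induction p with
  | nil => simp
  | cons y p ih =>
    simp only [List.mem_cons, not_or] at h
    simp [prefixSum, Ne.symm h.1, ih h.2, add_assoc]

theorem precedes_append {p : List Endpoint} {e f : Endpoint} (he : e ∉ p) (hf : f ∉ p)
    (l : List Endpoint) : precedes (p ++ l) f e = precedes l f e := by
  induction p with
  | nil => simp
  | cons y p ih =>
    simp only [List.mem_cons, not_or] at he hf
    simp [precedes, Ne.symm he.1, Ne.symm hf.1, ih he.2 hf.2]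

/-- The sum over an arc in terms of a linear word: a correction by the total sum is needed when the
arc runs through the base point. -/
theorem arcSum_eq {w : List Endpoint} {e : Endpoint} (hn : w.Nodup) (he : e ∈ w)
    (hf : e.opp ∈ w) : arcSum w e =
      prefixSum w e.opp - prefixSum w e - e.sign + signSum w * precedes w e.opp e := by
  obtain ⟨p, q, rfl⟩ := List.append_of_mem he
  have hn1 := hn
  rw [List.nodup_append, List.nodup_cons] at hn1
  have hep : e ∉ p := fun h => hn1.2.2 e h e (by simp) rfl
  simp only [List.mem_append, List.mem_cons, e.opp_ne, false_or] at hf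
  rcases hf with hf | hf
  · obtain ⟨a, b, rfl⟩ := List.append_of_mem hf
    have hfa : e.opp ∉ a := by
      have := hn1.1
      rw [List.nodup_append] at this
      exact fun h => this.2.2 _ h _ (by simp) rfl
    simp only [List.mem_append, List.mem_cons, not_or] at hep
    rw [arcSum_of_isRotated (u := q ++ a) (v := b) hn]
    · simp [prefixSum_append hfa, precedes_append hep.1 hfa, prefixSum_append hep.1,
        prefixSum_append hep.2.2, prefixSum, precedes]
      ring
    · simpa using isRotated_append_comm (a ++ e.opp :: b) (e :: q)
  · obtain ⟨a, b, rfl⟩ := List.append_of_mem hf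
    have hfp : e.opp ∉ p := fun h => hn1.2.2 _ h _ (by simp) rfl
    have hfa : e.opp ∉ a := by
      have := hn1.2.1.2
      rw [List.nodup_append] at this
      exact fun h => this.2.2 _ h _ (by simp) rfl
    rw [arcSum_of_isRotated (u := a) (v := b ++ p) hn]
    · simp [prefixSum_append hfp, precedes_append hep hfp, prefixSum_append hep,
        prefixSum_append hfa, prefixSum, precedes]
    · simpa using isRotated_append_comm p (e :: (a ++ e.opp :: b))

/-- Prefixes with the same sum of signs are interchangeable for the chords off them. -/
theorem arcSum_append_congr {p q l : List Endpoint} {e : Endpoint} (hp : (p ++ l).Nodup)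
    (hq : (q ++ l).Nodup) (hs : signSum p = signSum q) (he : e ∈ l) (hf : e.opp ∈ l) :
    arcSum (p ++ l) e = arcSum (q ++ l) e := by
  have key : ∀ {r : List Endpoint} {x : Endpoint}, (r ++ l).Nodup → x ∈ l → x ∉ r :=
    fun hr hx hxr => (List.nodup_append.1 hr).2.2 _ hxr _ hx rfl
  rw [arcSum_eq hp (by simp [he]) (by simp [hf]), arcSum_eq hq (by simp [he]) (by simp [hf]),
    prefixSum_append (key hp he), prefixSum_append (key hp hf), prefixSum_append (key hq he),
    prefixSum_append (key hq hf), precedes_append (key hp he) (key hp hf),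
    precedes_append (key hq he) (key hq hf), signSum_append, signSum_append, hs]

/-- The change of the arc of a chord when two adjacent endpoints `a`, `b` are exchanged. -/
theorem arcSum_swap {w w' l : List Endpoint} {a b e : Endpoint} (hn : w.Nodup)
    (hw : w.IsRotated (a :: b :: l)) (hw' : w'.IsRotated (b :: a :: l)) (hab : a.chord ≠ b.chord)
    (hsgn : ∀ x ∈ w, ∀ y ∈ w, x.chord = y.chord → x.chordSign = y.chordSign)
    (he : e ∈ w) (hf : e.opp ∈ w) :
    arcSum w' e = arcSum w e - e.sign * (a.sign * b.sign) *
      ((if e.chord = a.chord then 1 else 0) - (if e.chord = b.chord then 1 else 0)) := by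
  have hpw : w.Perm (b :: a :: l) := hw.perm.trans (List.Perm.swap _ _ _)
  have hn1 : (a :: b :: l).Nodup := hw.perm.nodup_iff.1 hn
  have hn2 : (b :: a :: l).Nodup := hpw.nodup_iff.1 hn
  rw [arcSum_congr hn hw he hf, arcSum_congr (hw'.perm.nodup_iff.2 hn2) hw'
    (hw'.mem_iff.2 (hpw.mem_iff.1 he)) (hw'.mem_iff.2 (hpw.mem_iff.1 hf))]
  have ha : a ∈ w := hw.mem_iff.2 (by simp)
  have hb : b ∈ w := hw.mem_iff.2 (by simp)
  have hane : a ≠ b := fun h => hab (by rw [h])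
  have ha1 : a ≠ b.opp := fun h => hab (by rw [h]; rfl)
  have ha2 : b ≠ a.opp := fun h => hab (by rw [h]; rfl)
  have sa := a.sign_mul_self
  have sb := b.sign_mul_self
  rw [arcSum_eq hn1 (hw.mem_iff.1 he) (hw.mem_iff.1 hf),
    arcSum_eq hn2 (hpw.mem_iff.1 he) (hpw.mem_iff.1 hf)]
  by_cases h1 : e.chord = a.chord
  · have h2 : e.chord ≠ b.chord := fun h => hab (h1 ▸ h)
    rcases Endpoint.eq_or_eq_opp h1 (hsgn e he a ha h1) with rfl | rfl
    · simp [h2, prefixSum, precedes, hane.symm, ha2]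
      linear_combination (b.sign : ℤ) * sa
    · simp [hab, prefixSum, precedes, hane.symm, ha2]
      linear_combination (-(b.sign : ℤ)) * sa
  · by_cases h2 : e.chord = b.chord
    · rcases Endpoint.eq_or_eq_opp h2 (hsgn e he b hb h2) with rfl | rfl
      · simp [h1, prefixSum, precedes, hane, ha1]
        linear_combination (-(a.sign : ℤ)) * sb
      · simp [hab.symm, prefixSum, precedes, hane, ha1]
        linear_combination (a.sign : ℤ) * sb
    · have q1 : a ≠ e := fun h => h1 (by rw [h])
      have q2 : a ≠ e.opp := fun h => h1 (by rw [h]; rfl)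
      have q3 : b ≠ e := fun h => h2 (by rw [h])
      have q4 : b ≠ e.opp := fun h => h2 (by rw [h]; rfl)
      simp only [h1, h2, prefixSum, precedes, q1, q2, q3, q4, if_false, signSum_cons]
      ring

/-- The change of the arc of a chord when one of the chords receives a shell; here `p` and `q` are
the two endpoints of the shell. -/
theorem arcSum_shell {l : List Endpoint} {p x q e : Endpoint} {σ : ℤ}
    (hn : (p :: x :: q :: l).Nodup) (hp : (p.sign : ℤ) = -(x.sign * σ))
    (hq : (q.sign : ℤ) = x.sign * σ)
    (hsgn : ∀ y ∈ l, y.chord = x.chord → y.chordSign = x.chordSign)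
    (he : e ∈ x :: l) (hf : e.opp ∈ x :: l) :
    arcSum (p :: x :: q :: l) e = arcSum (x :: l) e +
      e.sign * σ * (if e.chord = x.chord then 1 else 0) := by
  have hsl : List.Sublist (x :: l) (x :: q :: l) := (List.sublist_cons_self q l).cons_cons x
  have hsub : ∀ y ∈ x :: l, y ∈ p :: x :: q :: l := fun y hy => .tail _ (hsl.subset hy)
  have hn0 : (x :: l).Nodup := (List.nodup_cons.1 hn).2.sublist hsl
  have ne1 : ∀ y ∈ x :: l, p ≠ y := fun y hy h =>
    (List.nodup_cons.1 hn).1 (h ▸ hsl.subset hy)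
  have ne2 : ∀ y ∈ x :: l, q ≠ y := by
    rintro y hy rfl
    have hn' := (List.nodup_cons.1 hn).2
    rcases List.mem_cons.1 hy with rfl | hy
    · exact (List.nodup_cons.1 hn').1 (by simp)
    · exact (List.nodup_cons.1 (List.nodup_cons.1 hn').2).1 hy
  rw [arcSum_eq hn (hsub _ he) (hsub _ hf), arcSum_eq hn0 he hf]
  by_cases h1 : e.chord = x.chord
  · have h2 : e.chordSign = x.chordSign := by
      rcases List.mem_cons.1 he with rfl | h
      · rfl
      · exact hsgn _ h h1
    rcases Endpoint.eq_or_eq_opp h1 h2 with rfl | rfl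
    · simp [prefixSum, precedes, hp, hq, ne1 _ he, ne1 _ hf, ne2 _ hf]
      ring
    · simp [prefixSum, precedes, hp, hq, ne1 x (by simp), ne1 _ he, ne2 _ he]
      ring
  · have q1 : x ≠ e := fun h => h1 (by rw [h])
    have q2 : x ≠ e.opp := fun h => h1 (by rw [h]; rfl)
    simp only [h1, prefixSum, precedes, hp, hq, ne1 _ he, ne1 _ hf, ne2 _ he, ne2 _ hf, q1, q2,
      if_false, signSum_cons]
    ring

end GaussDiagram

/-! ### Diagrams as pairs of words -/

namespace GaussDiagram

/-- The two cyclic words of a diagram on two circles, without the conditions that make them a Gauss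
diagram; these are `Words.Valid`. -/
abbrev Words := Fin 2 → List Endpoint

/-- All endpoints on the two circles. -/
def ends (W : Words) : List Endpoint := W 0 ++ W 1

theorem mem_ends {W : Words} {e : Endpoint} : e ∈ ends W ↔ ∃ i, e ∈ W i := by
  simp [ends, Fin.exists_fin_two]

theorem ends_perm {W W' : Words} (h : ∀ i, (W i).Perm (W' i)) : (ends W).Perm (ends W') :=
  (h 0).append (h 1)

/-- The words are those of a Gauss diagram. Stated in terms of the list of all endpoints, the
condition is visibly invariant under permutations. -/
structure Valid (W : Words) : Prop where
  nodup : (ends W).Nodup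
  opp_mem : ∀ e ∈ ends W, e.opp ∈ ends W
  sign_eq : ∀ e ∈ ends W, ∀ f ∈ ends W, e.chord = f.chord → e.chordSign = f.chordSign

theorem valid_circle (G : GaussDiagram 2) : Valid G.circle where
  nodup := List.nodup_append'.2 ⟨G.nodup 0, G.nodup 1, G.disjoint 0 1 (by decide)⟩
  opp_mem e he := by
    obtain ⟨i, hi⟩ := mem_ends.1 he
    exact mem_ends.2 (G.opp_mem i e hi)
  sign_eq e he f hf := by
    obtain ⟨i, hi⟩ := mem_ends.1 he
    obtain ⟨j, hj⟩ := mem_ends.1 hf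
    exact G.sign_eq i j e hi f hj

namespace Valid

variable {W W' : Words}

theorem of_perm (h : Valid W) (hp : (ends W).Perm (ends W')) : Valid W' where
  nodup := hp.nodup_iff.1 h.nodup
  opp_mem e he := hp.mem_iff.1 (h.opp_mem e (hp.mem_iff.2 he))
  sign_eq e he f hf := h.sign_eq e (hp.mem_iff.2 he) f (hp.mem_iff.2 hf)

theorem nodup_word (h : Valid W) (i : Fin 2) : (W i).Nodup := by
  have := List.nodup_append'.1 h.nodup
  fin_cases i
  exacts [this.1, this.2.1]

theorem eq_of_mem (h : Valid W) {i j : Fin 2} {e : Endpoint} (hi : e ∈ W i) (hj : e ∈ W j) :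
    i = j := by
  have hd := (List.nodup_append'.1 h.nodup).2.2
  fin_cases i <;> fin_cases j
  · rfl
  · exact absurd hj (hd hi)
  · exact absurd hi (hd hj)
  · rfl

theorem sign_eq_word (h : Valid W) (i j : Fin 2) : ∀ x ∈ W i, ∀ y ∈ W j, x.chord = y.chord →
    x.chordSign = y.chordSign := fun x hx y hy =>
  h.sign_eq x (mem_ends.2 ⟨i, hx⟩) y (mem_ends.2 ⟨j, hy⟩)

theorem eq_or_eq_opp (h : Valid W) {e f : Endpoint} (he : e ∈ ends W) (hf : f ∈ ends W)
    (hc : f.chord = e.chord) : f = e ∨ f = e.opp :=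
  Endpoint.eq_or_eq_opp hc (h.sign_eq f hf e he hc)

/-- The Gauss diagram with the given words. -/
def toDiagram (h : Valid W) : GaussDiagram 2 where
  circle := W
  nodup := h.nodup_word
  disjoint _ _ hij _ hi hj := hij (h.eq_of_mem hi hj)
  opp_mem i e he := mem_ends.1 (h.opp_mem e (mem_ends.2 ⟨i, he⟩))
  sign_eq i j e he f hf := h.sign_eq_word i j e he f hf

end Valid

end GaussDiagram

namespace Endpoint

/-- The first endpoint, along the circle, of the shell around `e`. -/
def shellStart (c : ℕ) (σ : ℤˣ) (e : Endpoint) : Endpoint := ⟨c, decide (e.sign ≠ 1), σ⟩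

@[simp] theorem chord_shellStart (c : ℕ) (σ : ℤˣ) (e : Endpoint) :
    (shellStart c σ e).chord = c := rfl

@[simp] theorem chordSign_shellStart (c : ℕ) (σ : ℤˣ) (e : Endpoint) :
    (shellStart c σ e).chordSign = σ := rfl

theorem sign_shellStart (c : ℕ) (σ : ℤˣ) (e : Endpoint) :
    (shellStart c σ e).sign = -(e.sign * σ) := by
  rcases Int.units_eq_one_or e.sign with h | h
  · have : shellStart c σ e = ⟨c, false, σ⟩ := by simp [shellStart, h]
    rw [this, h, sign_of_initial rfl, one_mul]
  · have : shellStart c σ e = ⟨c, true, σ⟩ := by simp [shellStart, h]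
    rw [this, h, sign_of_terminal rfl]
    simp

theorem withShell_eq (c : ℕ) (σ : ℤˣ) (e : Endpoint) :
    e.withShell c σ = [shellStart c σ e, e, (shellStart c σ e).opp] := by
  by_cases h : e.sign = 1 <;> simp [withShell, shellStart, opp, h]

end Endpoint

namespace GaussDiagram

open Endpoint

/-- The words with one new chord `c` of sign `σ`, a shell that surrounds `e` directly. -/
def addShell (e : Endpoint) (c : ℕ) (σ : ℤˣ) (W : Words) : Words := fun i =>
  (W i).flatMap fun x => if x = e then e.withShell c σ else [x]

theorem flatMap_ite_of_not_mem {e : Endpoint} {u w : List Endpoint} (h : e ∉ w) :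
    (w.flatMap fun x => if x = e then u else [x]) = w := by
  induction w with
  | nil => rfl
  | cons y w ih =>
    simp only [List.mem_cons, not_or] at h
    simp [ih h.2, Ne.symm h.1]

theorem addShell_of_not_mem {e : Endpoint} {W : Words} {i : Fin 2} (h : e ∉ W i) (c : ℕ)
    (σ : ℤˣ) : addShell e c σ W i = W i := flatMap_ite_of_not_mem h

theorem addShell_append {e : Endpoint} {W : Words} {i : Fin 2} {p q : List Endpoint}
    (hn : (W i).Nodup) (h : W i = p ++ e :: q) (c : ℕ) (σ : ℤˣ) :
    addShell e c σ W i = p ++ shellStart c σ e :: e :: (shellStart c σ e).opp :: q := by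
  rw [h, List.nodup_append, List.nodup_cons] at hn
  have hp : e ∉ p := fun hp => hn.2.2 e hp e (by simp) rfl
  simp [addShell, h, List.flatMap_append, flatMap_ite_of_not_mem hp,
    flatMap_ite_of_not_mem hn.2.1.1, withShell_eq]

theorem exists_addShell_isRotated {e : Endpoint} {W : Words} {i : Fin 2}
    (hn : (W i).Nodup) (h : e ∈ W i) (c : ℕ) (σ : ℤˣ) : ∃ l, (W i).IsRotated (e :: l) ∧
      (addShell e c σ W i).IsRotated
        (shellStart c σ e :: e :: (shellStart c σ e).opp :: l) := by
  obtain ⟨p, q, hpq⟩ := List.append_of_mem h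
  refine ⟨q ++ p, ?_, ?_⟩
  · rw [hpq]; exact isRotated_append_comm p (e :: q)
  · rw [addShell_append hn hpq]
    exact isRotated_append_comm p (_ :: e :: _ :: q)

theorem addShell_perm {e : Endpoint} {W : Words} {i : Fin 2}
    (hn : (W i).Nodup) (h : e ∈ W i) (c : ℕ) (σ : ℤˣ) : (addShell e c σ W i).Perm
      (shellStart c σ e :: (shellStart c σ e).opp :: W i) := by
  obtain ⟨l, h1, h2⟩ := exists_addShell_isRotated hn h c σ
  refine h2.perm.trans (.cons _ ((List.Perm.swap _ _ _).trans (.cons _ h1.perm.symm)))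

theorem ends_addShell_perm {e : Endpoint} {W : Words} (hW : Valid W) (h : e ∈ ends W) (c : ℕ)
    (σ : ℤˣ) : (ends (addShell e c σ W)).Perm
      (shellStart c σ e :: (shellStart c σ e).opp :: ends W) := by
  obtain ⟨i, hi⟩ := mem_ends.1 h
  have hp := addShell_perm (hW.nodup_word i) hi c σ
  have hne : ∀ j, j ≠ i → addShell e c σ W j = W j := fun j hj =>
    addShell_of_not_mem (fun h => hj (hW.eq_of_mem h hi)) c σ
  fin_cases i
  · rw [ends, hne 1 (by decide)]
    exact hp.append_right _
  · rw [ends, hne 0 (by decide)]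
    refine (hp.append_left _).trans ?_
    refine List.perm_middle.trans (.cons _ ?_)
    exact List.perm_middle

/-- No endpoint of the words belongs to the chord `c`. -/
def NewChord (c : ℕ) (W : Words) : Prop := ∀ x ∈ ends W, x.chord ≠ c

theorem valid_cons_cons {l : List Endpoint} {W W' : Words} {s : Endpoint} (hW : Valid W)
    (hl : (ends W).Perm l) (hc : NewChord s.chord W) (hp : (ends W').Perm (s :: s.opp :: l)) :
    Valid W' := by
  have hp' : (ends W').Perm (s :: s.opp :: ends W) :=
    hp.trans (.cons _ (.cons _ hl.symm))
  have hs : ∀ x ∈ ends W, x ≠ s ∧ x ≠ s.opp := fun x hx =>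
    ⟨fun h => hc x hx (by rw [h]), fun h => hc x hx (by rw [h]; rfl)⟩
  refine ⟨?_, ?_, ?_⟩
  · rw [hp'.nodup_iff]
    simp only [List.nodup_cons, List.mem_cons, not_or]
    exact ⟨⟨s.ne_opp, fun h => (hs _ h).1 rfl⟩, fun h => (hs _ h).2 rfl, hW.nodup⟩
  · intro e he
    rw [hp'.mem_iff] at he ⊢
    simp only [List.mem_cons] at he ⊢
    rcases he with rfl | rfl | he
    · simp
    · simp
    · exact .inr (.inr (hW.opp_mem e he))
  · intro e he f hf hef
    rw [hp'.mem_iff] at he hf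
    simp only [List.mem_cons] at he hf
    rcases he with rfl | rfl | he <;> rcases hf with rfl | rfl | hf
    · rfl
    · rfl
    · exact absurd hef.symm (hc f hf)
    · rfl
    · rfl
    · exact absurd hef.symm (hc f hf)
    · exact absurd hef (hc e he)
    · exact absurd hef (hc e he)
    · exact hW.sign_eq e he f hf hef

theorem Valid.addShell {e : Endpoint} {W : Words} (hW : Valid W) (h : e ∈ ends W) {c : ℕ}
    (hc : NewChord c W) (σ : ℤˣ) : Valid (addShell e c σ W) :=
  valid_cons_cons hW (.refl _) hc (ends_addShell_perm hW h c σ)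

/-- The words in which the two endpoints `a` and `b` have been exchanged. -/
def swapWords (a b : Endpoint) (W : Words) : Words := fun i => (W i).map (Equiv.swap a b)

theorem map_swap_of_not_mem {a b : Endpoint} {w : List Endpoint} (ha : a ∉ w) (hb : b ∉ w) :
    w.map (Equiv.swap a b) = w := by
  conv_rhs => rw [← List.map_id w]
  refine List.map_congr_left fun x hx => ?_
  exact Equiv.swap_apply_of_ne_of_ne (fun h => ha (h ▸ hx)) (fun h => hb (h ▸ hx))

theorem map_swap_of_isRotated {a b : Endpoint} {w l : List Endpoint} (hn : w.Nodup)
    (h : w.IsRotated (a :: b :: l)) : (w.map (Equiv.swap a b)).IsRotated (b :: a :: l) := by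
  have h1 := h.map (Equiv.swap a b)
  have h2 := h.perm.nodup_iff.1 hn
  simp only [List.nodup_cons, List.mem_cons, not_or] at h2
  simpa [map_swap_of_not_mem h2.1.2 h2.2.1] using h1

theorem swapWords_of_ne {a b : Endpoint} {W : Words} (hW : Valid W) {i j : Fin 2} (hij : j ≠ i)
    {l : List Endpoint} (h : (W i).IsRotated (a :: b :: l)) : swapWords a b W j = W j :=
  map_swap_of_not_mem (fun h' => hij (hW.eq_of_mem h' (h.mem_iff.2 (by simp))))
    (fun h' => hij (hW.eq_of_mem h' (h.mem_iff.2 (by simp))))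

theorem swapWords_perm {a b : Endpoint} {W : Words} (hW : Valid W) {i : Fin 2}
    {l : List Endpoint} (h : (W i).IsRotated (a :: b :: l)) (j : Fin 2) :
    (swapWords a b W j).Perm (W j) := by
  by_cases hij : j = i
  · subst hij
    exact (map_swap_of_isRotated (hW.nodup_word j) h).perm.trans
      ((List.Perm.swap _ _ _).trans h.perm.symm)
  · rw [swapWords_of_ne hW hij h]

theorem Valid.swapWords {a b : Endpoint} {W : Words} (hW : Valid W) {i : Fin 2}
    {l : List Endpoint} (h : (W i).IsRotated (a :: b :: l)) : Valid (swapWords a b W) :=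
  hW.of_perm (ends_perm fun j => (swapWords_perm hW h j).symm)

/-- The index of the self-chord with endpoint `g` on the circle `i` when every chord `x` carries
`m x` shells, counted with signs, that are not listed in the words. For a terminal endpoint `g` it
is the analogous sum over the arc from `g` to the initial endpoint. -/
def weightedIndex (W : Words) (m : ℕ → ℤ) (i : Fin 2) (g : Endpoint) : ℤ :=
  arcSum (W i) g + g.sign * m g.chord

theorem weightedIndex_swap {a b : Endpoint} {W : Words} (hW : Valid W) {i j : Fin 2}
    {l : List Endpoint} (h : (W i).IsRotated (a :: b :: l)) (hab : a.chord ≠ b.chord)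
    (m : ℕ → ℤ) {g : Endpoint} (hg : g ∈ W j) (hg' : g.opp ∈ W j) :
    weightedIndex (swapWords a b W) (m + Pi.single a.chord ((a.sign * b.sign : ℤˣ) : ℤ) -
      Pi.single b.chord ((a.sign * b.sign : ℤˣ) : ℤ)) j g = weightedIndex W m j g := by
  by_cases hij : j = i
  · subst hij
    rw [weightedIndex, weightedIndex, arcSum_swap (w' := swapWords a b W j) (hW.nodup_word j) h
      (map_swap_of_isRotated (hW.nodup_word j) h) hab (hW.sign_eq_word j j) hg hg']
    simp only [Pi.add_apply, Pi.sub_apply, Pi.single_apply]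
    push_cast
    split_ifs <;> ring
  · have key : ∀ x, x ∈ W i → g.chord ≠ x.chord := fun x hx hc => by
      rcases hW.eq_or_eq_opp (mem_ends.2 ⟨j, hg⟩) (mem_ends.2 ⟨i, hx⟩) hc.symm with rfl | rfl
      · exact hij (hW.eq_of_mem hg hx)
      · exact hij (hW.eq_of_mem hg' hx)
    have h1 := key a (h.mem_iff.2 (by simp))
    have h2 := key b (h.mem_iff.2 (by simp))
    simp [weightedIndex, swapWords_of_ne hW hij h, h1, h2]

theorem weightedIndex_addShell {e : Endpoint} {W : Words} (hW : Valid W) (he : e ∈ ends W)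
    {c : ℕ} (hc : NewChord c W) (σ : ℤˣ) (m : ℕ → ℤ) {j : Fin 2} {g : Endpoint} (hg : g ∈ W j)
    (hg' : g.opp ∈ W j) : weightedIndex (addShell e c σ W) m j g =
      weightedIndex W (m + Pi.single e.chord (σ : ℤ)) j g := by
  by_cases h : e ∈ W j
  · obtain ⟨l, h1, h2⟩ := exists_addShell_isRotated (hW.nodup_word j) h c σ
    have hn := (hW.addShell he hc σ).nodup_word j
    have hx : ∀ y ∈ e :: l, y ∈ W j := fun y hy => h1.mem_iff.2 hy
    have hy : ∀ {y}, y ∈ W j → y ∈ addShell e c σ W j := fun {y} hy =>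
      (addShell_perm (hW.nodup_word j) h c σ).mem_iff.2 (by simp [hy])
    rw [weightedIndex, weightedIndex, arcSum_congr hn h2 (hy hg) (hy hg'),
      arcSum_congr (hW.nodup_word j) h1 hg hg',
      arcSum_shell (σ := σ) (h2.perm.nodup_iff.1 hn) (by simp [sign_shellStart])
        (by simp [sign_shellStart])
        (fun y hy hc => hW.sign_eq_word j j y (hx y (by simp [hy])) e h hc)
        (h1.mem_iff.1 hg) (h1.mem_iff.1 hg')]
    simp only [Pi.add_apply, Pi.single_apply]
    split_ifs <;> ring
  · have h1 : g.chord ≠ e.chord := fun hc => by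
      rcases hW.eq_or_eq_opp (mem_ends.2 ⟨j, hg⟩) he hc.symm with rfl | rfl
      exacts [h hg, h hg']
    simp [weightedIndex, addShell_of_not_mem h, h1]

/-- The arc of a shell, from its initial to its terminal endpoint, contains the endpoint that it
surrounds if that one is positive, and all other endpoints of the circle if it is negative. -/
theorem arcSum_of_shell {e : Endpoint} {W : Words} (hW : Valid W) {c : ℕ} (hc : NewChord c W)
    (σ : ℤˣ) {i : Fin 2} (he : e ∈ W i) {g : Endpoint} (hg : g ∈ addShell e c σ W i)
    (hgc : g.chord = c) (hgt : g.isTerminal = false) :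
    arcSum (addShell e c σ W i) g = if e.sign = 1 then 1 else signSum (W i) + 1 := by
  have he' := mem_ends.2 ⟨i, he⟩
  obtain ⟨l, h1, h2⟩ := exists_addShell_isRotated (hW.nodup_word i) he c σ
  have hn := (hW.addShell he' hc σ).nodup_word i
  have hg2 : g = shellStart c σ e ∨ g = (shellStart c σ e).opp := by
    refine (hW.addShell he' hc σ).eq_or_eq_opp ?_ (mem_ends.2 ⟨i, hg⟩) (by simp [hgc])
    exact mem_ends.2 ⟨i, h2.mem_iff.2 (by simp)⟩
  split_ifs with hs
  · have : g = shellStart c σ e := by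
      rcases hg2 with h | h
      · exact h
      · simp [h, shellStart, hs] at hgt
    rw [this, arcSum_of_isRotated (u := [e]) (v := l) hn (by simpa using h2)]
    simp [hs]
  · have : g = (shellStart c σ e).opp := by
      rcases hg2 with h | h
      · simp [h, shellStart, hs] at hgt
      · exact h
    have h3 : (addShell e c σ W i).IsRotated (g :: (l ++ g.opp :: [e])) := by
      rw [this, opp_opp]
      exact h2.trans (isRotated_append_comm [_, e] (_ :: l))
    rw [arcSum_of_isRotated hn h3, signSum_perm h1.perm, signSum_cons,
      (Int.units_eq_one_or e.sign).resolve_left hs]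
    simp

end GaussDiagram

/-! ### The invariants of weighted diagrams -/

namespace GaussDiagram

open Endpoint

/-- The sum of the signs of the self-chords on the circle `i` whose weighted index is `n`. -/
def weightedWrithe (W : Words) (m : ℕ → ℤ) (i : Fin 2) (n : ℤ) : ℤ :=
  ((W i).map fun g => if g.isTerminal = false ∧ g.opp ∈ W i ∧ weightedIndex W m i g = n
    then (g.chordSign : ℤ) else 0).sum

/-- The sum of the signs of the chords from the circle `i` to the circle `j`. -/
def crossSum (W : Words) (i j : Fin 2) : ℤ :=
  ((W i).map fun g => if g.isTerminal = false ∧ g.opp ∈ W j then (g.chordSign : ℤ) else 0).sum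

theorem sum_map_filter_eq {α : Type*} (l : List α) (p : α → Bool) (f : α → ℤ) :
    ((l.filter p).map f).sum = (l.map fun x => if p x then f x else 0).sum := by
  induction l with
  | nil => rfl
  | cons x l ih => by_cases h : p x <;> simp [h, ih]

theorem linkingNumber_eq_crossSum (G : GaussDiagram 2) (i j : Fin 2) :
    G.linkingNumber i j = crossSum G.circle i j := by
  rw [linkingNumber, sum_map_filter_eq, crossSum]
  simp

theorem writhe_eq_weightedWrithe (G : GaussDiagram 2) (i : Fin 2) (n : ℤ) :
    G.writhe i n = weightedWrithe G.circle 0 i n := by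
  rw [writhe, sum_map_filter_eq, weightedWrithe]
  refine congrArg List.sum (List.map_congr_left fun g _ => if_congr ?_ rfl rfl)
  simp only [weightedIndex, index_eq_arcSum, Pi.zero_apply, mul_zero, add_zero]
  exact decide_eq_true_iff

/-- The invariants of the two weighted diagrams agree. The four excluded indices are those of the
free chords (`0` and the total sign of the circle) and of the shells. -/
structure SameInvariants (W : Words) (m : ℕ → ℤ) (W' : Words) (m' : ℕ → ℤ) : Prop where
  total : ∀ i, signSum (W i) = signSum (W' i)
  cross : ∀ i j, i ≠ j → crossSum W i j = crossSum W' i j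
  writhe : ∀ i n, n ≠ 0 → n ≠ 1 → n ≠ signSum (W i) → n ≠ signSum (W i) + 1 →
    weightedWrithe W m i n = weightedWrithe W' m' i n

namespace SameInvariants

variable {W W' W'' : Words} {m m' m'' : ℕ → ℤ}

theorem refl (W : Words) (m : ℕ → ℤ) : SameInvariants W m W m :=
  ⟨fun _ => rfl, fun _ _ _ => rfl, fun _ _ _ _ _ _ => rfl⟩

theorem symm (h : SameInvariants W m W' m') : SameInvariants W' m' W m :=
  ⟨fun i => (h.total i).symm, fun i j hij => (h.cross i j hij).symm,
    fun i n h0 h1 h2 h3 => (h.writhe i n h0 h1 (by rwa [h.total]) (by rwa [h.total])).symm⟩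

theorem trans (h : SameInvariants W m W' m') (h' : SameInvariants W' m' W'' m'') :
    SameInvariants W m W'' m'' :=
  ⟨fun i => (h.total i).trans (h'.total i), fun i j hij => (h.cross i j hij).trans
    (h'.cross i j hij), fun i n h0 h1 h2 h3 => (h.writhe i n h0 h1 h2 h3).trans
    (h'.writhe i n h0 h1 (by rwa [← h.total]) (by rwa [← h.total]))⟩

theorem of_perm (hp : ∀ i, (W i).Perm (W' i))
    (hw : ∀ i, ∀ g ∈ W i, g.opp ∈ W i → weightedIndex W m i g = weightedIndex W' m' i g) :
    SameInvariants W m W' m' where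
  total i := signSum_perm (hp i)
  cross i j _ := by
    rw [crossSum, crossSum, ((hp i).map _).sum_eq]
    simp only [(hp j).mem_iff]
  writhe i n _ _ _ _ := by
    rw [weightedWrithe, weightedWrithe, ← ((hp i).map _).sum_eq]
    refine congrArg List.sum (List.map_congr_left fun g hg => ?_)
    by_cases hg' : g.opp ∈ W i
    · exact if_congr (by rw [hw i g hg hg', (hp i).mem_iff]) rfl rfl
    · have := hg'
      rw [(hp i).mem_iff] at this
      simp [hg', this]

theorem swap {a b : Endpoint} (hW : Valid W) {i : Fin 2} {l : List Endpoint}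
    (h : (W i).IsRotated (a :: b :: l)) (hab : a.chord ≠ b.chord) (m : ℕ → ℤ) :
    SameInvariants W m (swapWords a b W) (m + Pi.single a.chord ((a.sign * b.sign : ℤˣ) : ℤ) -
      Pi.single b.chord ((a.sign * b.sign : ℤˣ) : ℤ)) :=
  of_perm (fun j => (swapWords_perm hW h j).symm)
    (fun _ _ hg hg' => (weightedIndex_swap hW h hab m hg hg').symm)

end SameInvariants

theorem mem_addShell {e : Endpoint} {W : Words} (hW : Valid W) {c : ℕ} (σ : ℤˣ) {i : Fin 2}
    {x : Endpoint} (hx : x.chord ≠ c) : x ∈ addShell e c σ W i ↔ x ∈ W i := by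
  by_cases h : e ∈ W i
  · have h1 : x ≠ shellStart c σ e := fun h => hx (by rw [h]; rfl)
    have h2 : x ≠ (shellStart c σ e).opp := fun h => hx (by rw [h]; rfl)
    rw [(addShell_perm (hW.nodup_word i) h c σ).mem_iff]
    simp [h1, h2]
  · rw [addShell_of_not_mem h]

theorem SameInvariants.addShell {e : Endpoint} {W : Words} (hW : Valid W) (he : e ∈ ends W)
    {c : ℕ} (hc : NewChord c W) (σ : ℤˣ) {m : ℕ → ℤ} (hm : m c = 0) :
    SameInvariants (addShell e c σ W) m W (m + Pi.single e.chord (σ : ℤ)) := by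
  have hcW : ∀ i, ∀ x ∈ W i, x.chord ≠ c := fun i x hx => hc x (mem_ends.2 ⟨i, hx⟩)
  have hn := fun i => hW.nodup_word i
  set s := shellStart c σ e with hs
  have hV := hW.addShell he hc σ
  have hss : ∀ i j, i ≠ j → s ∈ GaussDiagram.addShell e c σ W i →
      s.opp ∉ GaussDiagram.addShell e c σ W j := by
    intro i j hij h1 h2
    have key : ∀ k x, x ∈ GaussDiagram.addShell e c σ W k → x.chord = c → e ∈ W k := by
      intro k x hx hxc
      by_contra hek
      rw [addShell_of_not_mem hek] at hx
      exact hcW k x hx hxc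
    exact hij (hW.eq_of_mem (key i _ h1 rfl) (key j _ h2 rfl))
  refine ⟨fun i => ?_, fun i j hij => ?_, fun i n _ h1 _ h2 => ?_⟩
  · by_cases h : e ∈ W i
    · rw [signSum_perm (addShell_perm (hn i) h c σ)]
      simp
    · rw [addShell_of_not_mem h]
  · rw [crossSum, crossSum]
    have hmid : ((W i).map fun g => if g.isTerminal = false ∧
        g.opp ∈ GaussDiagram.addShell e c σ W j then (g.chordSign : ℤ) else 0) =
        (W i).map fun g => if g.isTerminal = false ∧ g.opp ∈ W j then (g.chordSign : ℤ) else 0 := by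
      refine List.map_congr_left fun g hg => if_congr ?_ rfl rfl
      rw [mem_addShell hW σ (by exact hcW i g hg)]
    by_cases h : e ∈ W i
    · have hp := addShell_perm (hn i) h c σ
      rw [(hp.map _).sum_eq, List.map_cons, List.map_cons, hmid]
      have h3 := hss i j hij (hp.mem_iff.2 (by simp [hs]))
      have h4 : s ∉ GaussDiagram.addShell e c σ W j := fun h' =>
        hss j i hij.symm h' (hp.mem_iff.2 (by simp [hs]))
      simp [← hs, h3, h4]
    · rw [addShell_of_not_mem h, hmid]
  · rw [weightedWrithe, weightedWrithe]
    have hmid : ((W i).map fun g => if g.isTerminal = false ∧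
        g.opp ∈ GaussDiagram.addShell e c σ W i ∧
          weightedIndex (GaussDiagram.addShell e c σ W) m i g = n then (g.chordSign : ℤ) else 0) =
        (W i).map fun g => if g.isTerminal = false ∧ g.opp ∈ W i ∧
          weightedIndex W (m + Pi.single e.chord (σ : ℤ)) i g = n
        then (g.chordSign : ℤ) else 0 := by
      refine List.map_congr_left fun g hg => if_congr ?_ rfl rfl
      rw [mem_addShell hW σ (by exact hcW i g hg)]
      by_cases hg' : g.opp ∈ W i
      · rw [weightedIndex_addShell hW he hc σ m hg hg']
      · simp [hg']
    by_cases h : e ∈ W i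
    · have hp := addShell_perm (hn i) h c σ
      have key : ∀ g, g ∈ GaussDiagram.addShell e c σ W i → g.chord = c →
          (if g.isTerminal = false ∧ g.opp ∈ GaussDiagram.addShell e c σ W i ∧
          weightedIndex (GaussDiagram.addShell e c σ W) m i g = n then (g.chordSign : ℤ) else 0)
            = 0 := by
        intro g hg hgc
        rw [if_neg]
        rintro ⟨hgt, _, hgn⟩
        rw [weightedIndex, arcSum_of_shell hW hc σ h hg hgc hgt, hgc, hm, mul_zero,
          add_zero] at hgn
        split_ifs at hgn
        exacts [h1 hgn.symm, (h2 (by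
          rw [signSum_perm hp, ← hgn]
          simp))]
      rw [(hp.map _).sum_eq, List.map_cons, List.map_cons, hmid, List.sum_cons, List.sum_cons,
        key _ (hp.mem_iff.2 (by simp)) rfl, key _ (hp.mem_iff.2 (by simp)) rfl]
      simp
    · rw [addShell_of_not_mem h] at hmid ⊢
      rw [hmid]

theorem newChord_of_perm {W' : Words} {s : Endpoint} {l : List Endpoint} (hW' : Valid W')
    (hp : (ends W').Perm (s :: s.opp :: l)) : ∀ x ∈ l, x.chord ≠ s.chord := by
  intro x hx hc
  have hn := hp.nodup_iff.1 hW'.nodup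
  simp only [List.nodup_cons, List.mem_cons, not_or] at hn
  rcases hW'.eq_or_eq_opp (hp.mem_iff.2 (by simp)) (hp.mem_iff.2 (by simp [hx])) hc with rfl | rfl
  exacts [hn.1.2 hx, hn.2.1 hx]

theorem S1.sameInvariants {G H : GaussDiagram 2} (h : S1 G H) :
    SameInvariants G.circle 0 H.circle 0 := by
  obtain ⟨G₀, e, c, σ, he, hG, hH⟩ := h
  have hG : G.circle = addShell e c σ G₀.circle := funext hG
  have hH : H.circle = addShell e.opp c σ G₀.circle := funext hH
  have hV := valid_circle G₀
  have he : e ∈ ends G₀.circle := mem_ends.2 he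
  have hc : NewChord c G₀.circle := newChord_of_perm (valid_circle G)
    (s := shellStart c σ e) (by rw [hG]; exact ends_addShell_perm hV he c σ)
  rw [hG, hH]
  have h1 := SameInvariants.addShell hV he hc σ (m := 0) rfl
  have h2 := SameInvariants.addShell hV (hV.opp_mem e he) hc σ (m := 0) rfl
  exact h1.trans h2.symm

/-- The result of the move S2 in terms of an exchange and two added shells. -/
theorem s2_words {W : Words} {a b : Endpoint} {c d : ℕ}
    (hab : a.chord ≠ b.chord) {i : Fin 2} {l : List Endpoint}
    (h : (W i).IsRotated (a :: b :: l)) (hc : NewChord c W) (σ τ : ℤˣ) (j : Fin 2) :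
    ((W j).flatMap fun x => if x = a then b.withShell c σ
      else if x = b then a.withShell d τ else [x]) =
      addShell a d τ (addShell b c σ (swapWords a b W)) j := by
  have ha : a ∈ ends W := mem_ends.2 ⟨i, h.mem_iff.2 (by simp)⟩
  have hne : a ≠ b := fun h => hab (by rw [h])
  have h1 : shellStart c σ b ≠ a := fun h => hc a ha (by rw [← h]; rfl)
  have h2 : (shellStart c σ b).opp ≠ a := fun h => hc a ha (by rw [← h]; rfl)
  simp only [addShell, swapWords, List.flatMap_map, List.flatMap_assoc]
  refine List.flatMap_congr fun x _ => ?_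
  by_cases hxa : x = a
  · subst hxa
    simp [withShell_eq, h1, h2, hne.symm]
  · by_cases hxb : x = b
    · subst hxb
      simp [hxa, hne, withShell_eq]
    · simp [hxa, hxb, Equiv.swap_apply_of_ne_of_ne]

theorem S2.sameInvariants {G H : GaussDiagram 2} (h : S2 G H) :
    SameInvariants G.circle 0 H.circle 0 := by
  obtain ⟨a, b, c, d, hab, ⟨i, l, hi⟩, hH⟩ := h
  have hV := valid_circle G
  have hn : (a :: b :: l).Nodup := hi.perm.nodup_iff.1 (hV.nodup_word i)
  have hne : a ≠ b := fun h => hab (by rw [h])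
  set δ := a.sign * b.sign with hδ
  set s := shellStart c (-δ) b with hs
  set t := shellStart d δ a with ht
  -- The validity of `H` forces the names `c` and `d` to be new.
  have hHi : (H.circle i).Perm (s :: s.opp :: t :: t.opp :: G.circle i) := by
    rw [hH i]
    refine (hi.perm.flatMap_right _).trans ?_
    have hl : l.flatMap (fun x => if x = a then b.withShell c (-δ)
      else if x = b then a.withShell d δ else [x]) = l := by
      conv_rhs => rw [← List.flatMap_singleton' l]
      refine List.flatMap_congr fun x hx => ?_
      have : x ≠ a := by rintro rfl; simp [hx] at hn
      have : x ≠ b := by rintro rfl; simp [hx] at hn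
      simp [*]
    rw [List.flatMap_cons, List.flatMap_cons, hl]
    simp only [if_true, hne.symm, if_false, withShell_eq, ← hs, ← ht]
    refine .trans ?_ (.cons _ (.cons _ (.cons _ (.cons _ hi.perm.symm))))
    simp only [List.cons_append, List.nil_append]
    refine .cons _ ((List.perm_middle (l₁ := [s.opp, t, a, t.opp])).symm.trans ?_)
    exact .cons _ (.cons _ (.swap _ _ _))
  have hHj : ∀ j, j ≠ i → H.circle j = G.circle j := by
    intro j hj
    rw [hH j]
    conv_rhs => rw [← List.flatMap_singleton' (G.circle j)]
    refine List.flatMap_congr fun x hx => ?_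
    have h1 : x ≠ a := by rintro rfl; exact hj (hV.eq_of_mem hx (hi.mem_iff.2 (by simp)))
    have h2 : x ≠ b := by rintro rfl; exact hj (hV.eq_of_mem hx (hi.mem_iff.2 (by simp)))
    simp [h1, h2]
  have hp : (ends H.circle).Perm (s :: s.opp :: t :: t.opp :: ends G.circle) := by
    fin_cases i
    · rw [ends, hHj 1 (by decide)]
      exact hHi.append_right _
    · rw [ends, hHj 0 (by decide)]
      refine (hHi.append_left _).trans ?_
      exact List.perm_append_comm_assoc _ [s, s.opp, t, t.opp] _
  have hc1 := newChord_of_perm (valid_circle H) hp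
  have hd1 := newChord_of_perm (valid_circle H) (s := t)
    (l := s :: s.opp :: ends G.circle)
    (hp.trans (List.perm_append_comm_assoc [s, s.opp] [t, t.opp] _))
  have hc : NewChord c G.circle := fun x hx => hc1 x (by simp [hx])
  have hd : NewChord d G.circle := fun x hx => hd1 x (by simp [hx])
  have hcd : c ≠ d := hd1 s (by simp)
  have hE : H.circle = addShell a d δ (addShell b c (-δ) (swapWords a b G.circle)) := by
    funext j
    rw [hH j, s2_words hab hi hc]
  have hVs := hV.swapWords hi
  have hps := ends_perm (fun j => swapWords_perm hV hi j)
  have hbG : b ∈ ends G.circle := mem_ends.2 ⟨i, hi.mem_iff.2 (by simp)⟩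
  have haG : a ∈ ends G.circle := mem_ends.2 ⟨i, hi.mem_iff.2 (by simp)⟩
  have hcs : NewChord c (swapWords a b G.circle) := fun x hx => hc x (hps.mem_iff.1 hx)
  have hbs := hps.mem_iff.2 hbG
  have hpb := ends_addShell_perm hVs hbs c (-δ)
  have hds : NewChord d (addShell b c (-δ) (swapWords a b G.circle)) := by
    intro x hx
    rcases List.mem_cons.1 (hpb.mem_iff.1 hx) with rfl | hx
    · exact hcd
    rcases List.mem_cons.1 hx with rfl | hx
    · exact hcd
    · exact hd x (hps.mem_iff.1 hx)
  have h1 := SameInvariants.addShell (hVs.addShell hbs hcs (-δ)) (hpb.mem_iff.2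
    (by simp [hps.mem_iff.2 haG] : a ∈ _)) hds δ (m := 0) rfl
  have h2 := SameInvariants.addShell hVs hbs hcs (-δ) (m := 0 + Pi.single a.chord (δ : ℤ))
    (by simp [(hc a haG).symm])
  have h3 := SameInvariants.swap hV hi hab 0
  rw [hE]
  refine h3.trans ?_
  have := (h1.trans h2).symm
  rw [Units.val_neg, Pi.single_neg, ← sub_eq_add_neg] at this
  exact this

theorem swapWords_isRotated {W : Words} {a b p q : Endpoint} {i : Fin 2} {l : List Endpoint}
    (h : (W i).IsRotated (a :: b :: l)) (h1 : a ≠ p) (h2 : a ≠ q) (h3 : b ≠ p) (h4 : b ≠ q) :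
    (swapWords p q W i).IsRotated (a :: b :: l.map (Equiv.swap p q)) := by
  have := h.map (Equiv.swap p q)
  rwa [List.map_cons, List.map_cons, Equiv.swap_apply_of_ne_of_ne h1 h2,
    Equiv.swap_apply_of_ne_of_ne h3 h4] at this

theorem swapWords_comm (a b : Endpoint) (W : Words) : swapWords a b W = swapWords b a W := by
  funext i
  rw [swapWords, swapWords, Equiv.swap_comm]

/-- On the circle of the words, `b` comes immediately after `a` if `κ = 1`, and immediately before
`a` if `κ = -1`. -/
def AdjacentIn (W : Words) (κ : ℤˣ) (a b : Endpoint) : Prop :=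
  ∃ i l, (W i).IsRotated (if κ = 1 then a :: b :: l else b :: a :: l)

theorem AdjacentBy.adjacentIn {G : GaussDiagram 2} {κ : ℤˣ} {a b : Endpoint}
    (h : G.AdjacentBy κ a b) : AdjacentIn G.circle κ a b := by
  unfold AdjacentBy at h
  unfold AdjacentIn
  split_ifs at h ⊢ <;> exact h

theorem AdjacentIn.swapWords {W : Words} {κ : ℤˣ} {a b p q : Endpoint}
    (h : AdjacentIn W κ a b) (h1 : a ≠ p) (h2 : a ≠ q) (h3 : b ≠ p) (h4 : b ≠ q) :
    AdjacentIn (swapWords p q W) κ a b := by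
  obtain ⟨i, l, hl⟩ := h
  refine ⟨i, l.map (Equiv.swap p q), ?_⟩
  split_ifs at hl ⊢
  · exact swapWords_isRotated hl h1 h2 h3 h4
  · exact swapWords_isRotated hl h3 h4 h1 h2

theorem AdjacentIn.valid_swapWords {W : Words} (hW : Valid W) {κ : ℤˣ} {a b : Endpoint}
    (h : AdjacentIn W κ a b) : Valid (GaussDiagram.swapWords a b W) := by
  obtain ⟨i, l, hl⟩ := h
  split_ifs at hl
  · exact hW.swapWords hl
  · have := hW.swapWords hl
    rwa [swapWords_comm] at this

theorem AdjacentIn.sameInvariants {W : Words} (hW : Valid W) {κ : ℤˣ} {a b : Endpoint}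
    (h : AdjacentIn W κ a b) (hab : a.chord ≠ b.chord) (m : ℕ → ℤ) :
    SameInvariants W m (GaussDiagram.swapWords a b W)
      (m + Pi.single a.chord ((κ * (a.sign * b.sign) : ℤˣ) : ℤ) -
      Pi.single b.chord ((κ * (a.sign * b.sign) : ℤˣ) : ℤ)) := by
  obtain ⟨i, l, hl⟩ := h
  split_ifs at hl with hκ
  · rw [hκ, one_mul]
    exact SameInvariants.swap hW hl hab m
  · have := SameInvariants.swap hW hl hab.symm m
    rw [swapWords_comm] at this
    rw [(Int.units_eq_one_or κ).resolve_left hκ, neg_one_mul, Units.val_neg, Pi.single_neg,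
      Pi.single_neg, mul_comm a.sign]
    convert this using 1
    abel

theorem R3.sameInvariants {G H : GaussDiagram 2} (h : R3 G H) :
    SameInvariants G.circle 0 H.circle 0 := by
  obtain ⟨x, y, z, εx, εy, εz, κ, hxy, hxz, hyz, h1, h2, h3, hH⟩ := h
  set xi : Endpoint := ⟨x, false, εx⟩
  set xt : Endpoint := ⟨x, true, εx⟩
  set yi : Endpoint := ⟨y, false, εy⟩
  set yt : Endpoint := ⟨y, true, εy⟩
  set zi : Endpoint := ⟨z, false, εz⟩
  set zt : Endpoint := ⟨z, true, εz⟩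
  have hE : H.circle = swapWords xi yi (swapWords xt zi (swapWords yt zt G.circle)) := by
    funext i
    rw [hH i]
    simp [swapWords, List.map_map, Function.comp_def]
  have hV := valid_circle G
  have a3 := h3.adjacentIn
  have V3 := a3.valid_swapWords hV
  have a2 : AdjacentIn (swapWords yt zt G.circle) (κ * εz) xt zi :=
    h2.adjacentIn.swapWords (by simp [xt, yt, hxy]) (by simp [xt, zt, hxz])
      (by simp [zi, yt]) (by simp [zi, zt])
  have V2 := a2.valid_swapWords V3
  have a1 : AdjacentIn (swapWords xt zi (swapWords yt zt G.circle)) (κ * εy) xi yi :=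
    (h1.adjacentIn.swapWords (by simp [xi, yt]) (by simp [xi, zt])
      (by simp [yi, yt]) (by simp [yi, zt])).swapWords (by simp [xi, xt])
      (by simp [xi, zi, hxz]) (by simp [yi, xt]) (by simp [yi, zi, hyz])
  have := ((a3.sameInvariants hV hyz 0).trans (a2.sameInvariants V3 hxz _)).trans
    (a1.sameInvariants V2 hxy _)
  rw [hE]
  have sx : xi.sign = -εx := rfl
  have sx' : xt.sign = εx := rfl
  have sy : yi.sign = -εy := rfl
  have sy' : yt.sign = εy := rfl
  have sz : zi.sign = -εz := rfl
  have sz' : zt.sign = εz := rfl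
  have e1 : κ * (εx * εy * εz) * (yt.sign * zt.sign) = κ * εx := by
    rw [sy', sz']
    rcases Int.units_eq_one_or εy with h | h <;> rcases Int.units_eq_one_or εz with h' | h' <;>
      simp [h, h']
  have e2 : κ * εz * (xt.sign * zi.sign) = -(κ * εx) := by
    rw [sx', sz]
    rcases Int.units_eq_one_or εz with h' | h' <;> simp [h']
  have e3 : κ * εy * (xi.sign * yi.sign) = κ * εx := by
    rw [sx, sy]
    rcases Int.units_eq_one_or εy with h' | h' <;> simp [h']
  rw [e1, e2, e3] at this
  convert this using 1
  simp only [xi, xt, yi, yt, zi, zt, Units.val_neg, Pi.single_neg]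
  abel

end GaussDiagram

/-! ### Invariance under the moves -/

namespace GaussDiagram

open Endpoint

theorem relabel_injective (f : Equiv.Perm ℕ) : Function.Injective (relabel f) := by
  rintro ⟨c, t, s⟩ ⟨c', t', s'⟩ h
  simpa [relabel] using h

@[simp] theorem sign_relabel (f : Equiv.Perm ℕ) (e : Endpoint) : (relabel f e).sign = e.sign := rfl

theorem opp_relabel (f : Equiv.Perm ℕ) (e : Endpoint) : (relabel f e).opp = relabel f e.opp := rfl

@[simp] theorem signSum_map_relabel (f : Equiv.Perm ℕ) (w : List Endpoint) :
    signSum (w.map (relabel f)) = signSum w := by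
  simp [signSum, Function.comp_def]

/-- The words with the chords renamed. -/
def relabelWords (f : Equiv.Perm ℕ) (W : Words) : Words := fun i => (W i).map (relabel f)

theorem relabelWords_apply (f : Equiv.Perm ℕ) (W : Words) (i : Fin 2) :
    relabelWords f W i = (W i).map (relabel f) := rfl

theorem mem_relabelWords {f : Equiv.Perm ℕ} {W : Words} {i : Fin 2} {g : Endpoint} :
    relabel f g ∈ relabelWords f W i ↔ g ∈ W i :=
  List.mem_map_of_injective (relabel_injective f)

theorem ends_relabelWords (f : Equiv.Perm ℕ) (W : Words) :
    ends (relabelWords f W) = (ends W).map (relabel f) := by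
  simp [ends, relabelWords]

theorem Valid.relabelWords {W : Words} (hW : Valid W) (f : Equiv.Perm ℕ) :
    Valid (relabelWords f W) where
  nodup := by
    rw [ends_relabelWords]
    exact hW.nodup.map (relabel_injective f)
  opp_mem e he := by
    rw [ends_relabelWords] at he ⊢
    obtain ⟨x, hx, rfl⟩ := List.mem_map.1 he
    exact List.mem_map.2 ⟨x.opp, hW.opp_mem x hx, rfl⟩
  sign_eq e he g hg h := by
    rw [ends_relabelWords] at he hg
    obtain ⟨x, hx, rfl⟩ := List.mem_map.1 he
    obtain ⟨y, hy, rfl⟩ := List.mem_map.1 hg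
    exact hW.sign_eq x hx y hy (f.injective h)

theorem arcSum_relabel (f : Equiv.Perm ℕ) {w : List Endpoint} {g : Endpoint} (hn : w.Nodup)
    (hg : g ∈ w) (hg' : g.opp ∈ w) : arcSum (w.map (relabel f)) (relabel f g) = arcSum w g := by
  obtain ⟨u, v, h⟩ := exists_isRotated hg hg' g.ne_opp
  rw [arcSum_of_isRotated hn h, arcSum_of_isRotated (u := u.map (relabel f))
    (v := v.map (relabel f)) (hn.map (relabel_injective f)), signSum_map_relabel]
  have := h.map (relabel f)
  simpa [opp_relabel] using this

theorem SameInvariants.relabel {W : Words} (hW : Valid W) (f : Equiv.Perm ℕ) :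
    SameInvariants W 0 (relabelWords f W) 0 where
  total i := by simp [relabelWords]
  cross i j _ := by
    rw [crossSum, crossSum, relabelWords_apply f W i, List.map_map]
    refine congrArg List.sum (List.map_congr_left fun g _ => if_congr ?_ rfl rfl)
    rw [opp_relabel, mem_relabelWords]
    rfl
  writhe i n _ _ _ _ := by
    rw [weightedWrithe, weightedWrithe]
    conv_rhs => arg 1; arg 2; rw [relabelWords_apply]
    rw [List.map_map]
    refine congrArg List.sum (List.map_congr_left fun g hg => if_congr ?_ rfl rfl)
    have h1 : (Endpoint.relabel f g).opp ∈ relabelWords f W i ↔ g.opp ∈ W i := by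
      rw [opp_relabel, mem_relabelWords]
    change _ ↔ g.isTerminal = false ∧ (Endpoint.relabel f g).opp ∈ relabelWords f W i ∧ _
    rw [h1]
    by_cases hg' : g.opp ∈ W i
    · simp [weightedIndex, relabelWords, arcSum_relabel f (hW.nodup_word i) hg hg']
    · simp [hg']

theorem SameInvariants.rotate {W W' : Words} (hW : Valid W)
    (h : ∀ i, (W i).IsRotated (W' i)) (m : ℕ → ℤ) : SameInvariants W m W' m :=
  of_perm (fun i => (h i).perm) fun i g hg hg' => by
    rw [weightedIndex, weightedIndex, arcSum_congr (hW.nodup_word i) (h i) hg hg']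

theorem Iso.sameInvariants {G H : GaussDiagram 2} (h : Iso G H) :
    SameInvariants G.circle 0 H.circle 0 := by
  obtain ⟨f, hf⟩ := h
  exact (SameInvariants.relabel (valid_circle G) f).trans
    (SameInvariants.rotate ((valid_circle G).relabelWords f) (fun i => (hf i).symm) 0)

/-- Deleting chords does not change the invariants when the remaining arcs keep their sums and the
contributions of the deleted endpoints, those in `X`, cancel. -/
theorem SameInvariants.filter {W : Words} (p : Endpoint → Bool)
    (hp : ∀ x, p x.opp = p x) {X : Words}
    (hX : ∀ i, ((W i).filter fun x => !p x).Perm (X i))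
    (harc : ∀ i, ∀ g ∈ W i, g.opp ∈ W i → p g → arcSum ((W i).filter p) g = arcSum (W i) g)
    (htot : ∀ i, signSum (X i) = 0)
    (hcross : ∀ i j, i ≠ j → ((X i).map fun g => if g.isTerminal = false ∧ g.opp ∈ W j
      then (g.chordSign : ℤ) else 0).sum = 0)
    (hwr : ∀ i n, n ≠ 0 → n ≠ signSum (W i) → ((X i).map fun g =>
      if g.isTerminal = false ∧ g.opp ∈ W i ∧ arcSum (W i) g = n
      then (g.chordSign : ℤ) else 0).sum = 0) :
    SameInvariants W 0 (fun i => (W i).filter p) 0 := by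
  have hperm : ∀ i, (W i).Perm ((W i).filter p ++ X i) := fun i =>
    (List.filter_append_perm p (W i)).symm.trans ((hX i).append_left _)
  refine ⟨fun i => ?_, fun i j hij => ?_, fun i n h0 _ h1 _ => ?_⟩
  · rw [signSum_perm (hperm i), signSum_append, htot, add_zero]
  · rw [crossSum, crossSum, ((hperm i).map _).sum_eq, List.map_append, List.sum_append,
      hcross i j hij, add_zero]
    refine congrArg List.sum (List.map_congr_left fun g hg => if_congr ?_ rfl rfl)
    simp [hp, (List.mem_filter.1 hg).2]
  · rw [weightedWrithe, weightedWrithe, ((hperm i).map _).sum_eq, List.map_append,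
      List.sum_append]
    simp only [weightedIndex, Pi.zero_apply, mul_zero, add_zero]
    rw [hwr i n h0 h1, add_zero]
    refine congrArg List.sum (List.map_congr_left fun g hg => if_congr ?_ rfl rfl)
    have hg := List.mem_filter.1 hg
    by_cases hg' : g.opp ∈ W i
    · simp [hp, hg.2, hg', harc i g hg.1 hg' hg.2]
    · simp [hg']

theorem isRotated_filter {α : Type*} {w w' : List α} (h : w.IsRotated w') (p : α → Bool) :
    (w.filter p).IsRotated (w'.filter p) := by
  obtain ⟨n, hn, rfl⟩ := List.isRotated_iff_mod.1 h
  rw [List.rotate_eq_drop_append_take hn, List.filter_append]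
  conv_lhs => rw [← List.take_append_drop n w, List.filter_append]
  exact isRotated_append_comm _ _

theorem filter_pair_isRotated {w l : List Endpoint} {x y : Endpoint} (hn : w.Nodup)
    (h : w.IsRotated (x :: y :: l)) :
    (w.filter fun z => z ≠ x ∧ z ≠ y).IsRotated l := by
  have hn' := h.perm.nodup_iff.1 hn
  simp only [List.nodup_cons, List.mem_cons, not_or] at hn'
  have h1 : (x :: y :: l).filter (fun z => z ≠ x ∧ z ≠ y) = l := by
    rw [List.filter_cons_of_neg (by simp), List.filter_cons_of_neg (by simp),
      List.filter_eq_self]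
    intro z hz
    have : z ≠ x := fun h => hn'.1.2 (h ▸ hz)
    have : z ≠ y := fun h => hn'.2.1 (h ▸ hz)
    simp [*]
  have := isRotated_filter h (fun z => z ≠ x ∧ z ≠ y)
  rwa [h1] at this

theorem filter_pair_of_not_mem {w : List Endpoint} {x y : Endpoint} (hx : x ∉ w) (hy : y ∉ w) :
    (w.filter fun z => z ≠ x ∧ z ≠ y) = w := by
  rw [List.filter_eq_self]
  intro z hz
  have : z ≠ x := fun h => hx (h ▸ hz)
  have : z ≠ y := fun h => hy (h ▸ hz)
  simp [*]

theorem arcSum_filter_pair {w l : List Endpoint} {x y g : Endpoint} (hn : w.Nodup)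
    (h : w.IsRotated (x :: y :: l)) (hs : (x.sign : ℤ) + y.sign = 0) (hg : g ∈ w)
    (hg' : g.opp ∈ w) (hgx : g ≠ x) (hgy : g ≠ y) (hgx' : g.opp ≠ x) (hgy' : g.opp ≠ y) :
    arcSum (w.filter fun z => z ≠ x ∧ z ≠ y) g = arcSum w g := by
  have h1 := filter_pair_isRotated hn h
  have hl : ∀ {z}, z ∈ w → z ≠ x → z ≠ y → z ∈ l := fun {z} hz h1 h2 => by
    have := h.mem_iff.1 hz
    simpa [h1, h2] using this
  have hn' := h.perm.nodup_iff.1 hn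
  have hgl := hl hg hgx hgy
  have hgl' := hl hg' hgx' hgy'
  rw [arcSum_congr (hn.filter _) h1 (h1.mem_iff.2 hgl) (h1.mem_iff.2 hgl'),
    arcSum_congr hn h hg hg']
  refine arcSum_append_congr (p := []) (q := [x, y]) ?_ hn' (by simp [← hs]) hgl hgl'
  exact (List.nodup_cons.1 (List.nodup_cons.1 hn').2).2

theorem R1.sameInvariants {G H : GaussDiagram 2} (h : R1 G H) :
    SameInvariants G.circle 0 H.circle 0 := by
  obtain ⟨e, ⟨i, l, hi⟩, hH⟩ := h
  have hV := valid_circle G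
  have hE : H.circle = fun j => (G.circle j).filter fun x => x.chord ≠ e.chord := funext hH
  have he : e ∈ G.circle i := hi.mem_iff.2 (by simp)
  have he' : e.opp ∈ G.circle i := hi.mem_iff.2 (by simp)
  have hch : ∀ {j z}, z ∈ G.circle j → (z.chord = e.chord ↔ z = e ∨ z = e.opp) :=
    fun {j z} hz => ⟨hV.eq_or_eq_opp (mem_ends.2 ⟨i, he⟩) (mem_ends.2 ⟨j, hz⟩), by
      rintro (rfl | rfl) <;> rfl⟩
  have hnot : ∀ {j}, j ≠ i → e ∉ G.circle j ∧ e.opp ∉ G.circle j := fun hj =>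
    ⟨fun h => hj (hV.eq_of_mem h he), fun h => hj (hV.eq_of_mem h he')⟩
  rw [hE]
  refine SameInvariants.filter (X := fun j => if j = i then [e, e.opp] else []) _ (fun x => rfl)
    ?_ ?_ ?_ ?_ ?_
  · intro j
    rw [List.perm_ext_iff_of_nodup ((hV.nodup_word j).filter _) (by split_ifs <;> simp)]
    intro z
    by_cases hj : j = i
    · subst hj
      simp only [List.mem_filter, if_true, decide_not, Bool.not_not, decide_eq_true_eq,
        List.mem_cons, List.not_mem_nil, or_false]
      constructor
      · rintro ⟨h1, h2⟩
        exact (hch h1).1 h2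
      · rintro (rfl | rfl)
        exacts [⟨he, rfl⟩, ⟨he', rfl⟩]
    · simp only [hj, if_false, List.mem_filter, List.not_mem_nil, iff_false]
      rintro ⟨h1, h2⟩
      have h3 : z.chord = e.chord := by simpa using h2
      rcases (hch h1).1 h3 with rfl | rfl
      exacts [(hnot hj).1 h1, (hnot hj).2 h1]
  · intro j g hg hg' hgc
    have hgc : g.chord ≠ e.chord := by simpa using hgc
    have hf : ((G.circle j).filter fun x => x.chord ≠ e.chord) =
        (G.circle j).filter fun z => z ≠ e ∧ z ≠ e.opp := by
      refine List.filter_congr fun z hz => ?_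
      simp [hch hz]
    rw [hf]
    by_cases hj : j = i
    · subst hj
      refine arcSum_filter_pair (hV.nodup_word j) hi (by simp) hg hg' ?_ ?_ ?_ ?_ <;>
        · intro h
          apply hgc
          first
            | rw [h]; done
            | rw [h]; rfl
            | rw [← chord_opp, h]; done
            | rw [← chord_opp, h]; rfl
    · rw [filter_pair_of_not_mem (hnot hj).1 (hnot hj).2]
  · intro j
    split_ifs <;> simp
  · intro j k hjk
    split_ifs with hj
    · subst hj
      simp [(hnot hjk.symm).1, (hnot hjk.symm).2]
    · rfl
  · intro j n h0 h1
    split_ifs with hj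
    · subst hj
      have hn := hV.nodup_word j
      have a1 : arcSum (G.circle j) e = 0 := by
        rw [arcSum_of_isRotated (u := []) (v := l) hn (by simpa using hi)]
        rfl
      have a2 : arcSum (G.circle j) e.opp = signSum (G.circle j) := by
        rw [arcSum_of_isRotated (u := l) (v := []) hn, signSum_perm hi.perm]
        · simp
        · simpa using hi.trans (isRotated_append_comm [e] (e.opp :: l))
      simp [a1, a2, h0.symm, h1.symm]
    · rfl

/-- Two chords of opposite signs with adjacent initial and adjacent terminal endpoints on one
circle have the same index. -/
theorem arcSum_eq_of_parallel {w l l' : List Endpoint} {a b : Endpoint} (hn : w.Nodup)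
    (hab : w.IsRotated (a :: b :: l))
    (hab' : w.IsRotated (a.opp :: b.opp :: l') ∨ w.IsRotated (b.opp :: a.opp :: l'))
    (hs : (a.sign : ℤ) + b.sign = 0) (hne : a ≠ b.opp) : arcSum w a = arcSum w b := by
  have hn1 := hab.perm.nodup_iff.1 hn
  have hne' : b ≠ a.opp := fun h => hne (by rw [h, opp_opp])
  -- In the word `a :: b :: l`, the second pair is not cut by the base point.
  have key : ∀ {x y : Endpoint} {l' : List Endpoint}, w.IsRotated (x :: y :: l') → a ≠ x → a ≠ y →
      b ≠ x → b ≠ y → ∃ u v, l = u ++ x :: y :: v := by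
    intro x y l' h h1 h2 h3 h4
    obtain ⟨n, hn2, hr⟩ := List.isRotated_iff_mod.1 (h.symm.trans hab)
    rw [List.rotate_eq_drop_append_take hn2] at hr
    rcases n with _ | _ | n
    · simp at hr; exact absurd hr.1.symm h1
    · simp at hr; exact absurd hr.1.symm h2
    · simp only [List.drop_succ_cons, List.take_succ_cons] at hr
      rcases h5 : l'.drop n with _ | ⟨p, _ | ⟨q, s⟩⟩
      · simp [h5] at hr; exact absurd hr.1.symm h1
      · simp [h5] at hr; exact absurd hr.2.1.symm h3
      · simp only [h5, List.cons_append, List.cons.injEq] at hr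
        exact ⟨s, l'.take n, hr.2.2.symm⟩
  rcases hab' with h | h
  · obtain ⟨u, v, rfl⟩ := key h a.ne_opp hne hne' b.ne_opp
    rw [arcSum_of_isRotated (u := b :: u) (v := b.opp :: v) hn (by simpa using hab),
      arcSum_of_isRotated (u := u ++ [a.opp]) (v := v ++ [a]) hn
        (hab.trans (by simpa using isRotated_append_comm [a] (b :: (u ++ a.opp :: b.opp :: v))))]
    simp
    linear_combination hs
  · obtain ⟨u, v, rfl⟩ := key h hne a.ne_opp b.ne_opp hne'
    rw [arcSum_of_isRotated (u := b :: (u ++ [b.opp])) (v := v) hn (by simpa using hab),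
      arcSum_of_isRotated (u := u) (v := a.opp :: (v ++ [a])) hn
        (hab.trans (by simpa using isRotated_append_comm [a] (b :: (u ++ b.opp :: a.opp :: v))))]
    simp

theorem R2.sameInvariants {G H : GaussDiagram 2} (h : R2 G H) :
    SameInvariants G.circle 0 H.circle 0 := by
  obtain ⟨a, b, ha, hb, hs, ⟨i, l, hi⟩, hadj, hH⟩ := h
  obtain ⟨k, l', hk⟩ : ∃ k l', (G.circle k).IsRotated (a.opp :: b.opp :: l') ∨
      (G.circle k).IsRotated (b.opp :: a.opp :: l') := by
    rcases hadj with ⟨k, l', h⟩ | ⟨k, l', h⟩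
    exacts [⟨k, l', .inl h⟩, ⟨k, l', .inr h⟩]
  have hV := valid_circle G
  have hE : H.circle = fun j => (G.circle j).filter fun x => x.chord ≠ a.chord ∧
    x.chord ≠ b.chord := funext hH
  have hai : a ∈ G.circle i := hi.mem_iff.2 (by simp)
  have hbi : b ∈ G.circle i := hi.mem_iff.2 (by simp)
  have hak : a.opp ∈ G.circle k := by rcases hk with h | h <;> exact h.mem_iff.2 (by simp)
  have hbk : b.opp ∈ G.circle k := by rcases hk with h | h <;> exact h.mem_iff.2 (by simp)
  have hab : a.chord ≠ b.chord := fun h => by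
    have h1 := hV.sign_eq_word i i a hai b hbi h
    rw [hs] at h1
    rcases Int.units_eq_one_or a.chordSign with h2 | h2 <;> rw [h2] at h1 <;>
      exact absurd h1 (by decide)
  have hne : a ≠ b.opp := fun h => hab (by rw [h]; rfl)
  have hne0 : a ≠ b := fun h => hab (by rw [h])
  have hsum : (a.sign : ℤ) + b.sign = 0 := by
    rw [sign_of_initial ha, sign_of_initial hb, hs]; simp
  have hch : ∀ {j z}, z ∈ G.circle j → (z.chord = a.chord ↔ z = a ∨ z = a.opp) :=
    fun {j z} hz => ⟨hV.eq_or_eq_opp (mem_ends.2 ⟨i, hai⟩) (mem_ends.2 ⟨j, hz⟩), by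
      rintro (rfl | rfl) <;> rfl⟩
  have hch' : ∀ {j z}, z ∈ G.circle j → (z.chord = b.chord ↔ z = b ∨ z = b.opp) :=
    fun {j z} hz => ⟨hV.eq_or_eq_opp (mem_ends.2 ⟨i, hbi⟩) (mem_ends.2 ⟨j, hz⟩), by
      rintro (rfl | rfl) <;> rfl⟩
  have hnot : ∀ {j}, j ≠ i → a ∉ G.circle j ∧ b ∉ G.circle j := fun hj =>
    ⟨fun h => hj (hV.eq_of_mem h hai), fun h => hj (hV.eq_of_mem h hbi)⟩
  have hnot' : ∀ {j}, j ≠ k → a.opp ∉ G.circle j ∧ b.opp ∉ G.circle j := fun hj =>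
    ⟨fun h => hj (hV.eq_of_mem h hak), fun h => hj (hV.eq_of_mem h hbk)⟩
  have hmem : ∀ j, a.opp ∈ G.circle j ↔ b.opp ∈ G.circle j := fun j =>
    ⟨fun h => hV.eq_of_mem h hak ▸ hbk, fun h => hV.eq_of_mem h hbk ▸ hak⟩
  have hεs : (b.chordSign : ℤ) = -a.chordSign := by rw [hs]; simp
  rw [hE]
  refine SameInvariants.filter (X := fun j => (if j = i then [a, b] else []) ++
    if j = k then [a.opp, b.opp] else []) _ (fun x => rfl) ?_ ?_ ?_ ?_ ?_
  · intro j
    rw [List.perm_ext_iff_of_nodup ((hV.nodup_word j).filter _) (by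
      split_ifs <;> simp [hne0, hne, opp_injective.ne hne0,
        show b ≠ a.opp from fun h => hne (by rw [h, opp_opp])])]
    intro z
    rw [List.mem_filter]
    constructor
    · rintro ⟨h1, h2⟩
      have h3 : (z = a ∨ z = a.opp) ∨ z = b ∨ z = b.opp := by
        rw [← hch h1, ← hch' h1]
        by_contra hcon
        simp_all
      rcases h3 with (rfl | rfl) | rfl | rfl
      · simp [hV.eq_of_mem h1 hai]
      · simp [hV.eq_of_mem h1 hak]
      · simp [hV.eq_of_mem h1 hbi]
      · simp [hV.eq_of_mem h1 hbk]
    · intro h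
      rw [List.mem_append] at h
      rcases h with h | h <;> split_ifs at h with hj
      · subst hj
        simp only [List.mem_cons, List.not_mem_nil, or_false] at h
        rcases h with rfl | rfl
        · simp [hai]
        · simp [hbi]
      · simp at h
      · subst hj
        simp only [List.mem_cons, List.not_mem_nil, or_false] at h
        rcases h with rfl | rfl
        · simp [hak]
        · simp [hbk]
      · simp at h
  · intro j g hg hg' hgc
    have hgc : g.chord ≠ a.chord ∧ g.chord ≠ b.chord := by simpa using hgc
    have g1 : g ≠ a := fun h => hgc.1 (by rw [h])
    have g2 : g ≠ b := fun h => hgc.2 (by rw [h])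
    have g3 : g ≠ a.opp := fun h => hgc.1 (by rw [h]; rfl)
    have g4 : g ≠ b.opp := fun h => hgc.2 (by rw [h]; rfl)
    have g5 : g.opp ≠ a := fun h => hgc.1 (by rw [← h]; rfl)
    have g6 : g.opp ≠ b := fun h => hgc.2 (by rw [← h]; rfl)
    have g7 := opp_injective.ne g1
    have g8 := opp_injective.ne g2
    have hf : ((G.circle j).filter fun x => x.chord ≠ a.chord ∧ x.chord ≠ b.chord) =
        ((G.circle j).filter fun z => z ≠ a ∧ z ≠ b).filter
          fun z => z ≠ a.opp ∧ z ≠ b.opp := by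
      rw [List.filter_filter]
      refine List.filter_congr fun z hz => ?_
      have h1 := hch hz
      have h2 := hch' hz
      rw [Bool.eq_iff_iff]
      simp only [Bool.and_eq_true, decide_eq_true_eq]
      tauto
    rw [hf]
    have h1 : arcSum ((G.circle j).filter fun z => z ≠ a ∧ z ≠ b) g = arcSum (G.circle j) g := by
      by_cases hj : j = i
      · subst hj
        exact arcSum_filter_pair (hV.nodup_word j) hi hsum hg hg' g1 g2 g5 g6
      · rw [filter_pair_of_not_mem (hnot hj).1 (hnot hj).2]
    rw [← h1]
    have hm : ∀ {z}, z ∈ G.circle j → z ≠ a → z ≠ b →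
        z ∈ (G.circle j).filter fun z => z ≠ a ∧ z ≠ b := fun hz h1 h2 => by simp [hz, h1, h2]
    by_cases hj : j = k
    · subst hj
      rcases hk with hk | hk
      · have hk' := isRotated_filter hk (fun z => z ≠ a ∧ z ≠ b)
        rw [List.filter_cons_of_pos (by simp [opp_eq_iff]; tauto),
          List.filter_cons_of_pos (by simp [hne.symm])] at hk'
        exact arcSum_filter_pair ((hV.nodup_word j).filter _) hk'
          (by simp; linear_combination -hsum) (hm hg g1 g2) (hm hg' g5 g6) g3 g4 g7 g8
      · have hk' := isRotated_filter hk (fun z => z ≠ a ∧ z ≠ b)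
        rw [List.filter_cons_of_pos (by simp [hne.symm]),
          List.filter_cons_of_pos (by simp [opp_eq_iff]; tauto)] at hk'
        have := arcSum_filter_pair ((hV.nodup_word j).filter _) hk'
          (by simp; linear_combination -hsum) (hm hg g1 g2) (hm hg' g5 g6) g4 g3 g8 g7
        simp only [and_comm (a := _ ≠ a.opp)]
        exact this
    · have := hnot' hj
      rw [filter_pair_of_not_mem (fun h => this.1 (List.mem_filter.1 h).1)
        (fun h => this.2 (List.mem_filter.1 h).1)]
  · intro j
    rw [signSum_append]
    split_ifs <;> simp <;> linarith
  · intro j j' _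
    have := hmem j'
    rw [List.map_append, List.sum_append]
    split_ifs <;> simp [ha, hb, this, hεs] <;> split_ifs <;> simp
  · intro j n _ _
    have := hmem j
    rw [List.map_append, List.sum_append]
    by_cases hj : j = i
    · subst hj
      by_cases hjk : j = k
      · subst hjk
        have := arcSum_eq_of_parallel (hV.nodup_word j) hi hk hsum hne
        simp [ha, hb, hak, hbk, this, hεs]
        split_ifs <;> simp
      · simp [hjk, (hnot' hjk).1, (hnot' hjk).2]
    · split_ifs <;> simp [ha, hb]

theorem SMove.sameInvariants {G H : GaussDiagram 2} (h : SMove G H) :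
    SameInvariants G.circle 0 H.circle 0 := by
  rcases h with h | h | h
  · rcases h with h | h | h | h
    exacts [h.sameInvariants, h.sameInvariants, h.sameInvariants, h.sameInvariants]
  · exact h.sameInvariants
  · exact h.sameInvariants

theorem SEquiv.sameInvariants {G H : GaussDiagram 2} (h : SEquiv G H) :
    SameInvariants G.circle 0 H.circle 0 := by
  induction h with
  | rel _ _ h => exact h.sameInvariants
  | refl => exact .refl _ _
  | symm _ _ _ ih => exact ih.symm
  | trans _ _ _ _ _ ih ih' => exact ih.trans ih'

end GaussDiagram

/-! ### S-classes of words, and diagrams with shells -/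

namespace GaussDiagram

open Endpoint

/-- The Gauss diagrams on two circles up to S-equivalence. -/
abbrev SClass : Type := Quotient (Relation.EqvGen.setoid (SMove (μ := 2)))

open Classical in
/-- The S-equivalence class of the diagram with the given words; for words that are not valid it is
the class of the diagram without chords, a value that is never used. -/
noncomputable def sClass (W : Words) : SClass :=
  if h : Valid W then Quotient.mk _ h.toDiagram
  else Quotient.mk _ (Valid.toDiagram (W := fun _ => [])
    ⟨List.nodup_nil, fun e he => absurd he (by simp [ends]),
      fun e he => absurd he (by simp [ends])⟩)

theorem sClass_of_valid {W : Words} (h : Valid W) : sClass W = Quotient.mk _ h.toDiagram := by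
  rw [sClass, dif_pos h]

theorem sClass_circle (G : GaussDiagram 2) : sClass G.circle = Quotient.mk _ G := by
  rw [sClass_of_valid (valid_circle G)]
  rfl

theorem sClass_eq_of_sMove {W W' : Words} (h : Valid W) (h' : Valid W')
    (hm : SMove h.toDiagram h'.toDiagram) : sClass W = sClass W' := by
  rw [sClass_of_valid h, sClass_of_valid h']
  exact Quotient.sound (.rel _ _ hm)

theorem sClass_relabel {W W' : Words} (h : Valid W) (f : Equiv.Perm ℕ)
    (hW : ∀ i, (W' i).IsRotated (relabelWords f W i)) : sClass W = sClass W' :=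
  sClass_eq_of_sMove h ((h.relabelWords f).of_perm (ends_perm fun i => (hW i).perm.symm))
    (.reidemeister (.iso ⟨f, hW⟩))

theorem relabelWords_one (W : Words) : relabelWords 1 W = W := by
  funext i
  rw [relabelWords_apply]
  conv_rhs => rw [← List.map_id (W i)]
  rfl

theorem sClass_rotate {W W' : Words} (h : Valid W) (hW : ∀ i, (W' i).IsRotated (W i)) :
    sClass W = sClass W' :=
  sClass_relabel h 1 (by rwa [relabelWords_one])

theorem sClass_addShell_opp {W : Words} (h : Valid W) {e : Endpoint} (he : e ∈ ends W) {c : ℕ}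
    (hc : NewChord c W) (σ : ℤˣ) : sClass (addShell e c σ W) = sClass (addShell e.opp c σ W) :=
  sClass_eq_of_sMove (h.addShell he hc σ) (h.addShell (h.opp_mem e he) hc σ)
    (.s1 ⟨h.toDiagram, e, c, σ, mem_ends.1 he, fun _ => rfl, fun _ => rfl⟩)

/-- The words without the endpoints that fail the test `p`. -/
def filterWords (p : Endpoint → Bool) (W : Words) : Words := fun i => (W i).filter p

theorem ends_filterWords (p : Endpoint → Bool) (W : Words) :
    ends (filterWords p W) = (ends W).filter p := by simp [ends, filterWords]

theorem Valid.filterWords {W : Words} (h : Valid W) {p : Endpoint → Bool}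
    (hp : ∀ x, p x.opp = p x) : Valid (filterWords p W) where
  nodup := by
    rw [ends_filterWords]
    exact h.nodup.filter _
  opp_mem e he := by
    rw [ends_filterWords, List.mem_filter] at he ⊢
    exact ⟨h.opp_mem e he.1, by rw [hp, he.2]⟩
  sign_eq e he f hf := by
    rw [ends_filterWords, List.mem_filter] at he hf
    exact h.sign_eq e he.1 f hf.1

theorem sClass_r1 {W : Words} (h : Valid W) {e : Endpoint} {i : Fin 2} {l : List Endpoint}
    (hi : (W i).IsRotated (e :: e.opp :: l)) :
    sClass W = sClass (filterWords (fun x => x.chord ≠ e.chord) W) :=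
  sClass_eq_of_sMove h (h.filterWords fun _ => rfl)
    (.reidemeister (.r1 ⟨e, ⟨i, l, hi⟩, fun _ => rfl⟩))

theorem sClass_r2 {W : Words} (h : Valid W) {a b : Endpoint} (ha : a.isTerminal = false)
    (hb : b.isTerminal = false) (hs : b.chordSign = -a.chordSign) {i j : Fin 2}
    {l l' : List Endpoint} (hi : (W i).IsRotated (a :: b :: l))
    (hj : (W j).IsRotated (a.opp :: b.opp :: l') ∨ (W j).IsRotated (b.opp :: a.opp :: l')) :
    sClass W = sClass (filterWords (fun x => x.chord ≠ a.chord ∧ x.chord ≠ b.chord) W) := by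
  refine sClass_eq_of_sMove h (h.filterWords fun _ => rfl)
    (.reidemeister (.r2 ⟨a, b, ha, hb, hs, ⟨i, l, hi⟩, ?_, fun _ => rfl⟩))
  exact hj.imp (fun h => ⟨j, l', h⟩) (fun h => ⟨j, l', h⟩)

theorem sClass_s2 {W : Words} (h : Valid W) {a b : Endpoint} {i : Fin 2} {l : List Endpoint}
    (hab : a.chord ≠ b.chord) (hi : (W i).IsRotated (a :: b :: l)) {c d : ℕ}
    (hc : NewChord c W) (hV : Valid (addShell a d (a.sign * b.sign)
      (addShell b c (-(a.sign * b.sign)) (swapWords a b W)))) :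
    sClass W = sClass (addShell a d (a.sign * b.sign)
      (addShell b c (-(a.sign * b.sign)) (swapWords a b W))) :=
  sClass_eq_of_sMove h hV (.s2 ⟨a, b, c, d, hab, ⟨i, l, hi⟩, fun j =>
    (s2_words hab hi hc _ _ j).symm⟩)

/-- A shell to be added to a diagram: the endpoint that it surrounds, the name of the shell, and its
sign. -/
structure Bead where
  pt : Endpoint
  name : ℕ
  sgn : ℤˣ

/-- The words with a list of shells added, the last one of the list first. Every new shell surrounds
its endpoint directly, so the head of the list is innermost. -/
def shelled (W : Words) : List Bead → Words
  | [] => W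
  | b :: S => addShell b.pt b.name b.sgn (shelled W S)

/-- The shells in `S` surround endpoints of `W` and have new and distinct names. -/
structure Fresh (W : Words) (S : List Bead) : Prop where
  nodup : (S.map Bead.name).Nodup
  mem : ∀ b ∈ S, b.pt ∈ ends W
  new : ∀ b ∈ S, NewChord b.name W

theorem shelled_append (W : Words) (S T : List Bead) :
    shelled W (S ++ T) = shelled (shelled W T) S := by
  induction S with
  | nil => rfl
  | cons b S ih => simp only [List.cons_append, shelled, ih]

namespace Fresh

variable {W : Words} {S T : List Bead}

theorem nil (W : Words) : Fresh W [] := ⟨List.nodup_nil, by simp, by simp⟩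

theorem perm (h : Fresh W S) (hp : S.Perm T) : Fresh W T :=
  ⟨(hp.map _).nodup_iff.1 h.nodup, fun b hb => h.mem b (hp.mem_iff.2 hb),
    fun b hb => h.new b (hp.mem_iff.2 hb)⟩

theorem sublist (h : Fresh W S) (hp : T.Sublist S) : Fresh W T :=
  ⟨h.nodup.sublist (hp.map _), fun b hb => h.mem b (hp.subset hb),
    fun b hb => h.new b (hp.subset hb)⟩

theorem tail {b : Bead} (h : Fresh W (b :: S)) : Fresh W S := h.sublist (List.sublist_cons_self _ _)

end Fresh

theorem valid_shelled_aux {W : Words} (hW : Valid W) {S : List Bead} (h : Fresh W S) :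
    Valid (shelled W S) ∧ (∀ x, x ∈ ends (shelled W S) → x ∈ ends W ∨ ∃ b ∈ S, x.chord = b.name) ∧
      ∀ x ∈ ends W, x ∈ ends (shelled W S) := by
  induction S with
  | nil => exact ⟨hW, fun x hx => .inl hx, fun x hx => hx⟩
  | cons b S ih =>
    obtain ⟨h1, h2, h3⟩ := ih h.tail
    have hpt := h3 _ (h.mem b (by simp))
    have hp := ends_addShell_perm h1 hpt b.name b.sgn
    refine ⟨h1.addShell hpt ?_ _, fun x hx => ?_, fun x hx => ?_⟩
    · intro x hx hxb
      rcases h2 x hx with hx | ⟨b', hb', hx⟩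
      · exact h.new b (by simp) x hx hxb
      · have := h.nodup
        rw [List.map_cons, List.nodup_cons] at this
        exact this.1 (List.mem_map.2 ⟨b', hb', by rw [← hx, hxb]⟩)
    · rcases List.mem_cons.1 (hp.mem_iff.1 hx) with rfl | hx
      · exact .inr ⟨b, by simp, rfl⟩
      rcases List.mem_cons.1 hx with rfl | hx
      · exact .inr ⟨b, by simp, rfl⟩
      rcases h2 x hx with hx | ⟨b', hb', hx⟩
      · exact .inl hx
      · exact .inr ⟨b', by simp [hb'], hx⟩
    · exact hp.mem_iff.2 (by simp [h3 x hx])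

theorem Valid.shelled {W : Words} (hW : Valid W) {S : List Bead} (h : Fresh W S) :
    Valid (shelled W S) := (valid_shelled_aux hW h).1

theorem mem_ends_shelled {W : Words} (hW : Valid W) {S : List Bead} (h : Fresh W S) {x : Endpoint}
    (hx : x ∈ ends W) : x ∈ ends (shelled W S) := (valid_shelled_aux hW h).2.2 x hx

theorem newChord_shelled {W : Words} (hW : Valid W) {S : List Bead} (h : Fresh W S) {c : ℕ}
    (hc : NewChord c W) (hS : ∀ b ∈ S, b.name ≠ c) : NewChord c (shelled W S) := by
  intro x hx hxc
  rcases (valid_shelled_aux hW h).2.1 x hx with h | ⟨b, hb, h⟩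
  · exact hc x h hxc
  · exact hS b hb (by rw [← h, hxc])

theorem addShell_comm {e e' : Endpoint} {c d : ℕ} (hee : e ≠ e') (hd : d ≠ e.chord)
    (hc : c ≠ e'.chord) (σ τ : ℤˣ) (W : Words) :
    addShell e c σ (addShell e' d τ W) = addShell e' d τ (addShell e c σ W) := by
  have h1 : shellStart d τ e' ≠ e := fun h => hd (by rw [← h]; rfl)
  have h2 : (shellStart d τ e').opp ≠ e := fun h => hd (by rw [← h]; rfl)
  have h3 : shellStart c σ e ≠ e' := fun h => hc (by rw [← h]; rfl)
  have h4 : (shellStart c σ e).opp ≠ e' := fun h => hc (by rw [← h]; rfl)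
  funext i
  simp only [addShell, List.flatMap_assoc]
  refine List.flatMap_congr fun x _ => ?_
  by_cases hx : x = e
  · subst hx
    simp [hee, withShell_eq, h3, h4]
  · by_cases hx' : x = e'
    · subst hx'
      simp [hx, withShell_eq, h1, h2]
    · simp [hx, hx']

theorem relabelWords_addShell (f : Equiv.Perm ℕ) (e : Endpoint) (c : ℕ) (σ : ℤˣ) (W : Words) :
    relabelWords f (addShell e c σ W) = addShell (relabel f e) (f c) σ (relabelWords f W) := by
  funext i
  simp only [relabelWords, addShell, List.map_flatMap, List.flatMap_map]
  refine List.flatMap_congr fun x _ => ?_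
  simp only [(relabel_injective f).eq_iff]
  split_ifs
  · simp only [withShell_eq, shellStart, sign_relabel]
    rfl
  · rfl

theorem relabelWords_shelled {f : Equiv.Perm ℕ} {W : Words} (hf : ∀ x ∈ ends W, relabel f x = x)
    {S : List Bead} (h : Fresh W S) : relabelWords f (shelled W S) =
      shelled W (S.map fun b => ⟨b.pt, f b.name, b.sgn⟩) := by
  induction S with
  | nil =>
    funext i
    rw [shelled, relabelWords_apply]
    conv_rhs => rw [List.map_nil, shelled, ← List.map_id (W i)]
    exact List.map_congr_left fun x hx => hf x (mem_ends.2 ⟨i, hx⟩)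
  | cons b S ih =>
    rw [shelled, relabelWords_addShell, ih h.tail, hf _ (h.mem b (by simp))]
    rfl

theorem filterWords_addShell {p : Endpoint → Bool} {e : Endpoint} {c : ℕ} {σ : ℤˣ} (he : p e)
    (hc : p (shellStart c σ e)) (hp : ∀ x, p x.opp = p x) (W : Words) :
    filterWords p (addShell e c σ W) = addShell e c σ (filterWords p W) := by
  funext i
  simp only [filterWords, addShell]
  induction W i with
  | nil => rfl
  | cons x w ih =>
    rw [List.flatMap_cons, List.filter_append, ih]
    by_cases hx : x = e
    · subst hx
      simp [withShell_eq, he, hc, hp]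
    · by_cases hpx : p x <;> simp [hx, hpx]

theorem filterWords_shelled {p : Endpoint → Bool} (hp : ∀ x, p x.opp = p x) {S : List Bead}
    (h : ∀ b ∈ S, p b.pt ∧ p (shellStart b.name b.sgn b.pt)) (W : Words) :
    filterWords p (shelled W S) = shelled (filterWords p W) S := by
  induction S with
  | nil => rfl
  | cons b S ih =>
    rw [shelled, filterWords_addShell (h b (by simp)).1 (h b (by simp)).2 hp,
      ih fun b hb => h b (by simp [hb])]
    rfl

theorem filterWords_addShell_of_neg {p : Endpoint → Bool} {e : Endpoint} {c : ℕ} {σ : ℤˣ}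
    (hp : ∀ x, p x.opp = p x) (hc : p (shellStart c σ e) = false) (W : Words) :
    filterWords p (addShell e c σ W) = filterWords p W := by
  funext i
  simp only [filterWords, addShell]
  induction W i with
  | nil => rfl
  | cons x w ih =>
    rw [List.flatMap_cons, List.filter_append, ih]
    by_cases hx : x = e
    · subst hx
      simp [withShell_eq, hc, hp, List.filter_cons]
      split_ifs <;> rfl
    · by_cases hpx : p x <;> simp [hx, hpx]

theorem swapWords_addShell {a b e : Endpoint} {c : ℕ} (hea : e ≠ a) (heb : e ≠ b)
    (hca : c ≠ a.chord) (hcb : c ≠ b.chord) (σ : ℤˣ) (W : Words) :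
    swapWords a b (addShell e c σ W) = addShell e c σ (swapWords a b W) := by
  have h1 : shellStart c σ e ≠ a := fun h => hca (by rw [← h]; rfl)
  have h2 : (shellStart c σ e).opp ≠ a := fun h => hca (by rw [← h]; rfl)
  have h3 : shellStart c σ e ≠ b := fun h => hcb (by rw [← h]; rfl)
  have h4 : (shellStart c σ e).opp ≠ b := fun h => hcb (by rw [← h]; rfl)
  funext i
  simp only [swapWords, addShell, List.map_flatMap, List.flatMap_map]
  refine List.flatMap_congr fun x _ => ?_
  have he : Equiv.swap a b e = e := Equiv.swap_apply_of_ne_of_ne hea heb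
  by_cases hx : x = e
  · subst hx
    simp [he, withShell_eq, Equiv.swap_apply_of_ne_of_ne, h1, h2, h3, h4]
  · have : Equiv.swap a b x ≠ e := fun h => hx ((Equiv.swap a b).injective (by rw [h, he]))
    simp [hx, this]

theorem swapWords_shelled {a b : Endpoint} {S : List Bead}
    (h : ∀ s ∈ S, s.pt ≠ a ∧ s.pt ≠ b ∧ s.name ≠ a.chord ∧ s.name ≠ b.chord) (W : Words) :
    swapWords a b (shelled W S) = shelled (swapWords a b W) S := by
  induction S with
  | nil => rfl
  | cons s S ih =>
    obtain ⟨h1, h2, h3, h4⟩ := h s (by simp)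
    rw [shelled, swapWords_addShell h1 h2 h3 h4, ih fun b hb => h b (by simp [hb])]
    rfl

theorem isRotated_flatMap {α β : Type*} {w w' : List α} (h : w.IsRotated w') (g : α → List β) :
    (w.flatMap g).IsRotated (w'.flatMap g) := by
  obtain ⟨n, hn, rfl⟩ := List.isRotated_iff_mod.1 h
  rw [List.rotate_eq_drop_append_take hn, List.flatMap_append]
  conv_lhs => rw [← List.take_append_drop n w, List.flatMap_append]
  exact isRotated_append_comm _ _

theorem shelled_isRotated {W : Words} {i : Fin 2} {a b : Endpoint} {l : List Endpoint}
    (h : (W i).IsRotated (a :: b :: l)) {S : List Bead} (hS : ∀ s ∈ S, s.pt ≠ a ∧ s.pt ≠ b) :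
    ∃ l', (shelled W S i).IsRotated (a :: b :: l') := by
  induction S with
  | nil => exact ⟨l, h⟩
  | cons s S ih =>
    obtain ⟨l', hl⟩ := ih fun s hs => hS s (by simp [hs])
    obtain ⟨h1, h2⟩ := hS s (by simp)
    have := isRotated_flatMap hl fun x => if x = s.pt then s.pt.withShell s.name s.sgn else [x]
    rw [List.flatMap_cons, List.flatMap_cons, if_neg h1.symm, if_neg h2.symm] at this
    exact ⟨_, this⟩

/-- Two adjacent shells of opposite signs around the same endpoint cancel by a move R2, whatever
shells are placed inside. -/
theorem sClass_shelled_cancel {W : Words} (hW : Valid W) {P S : List Bead} {x y : Bead}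
    (h : Fresh W (P ++ x :: y :: S)) (hpt : x.pt = y.pt) (hs : x.sgn = -y.sgn) :
    sClass (shelled W (P ++ x :: y :: S)) = sClass (shelled W (P ++ S)) := by
  have hV := hW.shelled h
  have h1 : Fresh W (x :: y :: S) := h.sublist (List.sublist_append_right _ _)
  have hS : Fresh W S := h1.tail.tail
  have hW1 := hW.shelled hS
  have hy := hW.shelled h1.tail
  obtain ⟨e, c, σ⟩ := x
  obtain ⟨e', d, τ⟩ := y
  obtain rfl : e = e' := hpt
  obtain rfl : σ = -τ := hs
  have he : e ∈ ends (shelled W S) := mem_ends_shelled hW hS (h1.mem _ (List.mem_cons_self))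
  obtain ⟨i, hi⟩ := mem_ends.1 he
  obtain ⟨l, -, hl⟩ := exists_addShell_isRotated (hW1.nodup_word i) hi d τ
  have hi2 : e ∈ shelled W (⟨e, d, τ⟩ :: S) i := hl.mem_iff.2 (by simp)
  set s := shellStart c (-τ) e with hs
  set t := shellStart d τ e with ht
  have hcd : c ≠ d := by
    have := h1.nodup
    simp at this
    exact this.1.1
  have hce : e.chord ≠ c := h1.new _ (List.mem_cons_self) e (h1.mem _ (List.mem_cons_self))
  have hde : e.chord ≠ d :=
    h1.new ⟨e, d, τ⟩ (by simp) e (h1.mem _ (List.mem_cons_self))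
  have ht1 : t ≠ e := fun h => hde (by rw [← h]; rfl)
  have ht2 : t.opp ≠ e := fun h => hde (by rw [← h]; rfl)
  have hrot : (shelled W (⟨e, c, -τ⟩ :: ⟨e, d, τ⟩ :: S) i).IsRotated
      (t :: s :: e :: s.opp :: t.opp :: l) := by
    have : (shelled W (⟨e, c, -τ⟩ :: ⟨e, d, τ⟩ :: S) i).IsRotated _ :=
      isRotated_flatMap hl fun x => if x = e then e.withShell c (-τ) else [x]
    have hel : e ∉ l := by
      have h3 := hl.perm.nodup_iff.1 (hy.nodup_word i)
      simp at h3
      exact h3.2.1.2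
    rw [List.flatMap_cons, List.flatMap_cons, List.flatMap_cons, if_neg ht1, if_pos rfl,
      if_neg ht2, flatMap_ite_of_not_mem hel, withShell_eq] at this
    exact this
  have hrot2 : (shelled W (⟨e, c, -τ⟩ :: ⟨e, d, τ⟩ :: S) i).IsRotated
      (s.opp :: t.opp :: (l ++ [t, s, e])) :=
    hrot.trans (isRotated_append_comm [t, s, e] (s.opp :: t.opp :: l))
  have hPt : ∀ b ∈ P, ∀ z : Endpoint, (z.chord = c ∨ z.chord = d) → b.pt ≠ z := by
    rintro b hb z hz rfl
    have := h.mem b (by simp [hb])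
    rcases hz with hz | hz
    · exact h1.new _ (List.mem_cons_self) _ this hz
    · exact h1.new ⟨e, d, τ⟩ (by simp) _ this hz
  obtain ⟨l1, hl1⟩ := shelled_isRotated hrot (S := P)
    fun b hb => ⟨hPt b hb t (.inr rfl), hPt b hb s (.inl rfl)⟩
  obtain ⟨l2, hl2⟩ := shelled_isRotated hrot2 (S := P)
    fun b hb => ⟨hPt b hb s.opp (.inl rfl), hPt b hb t.opp (.inr rfl)⟩
  rw [← shelled_append] at hl1 hl2
  have hPn : ∀ b ∈ P, b.name ≠ c ∧ b.name ≠ d := by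
    intro b hb
    have := h.nodup
    rw [List.map_append, List.nodup_append'] at this
    have hd := this.2.2 (List.mem_map.2 ⟨b, hb, rfl⟩)
    simp only [List.map_cons, List.mem_cons] at hd
    exact ⟨fun h => hd (.inl h), fun h => hd (.inr (.inl h))⟩
  -- Both pairs of adjacent endpoints of the two shells are used, in the order that puts the
  -- initial endpoints first.
  have hfin : ∀ p : Endpoint → Bool, (∀ x, p x = decide (x.chord ≠ c ∧ x.chord ≠ d)) →
      filterWords p (shelled W (P ++ ⟨e, c, -τ⟩ :: ⟨e, d, τ⟩ :: S)) = shelled W (P ++ S) := by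
    intro p hp
    have hpo : ∀ x, p x.opp = p x := fun x => by rw [hp, hp]; rfl
    rw [shelled_append, shelled_append, filterWords_shelled hpo, shelled, shelled,
      filterWords_addShell_of_neg hpo (by simp [hp]),
      filterWords_addShell_of_neg hpo (by simp [hp])]
    · congr 1
      funext j
      refine List.filter_eq_self.2 fun x hx => ?_
      have hx := mem_ends.2 ⟨j, hx⟩
      rw [hp, decide_eq_true_eq]
      refine ⟨newChord_shelled hW hS (h1.new _ (List.mem_cons_self)) ?_ x hx,
        newChord_shelled hW hS (h1.new ⟨e, d, τ⟩ (by simp)) ?_ x hx⟩ <;>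
      · intro b hb hbn
        have h2 := h1.nodup
        simp only [List.map_cons, List.nodup_cons, List.mem_cons, List.mem_map, not_or,
          not_exists, not_and] at h2
        first | exact h2.1.2 b hb hbn | exact h2.2.1 b hb hbn
    · intro b hb
      refine ⟨?_, by simp [hp, hPn b hb]⟩
      rw [hp, decide_eq_true_eq]
      exact ⟨fun hc => hPt b hb _ (.inl hc) rfl, fun hc => hPt b hb _ (.inr hc) rfl⟩
  have hst : s.isTerminal = t.isTerminal := rfl
  cases htt : t.isTerminal
  · rw [sClass_r2 hV (a := t) (b := s) htt (hst.trans htt) rfl hl1 (.inr hl2)]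
    exact congrArg sClass (hfin _ fun x => decide_eq_decide.2 and_comm)
  · have e1 : s.opp.opp = s := opp_opp _
    have e2 : t.opp.opp = t := opp_opp _
    rw [sClass_r2 hV (a := s.opp) (b := t.opp) (by simp [hst, htt]) (by simp [htt])
      (by simp [hs, ht]) hl2 (.inr (by rw [e1, e2]; exact hl1))]
    exact congrArg sClass (hfin _ fun x => rfl)

end GaussDiagram

/-! ### Shells may be moved and cancelled -/

namespace GaussDiagram

open Endpoint

theorem shelled_cons_append_comm {W : Words} {P S : List Bead} {b : Bead}
    (h : Fresh W (P ++ b :: S)) (hP : ∀ x ∈ P, x.pt ≠ b.pt) :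
    shelled W (P ++ b :: S) = shelled W (b :: (P ++ S)) := by
  induction P with
  | nil => rfl
  | cons x P ih =>
    have h' : Fresh W (P ++ b :: S) := h.tail
    rw [List.cons_append, shelled, ih h' fun x hx => hP x (by simp [hx])]
    simp only [shelled, List.cons_append]
    exact addShell_comm (hP x (by simp))
      (fun hc => h.new b (by simp) x.pt (h.mem x (by simp)) hc.symm)
      (fun hc => h.new x (by simp) b.pt (h.mem b (by simp)) hc.symm) _ _ _

/-- Shells around initial endpoints may be permuted. Shells around different endpoints commute, two
shells of opposite signs around the same endpoint cancel in either order, and two of the same sign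
are exchanged by renaming. -/
theorem sClass_shelled_perm_of_initial {W : Words} (hW : Valid W) {S T : List Bead}
    (hp : S.Perm T) : ∀ P : List Bead, Fresh W (P ++ S) →
      (∀ b ∈ P ++ S, b.pt.isTerminal = false) →
      sClass (shelled W (P ++ S)) = sClass (shelled W (P ++ T)) := by
  induction hp with
  | nil => exact fun _ _ _ => rfl
  | cons x _ ih =>
    intro P h hi
    have := ih (P ++ [x])
    simp only [List.append_assoc, List.cons_append, List.nil_append] at this
    exact this h hi
  | trans h1 _ ih1 ih2 =>
    intro P h hi
    rw [ih1 P h hi, ih2 P (h.perm (h1.append_left P))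
      fun b hb => hi b ((h1.append_left P).mem_iff.2 hb)]
  | swap x y S =>
    intro P h hi
    have hxy : Fresh W (y :: x :: S) := h.sublist (List.sublist_append_right _ _)
    have h' : Fresh W (P ++ x :: y :: S) := h.perm ((List.Perm.swap _ _ _).append_left P)
    by_cases hpt : x.pt = y.pt
    · by_cases hs : x.sgn = y.sgn
      · have hfix : ∀ c, (c ≠ x.name ∧ c ≠ y.name) → Equiv.swap x.name y.name c = c :=
          fun c hc => Equiv.swap_apply_of_ne_of_ne hc.1 hc.2
        have hf : ∀ z ∈ ends W, relabel (Equiv.swap x.name y.name) z = z := by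
          intro z hz
          have := hfix z.chord ⟨hxy.new x (by simp) z hz, hxy.new y (by simp) z hz⟩
          rw [relabel, this]
        have hn := h.nodup
        simp only [List.map_append, List.map_cons, List.nodup_append', List.nodup_cons,
          List.mem_cons, not_or, List.disjoint_cons_right] at hn
        have hmap : ∀ L : List Bead, (∀ b ∈ L, b.name ≠ x.name ∧ b.name ≠ y.name) →
            L.map (fun b => (⟨b.pt, Equiv.swap x.name y.name b.name, b.sgn⟩ : Bead)) = L := by
          intro L hL
          conv_rhs => rw [← List.map_id L]
          refine List.map_congr_left fun b hb => ?_
          rw [hfix _ (hL b hb)]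
          rfl
        have hP := hmap P fun b hb => ⟨fun hc => hn.2.2.2.1 (hc ▸ List.mem_map_of_mem hb),
          fun hc => hn.2.2.1 (hc ▸ List.mem_map_of_mem hb)⟩
        have hS := hmap S fun b hb => ⟨fun hc => hn.2.1.2.1 (hc ▸ List.mem_map_of_mem hb),
          fun hc => hn.2.1.1.2 (hc ▸ List.mem_map_of_mem hb)⟩
        refine sClass_relabel (hW.shelled h) (Equiv.swap x.name y.name) fun i => ?_
        rw [relabelWords_shelled hf h, List.map_append, List.map_cons, List.map_cons, hP, hS,
          Equiv.swap_apply_left, Equiv.swap_apply_right, hpt, hs]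
        obtain ⟨ex, cx, σx⟩ := x
        obtain ⟨ey, cy, σy⟩ := y
        simp only at hpt hs
        subst hpt hs
        exact .refl _
      · have hs' : x.sgn = -y.sgn := by
          rcases Int.units_eq_one_or x.sgn with h1 | h1 <;>
            rcases Int.units_eq_one_or y.sgn with h2 | h2 <;> simp_all
        rw [sClass_shelled_cancel hW h hpt.symm (by rw [hs', neg_neg]),
          sClass_shelled_cancel hW h' hpt hs']
    · have := shelled_cons_append_comm (P := [y]) (hxy : Fresh W ([y] ++ x :: S))
        (by simpa using Ne.symm hpt)
      rw [shelled_append, shelled_append W P]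
      exact congrArg (fun V => sClass (shelled V P)) this

/-- The shell is moved to the initial endpoint of its chord. -/
def Bead.toInitial (b : Bead) : Bead := ⟨⟨b.pt.chord, false, b.pt.chordSign⟩, b.name, b.sgn⟩

theorem Bead.toInitial_eq (b : Bead) :
    b.toInitial = b ∨ b.toInitial = ⟨b.pt.opp, b.name, b.sgn⟩ := by
  obtain ⟨⟨c, t, ε⟩, d, σ⟩ := b
  cases t <;> simp [toInitial, opp]

theorem Fresh.map_toInitial {W : Words} (hW : Valid W) {S : List Bead} (h : Fresh W S) :
    Fresh W (S.map Bead.toInitial) where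
  nodup := by
    rw [List.map_map]
    exact h.nodup
  mem := by
    intro b hb
    obtain ⟨x, hx, rfl⟩ := List.mem_map.1 hb
    rcases x.toInitial_eq with h1 | h1 <;> rw [h1]
    exacts [h.mem x hx, hW.opp_mem _ (h.mem x hx)]
  new := by
    intro b hb
    obtain ⟨x, hx, rfl⟩ := List.mem_map.1 hb
    exact h.new x hx

theorem sClass_shelled_toInitial_aux {W : Words} (hW : Valid W) (S : List Bead) :
    ∀ P : List Bead, Fresh W (P ++ S) → (∀ b ∈ P, b.pt.isTerminal = false) →
      sClass (shelled W (P ++ S)) = sClass (shelled W (P ++ S.map Bead.toInitial)) := by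
  induction S with
  | nil => exact fun _ _ _ => rfl
  | cons b S ih =>
    intro P h hP
    by_cases hb : b.pt.isTerminal = false
    · have hb' : b.toInitial = b := by
        obtain ⟨⟨c, t, ε⟩, d, σ⟩ := b
        simp only at hb
        subst hb
        rfl
      have := ih (P ++ [b])
      simp only [List.append_assoc, List.cons_append, List.nil_append] at this
      rw [this h, List.map_cons, hb']
      intro x hx
      rcases List.mem_append.1 hx with hx | hx
      · exact hP x hx
      · rw [List.mem_singleton.1 hx, hb]
    · have hb' : b.toInitial = ⟨b.pt.opp, b.name, b.sgn⟩ := by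
        obtain ⟨⟨c, t, ε⟩, d, σ⟩ := b
        simp only [Bool.not_eq_false] at hb
        subst hb
        rfl
      rw [shelled_cons_append_comm h fun x hx hxb => hb (by rw [← hxb, hP x hx])]
      have h1 : Fresh W (b :: (P ++ S)) := h.perm List.perm_middle
      have hn : NewChord b.name (shelled W (P ++ S)) :=
        newChord_shelled hW h1.tail (h1.new b (by simp)) fun x hx hxb => by
          have := h1.nodup
          rw [List.map_cons, List.nodup_cons] at this
          exact this.1 (List.mem_map.2 ⟨x, hx, hxb⟩)
      rw [shelled, sClass_addShell_opp (hW.shelled h1.tail)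
        (mem_ends_shelled hW h1.tail (h1.mem b (by simp))) hn]
      set b' : Bead := ⟨b.pt.opp, b.name, b.sgn⟩ with hb'd
      have h2 : Fresh W (b' :: P ++ S) := ⟨h1.nodup, by
        rintro x (_ | ⟨_, hx⟩)
        exacts [hW.opp_mem _ (h1.mem b (by simp)), h1.mem x (.tail _ hx)], by
        rintro x (_ | ⟨_, hx⟩)
        exacts [h1.new b (by simp), h1.new x (.tail _ hx)]⟩
      have hP' : ∀ x ∈ b' :: P, x.pt.isTerminal = false := by
        rintro x (_ | ⟨_, hx⟩)
        exacts [by simpa [hb'd] using hb, hP x hx]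
      have h3 := ih (b' :: P) h2 hP'
      refine (show _ = _ from h3).trans ?_
      rw [List.map_cons, hb']
      have hpm : (b' :: P ++ S.map Bead.toInitial).Perm (P ++ b' :: S.map Bead.toInitial) :=
        List.perm_middle.symm
      have h4 : Fresh W (b' :: P ++ S.map Bead.toInitial) := by
        have := h2.map_toInitial hW
        refine ⟨?_, ?_, ?_⟩
        · have hname : Bead.name ∘ Bead.toInitial = Bead.name := rfl
          rw [List.map_append, List.map_map, hname, ← List.map_append]
          exact h2.nodup
        · intro x hx
          rcases List.mem_append.1 hx with hx | hx
          · exact h2.mem x (List.mem_append_left _ hx)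
          · exact this.mem x (by rw [List.map_append]; exact List.mem_append_right _ hx)
        · intro x hx
          rcases List.mem_append.1 hx with hx | hx
          · exact h2.new x (List.mem_append_left _ hx)
          · exact this.new x (by rw [List.map_append]; exact List.mem_append_right _ hx)
      exact sClass_shelled_perm_of_initial hW hpm [] h4 fun x hx => by
        rcases List.mem_append.1 (show x ∈ (b' :: P) ++ S.map Bead.toInitial from hx) with hx | hx
        · exact hP' x hx
        · obtain ⟨y, _, rfl⟩ := List.mem_map.1 hx
          rfl

/-- All shells may be slid to the initial endpoints. -/
theorem sClass_shelled_toInitial {W : Words} (hW : Valid W) {S : List Bead} (h : Fresh W S) :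
    sClass (shelled W S) = sClass (shelled W (S.map Bead.toInitial)) :=
  sClass_shelled_toInitial_aux hW S [] h (by simp)

theorem sClass_shelled_perm {W : Words} (hW : Valid W) {S T : List Bead} (h : Fresh W S)
    (hp : S.Perm T) : sClass (shelled W S) = sClass (shelled W T) := by
  rw [sClass_shelled_toInitial hW h, sClass_shelled_toInitial hW (h.perm hp)]
  refine sClass_shelled_perm_of_initial hW (hp.map _) [] (h.map_toInitial hW) fun b hb => ?_
  obtain ⟨y, _, rfl⟩ := List.mem_map.1 hb
  rfl

theorem sClass_shelled_cons_cons {W : Words} (hW : Valid W) {x y : Bead} {S : List Bead}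
    (h : Fresh W (x :: y :: S)) (hxy : x.pt.chord = y.pt.chord) (hs : y.sgn = -x.sgn) :
    sClass (shelled W (x :: y :: S)) = sClass (shelled W S) := by
  rw [sClass_shelled_toInitial hW h, sClass_shelled_toInitial hW h.tail.tail]
  refine sClass_shelled_cancel hW (P := []) (h.map_toInitial hW) ?_ ?_
  · have := hW.sign_eq _ (h.mem x (by simp)) _ (h.mem y (by simp)) hxy
    simp [Bead.toInitial, hxy, this]
  · simp [Bead.toInitial, hs]

/-- The sum of the signs of the members of a list that have the key `k`. -/
def signedCount {α κ : Type*} [DecidableEq κ] (key : α → κ) (sgn : α → ℤˣ) (l : List α)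
    (k : κ) : ℤ := (l.map fun a => if key a = k then (sgn a : ℤ) else 0).sum

section Cancellation

variable {α κ : Type*} [DecidableEq κ] {key : α → κ} {sgn : α → ℤˣ}

@[simp] theorem signedCount_nil (k : κ) : signedCount key sgn [] k = 0 := rfl

@[simp] theorem signedCount_cons (a : α) (l : List α) (k : κ) : signedCount key sgn (a :: l) k =
    (if key a = k then (sgn a : ℤ) else 0) + signedCount key sgn l k := by simp [signedCount]

@[simp] theorem signedCount_append (l l' : List α) (k : κ) : signedCount key sgn (l ++ l') k =
    signedCount key sgn l k + signedCount key sgn l' k := by simp [signedCount]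

theorem signedCount_perm {l l' : List α} (h : l.Perm l') (k : κ) :
    signedCount key sgn l k = signedCount key sgn l' k := (h.map _).sum_eq

theorem signedCount_map_neg {β : Type*} {key' : β → κ} {sgn' : β → ℤˣ} (f : α → β)
    (hk : ∀ a, key' (f a) = key a) (hs : ∀ a, sgn' (f a) = -sgn a) (l : List α) (k : κ) :
    signedCount key' sgn' (l.map f) k = -signedCount key sgn l k := by
  induction l with
  | nil => simp
  | cons a l ih =>
    rw [List.map_cons, signedCount_cons, signedCount_cons, ih, hk, hs]
    split_ifs
    · push_cast
      ring
    · ring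

theorem exists_opposite_of_signedCount {a : α} {l : List α}
    (h : signedCount key sgn (a :: l) (key a) = 0) :
    ∃ b ∈ l, key b = key a ∧ sgn b = -sgn a := by
  by_contra hcon
  push Not at hcon
  have key2 : ∀ l' : List α, (∀ b ∈ l', key b = key a → sgn b ≠ -sgn a) →
      0 ≤ (sgn a : ℤ) * signedCount key sgn l' (key a) := by
    intro l'
    induction l' with
    | nil => simp
    | cons b l' ih =>
      intro hb
      have h1 := ih fun c hc => hb c (by simp [hc])
      have h2 := hb b (by simp)
      rw [signedCount_cons, mul_add]
      split_ifs with hk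
      · have h3 := h2 hk
        rcases Int.units_eq_one_or (sgn a) with ha | ha <;>
          rcases Int.units_eq_one_or (sgn b) with hb | hb <;>
          simp only [ha, hb, ne_eq, not_true_eq_false, neg_neg] at h1 h3 ⊢ <;>
          norm_num at h1 ⊢ <;> linarith
      · simpa using h1
  have h1 := key2 l hcon
  rw [signedCount_cons, if_pos rfl] at h
  have h2 : signedCount key sgn l (key a) = -sgn a := by linarith
  rw [h2] at h1
  rcases Int.units_eq_one_or (sgn a) with ha | ha <;> simp [ha] at h1

/-- If a function of lists is invariant under permutations, under the cancellation of two members of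
opposite signs with the same key, and under the deletion of a member with a key in `R`, then a
list whose signed counts vanish off `R` can be deleted. -/
theorem cancel_of_signedCount_eq_zero {X : Type*} {F : List α → X} {Good : List α → Prop}
    {R : Set κ} (hperm : ∀ l l', l.Perm l' → Good l → Good l' ∧ F l = F l')
    (hcancel : ∀ a b l, Good (a :: b :: l) → key b = key a → sgn b = -sgn a →
      Good l ∧ F (a :: b :: l) = F l)
    (hrem : ∀ a l, Good (a :: l) → key a ∈ R → Good l ∧ F (a :: l) = F l) (l : List α) :
    ∀ Z : List α, (∀ k ∉ R, signedCount key sgn Z k = 0) → Good (Z ++ l) →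
      F (Z ++ l) = F l := by
  suffices H : ∀ n, ∀ Z : List α, Z.length = n → (∀ k ∉ R, signedCount key sgn Z k = 0) →
      Good (Z ++ l) → F (Z ++ l) = F l from fun Z => H _ Z rfl
  intro n
  induction n using Nat.strong_induction_on with
  | _ n ih =>
    rintro (_ | ⟨a, Z⟩) hn hZ hG
    · rfl
    by_cases ha : key a ∈ R
    · obtain ⟨h1, h2⟩ := hrem a _ hG ha
      refine h2.trans (ih Z.length (by simp at hn; omega) Z rfl (fun k hk => ?_) h1)
      have := hZ k hk
      rwa [signedCount_cons, if_neg (fun h => hk (by rwa [← h])), zero_add] at this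
    · obtain ⟨b, hb, hk, hs⟩ := exists_opposite_of_signedCount (hZ _ ha)
      obtain ⟨u, v, rfl⟩ := List.append_of_mem hb
      have hp : (a :: (u ++ b :: v)).Perm (a :: b :: (u ++ v)) := .cons _ List.perm_middle
      obtain ⟨h1, h2⟩ := hperm _ _ (hp.append_right l) hG
      obtain ⟨h3, h4⟩ := hcancel a b _ h1 hk hs
      refine h2.trans (h4.trans (ih (u ++ v).length (by simp at hn ⊢; omega) _ rfl
        (fun k hk' => ?_) h3))
      have := hZ k hk'
      rw [signedCount_perm hp, signedCount_cons, signedCount_cons, hk, hs] at this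
      split_ifs at this
      · push_cast at this
        linarith
      · linarith

/-- The value on a list is the value on any other list with the same signed counts off `R`, provided
that a list of opposites `N` is at hand to cancel with both. -/
theorem eq_of_signedCount_eq {X : Type*} {F : List α → X} {Good : List α → Prop}
    {R : Set κ} (hperm : ∀ l l', l.Perm l' → Good l → Good l' ∧ F l = F l')
    (hcancel : ∀ a b l, Good (a :: b :: l) → key b = key a → sgn b = -sgn a →
      Good l ∧ F (a :: b :: l) = F l)
    (hrem : ∀ a l, Good (a :: l) → key a ∈ R → Good l ∧ F (a :: l) = F l) {l N P : List α}
    (hNP : ∀ k ∉ R, signedCount key sgn N k + signedCount key sgn P k = 0)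
    (hlN : ∀ k ∉ R, signedCount key sgn N k + signedCount key sgn l k = 0)
    (hG : Good ((N ++ P) ++ l)) : F l = F P := by
  rw [← cancel_of_signedCount_eq_zero hperm hcancel hrem l (N ++ P)
    (fun k hk => by rw [signedCount_append, hNP k hk]) hG]
  have hp : ((N ++ P) ++ l).Perm ((N ++ l) ++ P) := by
    rw [List.append_assoc, List.append_assoc]
    exact List.perm_append_comm.append_left N
  obtain ⟨h1, h2⟩ := hperm _ _ hp hG
  rw [h2, cancel_of_signedCount_eq_zero hperm hcancel hrem P (N ++ l)
    (fun k hk => by rw [signedCount_append, hlN k hk]) h1]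

end Cancellation

/-- The signed number of shells of the chord `x`. -/
def beadWeight (S : List Bead) (x : ℕ) : ℤ :=
  signedCount (fun b : Bead => b.pt.chord) Bead.sgn S x

theorem exists_name_bound (W : Words) (S T : List Bead) : ∃ N, (∀ e ∈ ends W, e.chord < N) ∧
    (∀ b ∈ S, b.name < N) ∧ ∀ b ∈ T, b.name < N := by
  let L : List ℕ := (ends W).map Endpoint.chord ++ S.map Bead.name ++ T.map Bead.name
  have hL : ∀ n ∈ L, n < L.sum + 1 := fun n hn =>
    Nat.lt_succ_of_le (List.single_le_sum (by simp) n hn)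
  refine ⟨L.sum + 1, fun e he => hL _ ?_, fun b hb => hL _ ?_, fun b hb => hL _ ?_⟩
  · simp only [L, List.mem_append, List.mem_map]
    exact .inl (.inl ⟨e, he, rfl⟩)
  · simp only [L, List.mem_append, List.mem_map]
    exact .inl (.inr ⟨b, hb, rfl⟩)
  · simp only [L, List.mem_append, List.mem_map]
    exact .inr ⟨b, hb, rfl⟩

/-- The S-class of a diagram with shells depends only on the signed number of shells of every
chord. -/
theorem sClass_shelled_eq_of_beadWeight {W : Words} (hW : Valid W) {S T : List Bead}
    (hS : Fresh W S) (hT : Fresh W T) (h : ∀ x, beadWeight S x = beadWeight T x) :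
    sClass (shelled W S) = sClass (shelled W T) := by
  obtain ⟨N, hN, hSN, hTN⟩ := exists_name_bound W S T
  -- Copies of `T` with new names, once with opposite and once with the same signs.
  let neg : List Bead := T.map fun b => ⟨b.pt, b.name + N, -b.sgn⟩
  let pos : List Bead := T.map fun b => ⟨b.pt, b.name + (N + N), b.sgn⟩
  have hneg : ∀ x, beadWeight neg x = -beadWeight T x := by
    intro x
    exact signedCount_map_neg (key := fun b : Bead => b.pt.chord) (sgn := Bead.sgn)
      (key' := fun b : Bead => b.pt.chord) (sgn' := Bead.sgn)
      (fun b => ⟨b.pt, b.name + N, -b.sgn⟩) (fun _ => rfl) (fun _ => rfl) T x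
  have hpos : ∀ x, beadWeight pos x = beadWeight T x := by
    intro x
    simp only [pos, beadWeight, signedCount, List.map_map, Function.comp_def]
  suffices H : ∀ L, Fresh W L → (∀ b ∈ L, b.name < N) → (∀ x, beadWeight L x = beadWeight T x) →
      sClass (shelled W L) = sClass (shelled W pos) by
    rw [H S hS hSN h, H T hT hTN fun _ => rfl]
  intro L hL hLN hLw
  refine eq_of_signedCount_eq (key := fun b : Bead => b.pt.chord) (sgn := Bead.sgn)
    (F := fun L => sClass (shelled W L)) (Good := Fresh W) (R := ∅) (N := neg)
    (fun l l' hp hg => ⟨hg.perm hp, sClass_shelled_perm hW hg hp⟩)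
    (fun a b l hg hk hs => ⟨hg.tail.tail, sClass_shelled_cons_cons hW hg hk.symm hs⟩)
    (fun a l _ hk => absurd hk (by simp)) (fun k _ => ?_) (fun k _ => ?_) ?_
  · have h1 := hneg k
    have h2 := hpos k
    simp only [beadWeight] at h1 h2
    rw [h1, h2]
    ring
  · have h1 := hneg k
    have h2 := hLw k
    simp only [beadWeight] at h1 h2
    rw [h1, h2]
    ring
  · refine ⟨?_, ?_, ?_⟩
    · have e1 : neg.map Bead.name = (T.map Bead.name).map (· + N) := by
        simp [neg, Function.comp_def]
      have e2 : pos.map Bead.name = (T.map Bead.name).map (· + (N + N)) := by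
        simp [pos, Function.comp_def]
      rw [List.map_append, List.map_append, e1, e2]
      refine List.nodup_append'.2 ⟨List.nodup_append'.2
        ⟨hT.nodup.map (add_left_injective _), hT.nodup.map (add_left_injective _), ?_⟩,
        hL.nodup, ?_⟩
      · intro x hx hx'
        simp only [List.map_map, List.mem_map, Function.comp_apply] at hx hx'
        obtain ⟨b, hb, rfl⟩ := hx
        obtain ⟨b', hb', hbb⟩ := hx'
        have := hTN b hb
        omega
      · intro x hx hx'
        obtain ⟨b, hb, rfl⟩ := List.mem_map.1 hx'
        have := hLN b hb
        simp only [List.map_map, List.mem_append, List.mem_map, Function.comp_apply] at hx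
        rcases hx with ⟨b', _, hb'⟩ | ⟨b', _, hb'⟩ <;> omega
    · intro b hb
      simp only [neg, pos, List.mem_append, List.mem_map] at hb
      rcases hb with (⟨b, hb, rfl⟩ | ⟨b, hb, rfl⟩) | hb
      exacts [hT.mem b hb, hT.mem b hb, hL.mem b hb]
    · intro b hb
      simp only [neg, pos, List.mem_append, List.mem_map] at hb
      rcases hb with (⟨b, hb, rfl⟩ | ⟨b, hb, rfl⟩) | hb
      · exact fun x hx hxb => by have := hN x hx; simp only at hxb; omega
      · exact fun x hx hxb => by have := hN x hx; simp only at hxb; omega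
      · exact hL.new b hb

/-- There are shells of prescribed signed numbers, placed at prescribed ends of the chords. -/
theorem exists_beads {W : Words} (hW : Valid W) (m : ℕ → ℤ) (p : ℕ → Bool) :
    ∃ S, Fresh W S ∧ (∀ b ∈ S, b.pt.isTerminal = p b.pt.chord ∧ m b.pt.chord ≠ 0) ∧
      (∀ e ∈ ends W, beadWeight S e.chord = m e.chord) := by
  obtain ⟨N, hN, -, -⟩ := exists_name_bound W [] []
  let L := (ends W).filter fun e => e.isTerminal = p e.chord
  suffices H : ∀ L' : List Endpoint, (∀ e ∈ L', e ∈ L) → ∃ S : List Bead, (S.map Bead.name).Nodup ∧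
      (∀ b ∈ S, N ≤ b.name) ∧ (∀ b ∈ S, b.pt ∈ L ∧ m b.pt.chord ≠ 0) ∧
      ∀ x, beadWeight S x = (L'.map fun e => if e.chord = x then m x else 0).sum by
    obtain ⟨S, h1, h2, h3, h4⟩ := H L fun _ h => h
    refine ⟨S, ⟨h1, fun b hb => (List.mem_filter.1 (h3 b hb).1).1, fun b hb x hx hxb => ?_⟩,
      fun b hb => ⟨by simpa using (List.mem_filter.1 (h3 b hb).1).2, (h3 b hb).2⟩,
      fun e he => ?_⟩
    · have := hN x hx
      have := h2 b hb
      omega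
    · rw [h4]
      obtain ⟨e', he', hc, ht⟩ : ∃ e' ∈ ends W, e'.chord = e.chord ∧
          e'.isTerminal = p e.chord := by
        by_cases h : e.isTerminal = p e.chord
        · exact ⟨e, he, rfl, h⟩
        · refine ⟨e.opp, hW.opp_mem e he, rfl, ?_⟩
          rw [isTerminal_opp]
          cases h5 : e.isTerminal <;> cases h6 : p e.chord <;> simp_all
      have hn : L.Nodup := hW.nodup.filter _
      have heL : e' ∈ L := List.mem_filter.2 ⟨he', by simp [ht, hc]⟩
      have h5 : (L.map fun z => if z.chord = e.chord then m e.chord else 0) =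
          L.map fun z => if z = e' then m e.chord else 0 := by
        refine List.map_congr_left fun z hz => if_congr ⟨fun hzc => ?_, fun h => by rw [h, hc]⟩
          rfl rfl
        obtain ⟨hz1, hz2⟩ := List.mem_filter.1 hz
        rcases hW.eq_or_eq_opp he' hz1 (hzc.trans hc.symm) with h | h
        · exact h
        · simp [h, ht, hc] at hz2
      rw [h5, ← List.sum_toFinset _ hn, Finset.sum_ite_eq', if_pos (List.mem_toFinset.2 heL)]
  intro L'
  induction L' with
  | nil => exact fun _ => ⟨[], by simp, by simp, by simp, by simp [beadWeight]⟩
  | cons e L' ih =>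
    intro hL'
    obtain ⟨S, h1, h2, h3, h4⟩ := ih fun x hx => hL' x (by simp [hx])
    have he := hL' e (by simp)
    obtain ⟨σ, hσ⟩ : ∃ σ : ℤˣ, ((m e.chord).natAbs : ℤ) * σ = m e.chord := by
      rcases Int.natAbs_eq (m e.chord) with h | h
      · exact ⟨1, by simpa using h.symm⟩
      · exact ⟨-1, by simpa using h.symm⟩
    have key : ∀ n : ℕ, n ≤ (m e.chord).natAbs → ∃ S : List Bead, (S.map Bead.name).Nodup ∧
        (∀ b ∈ S, N ≤ b.name) ∧ (∀ b ∈ S, b.pt ∈ L ∧ m b.pt.chord ≠ 0) ∧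
        ∀ x, beadWeight S x = (if e.chord = x then (n : ℤ) * σ else 0) +
          (L'.map fun e => if e.chord = x then m x else 0).sum := by
      intro n
      induction n with
      | zero => exact fun _ => ⟨S, h1, h2, h3, by simpa using h4⟩
      | succ n ihn =>
        intro hn
        obtain ⟨S, h1, h2, h3, h4⟩ := ihn (by omega)
        obtain ⟨N', -, hN', -⟩ := exists_name_bound W S []
        refine ⟨⟨e, N + N', σ⟩ :: S, ?_, ?_, ?_, ?_⟩
        · rw [List.map_cons, List.nodup_cons]
          refine ⟨fun h => ?_, h1⟩
          obtain ⟨b, hb, hbn⟩ := List.mem_map.1 h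
          have := hN' b hb
          simp only at hbn
          omega
        · rintro b (_ | ⟨_, hb⟩)
          exacts [by simp, h2 b hb]
        · rintro b (_ | ⟨_, hb⟩)
          · exact ⟨he, fun h => by simp only at h; rw [h] at hn; simp at hn⟩
          · exact h3 b hb
        · intro x
          have := h4 x
          rw [beadWeight] at this
          rw [beadWeight, signedCount_cons, this]
          split_ifs
          · push_cast
            ring
          · ring
    obtain ⟨S, h1, h2, h3, h4⟩ := key _ le_rfl
    refine ⟨S, h1, h2, h3, fun x => ?_⟩
    rw [h4, List.map_cons, List.sum_cons]
    split_ifs with h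
    · rw [hσ, h]
    · rfl

open Classical in
/-- The S-class of the diagram in which every chord `x` of `W` carries `m x` shells, counted with
signs. -/
noncomputable def weightedClass (W : Words) (m : ℕ → ℤ) : SClass :=
  if h : Valid W then sClass (shelled W (exists_beads h m fun _ => false).choose) else sClass W

theorem weightedClass_eq {W : Words} (hW : Valid W) {m : ℕ → ℤ} {S : List Bead} (hS : Fresh W S)
    (h : ∀ e ∈ ends W, beadWeight S e.chord = m e.chord) :
    sClass (shelled W S) = weightedClass W m := by
  rw [weightedClass, dif_pos hW]
  obtain ⟨h1, -, h3⟩ := (exists_beads hW m fun _ => false).choose_spec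
  refine sClass_shelled_eq_of_beadWeight hW hS h1 fun x => ?_
  by_cases hx : ∃ e ∈ ends W, e.chord = x
  · obtain ⟨e, he, rfl⟩ := hx
    rw [h e he, h3 e he]
  · have key : ∀ T, Fresh W T → beadWeight T x = 0 := by
      intro T hT
      refine List.sum_eq_zero fun y hy => ?_
      obtain ⟨b, hb, rfl⟩ := List.mem_map.1 hy
      exact if_neg fun hbx => hx ⟨b.pt, hT.mem b hb, hbx⟩
    rw [key _ hS, key _ h1]

end GaussDiagram

/-! ### Moves of weighted diagrams -/

namespace GaussDiagram

open Endpoint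

theorem weightedClass_congr {W : Words} (hW : Valid W) {m m' : ℕ → ℤ}
    (h : ∀ e ∈ ends W, m e.chord = m' e.chord) : weightedClass W m = weightedClass W m' := by
  obtain ⟨S, hS, -, hSm⟩ := exists_beads hW m fun _ => false
  rw [← weightedClass_eq hW hS hSm, ← weightedClass_eq hW hS fun e he => (hSm e he).trans (h e he)]

theorem weightedClass_zero {W : Words} (hW : Valid W) : weightedClass W 0 = sClass W :=
  (weightedClass_eq hW (Fresh.nil W) fun _ _ => rfl).symm

theorem shelled_rotate {W W' : Words} (h : ∀ i, (W' i).IsRotated (W i)) (S : List Bead)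
    (i : Fin 2) :
    (shelled W' S i).IsRotated (shelled W S i) := by
  induction S with
  | nil => exact h i
  | cons b S ih => exact isRotated_flatMap ih _

theorem Fresh.of_ends {W W' : Words} {S : List Bead} (h : Fresh W S)
    (hp : (ends W).Perm (ends W')) : Fresh W' S :=
  ⟨h.nodup, fun b hb => hp.mem_iff.1 (h.mem b hb),
    fun b hb x hx => h.new b hb x (hp.mem_iff.2 hx)⟩

theorem weightedClass_rotate {W W' : Words} (hW : Valid W) (h : ∀ i, (W' i).IsRotated (W i))
    (m : ℕ → ℤ) : weightedClass W m = weightedClass W' m := by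
  obtain ⟨S, hS, -, hSm⟩ := exists_beads hW m fun _ => false
  have hp : (ends W).Perm (ends W') := ends_perm fun i => (h i).perm.symm
  rw [← weightedClass_eq hW hS hSm, ← weightedClass_eq (hW.of_perm hp) (hS.of_ends hp)
    fun e he => hSm e (hp.mem_iff.2 he)]
  exact sClass_rotate (hW.shelled hS) fun i => shelled_rotate h S i

/-- An explicit shell may be counted in the weight of its chord instead. -/
theorem weightedClass_addShell {W : Words} (hW : Valid W) {e : Endpoint} (he : e ∈ ends W) {c : ℕ}
    (hc : NewChord c W) (σ : ℤˣ) {m : ℕ → ℤ} (hm : m c = 0) :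
    weightedClass (addShell e c σ W) m = weightedClass W (m + Pi.single e.chord (σ : ℤ)) := by
  have hV := hW.addShell he hc σ
  have hp := ends_addShell_perm hW he c σ
  obtain ⟨S, hS, hS0, hSm⟩ := exists_beads hV m fun _ => false
  have hmem : ∀ b ∈ S, b.pt ∈ ends W := by
    intro b hb
    have hbc : b.pt.chord ≠ c := fun h => (hS0 b hb).2 (by rw [h, hm])
    have := hp.mem_iff.1 (hS.mem b hb)
    simp only [List.mem_cons] at this
    rcases this with h | h | h
    · exact absurd (by rw [h]; rfl) hbc
    · exact absurd (by rw [h]; rfl) hbc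
    · exact h
  have hF : Fresh W (S ++ [⟨e, c, σ⟩]) := by
    refine ⟨?_, ?_, ?_⟩
    · rw [List.map_append, List.nodup_append']
      refine ⟨hS.nodup, List.nodup_singleton _, ?_⟩
      intro x hx hx'
      obtain ⟨b, hb, rfl⟩ := List.mem_map.1 hx
      have hx' : b.name = c := by simpa using hx'
      exact hS.new b hb (shellStart c σ e) (hp.mem_iff.2 (by simp)) hx'.symm
    · intro b hb
      rcases List.mem_append.1 hb with hb | hb
      · exact hmem b hb
      · rw [List.mem_singleton.1 hb]; exact he
    · intro b hb
      rcases List.mem_append.1 hb with hb | hb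
      · exact fun x hx => hS.new b hb x (hp.mem_iff.2 (by simp [hx]))
      · rw [List.mem_singleton.1 hb]; exact hc
  rw [← weightedClass_eq hV hS hSm, ← weightedClass_eq hW hF fun x hx => ?_]
  · rw [shelled_append]
    rfl
  · have := hSm x (hp.mem_iff.2 (by simp [hx]))
    rw [beadWeight] at this
    rw [beadWeight, signedCount_append, this, Pi.add_apply, Pi.single_apply]
    simp [eq_comm]

/-- The move S2 for weighted diagrams: adjacent endpoints of different chords may be exchanged at
the cost of a shell on each of the two chords. -/
theorem weightedClass_swap {W : Words} (hW : Valid W) {a b : Endpoint} {i : Fin 2}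
    {l : List Endpoint} (hab : a.chord ≠ b.chord) (hi : (W i).IsRotated (a :: b :: l))
    (m : ℕ → ℤ) : weightedClass W m = weightedClass (swapWords a b W)
      (m + Pi.single a.chord ((a.sign * b.sign : ℤˣ) : ℤ) -
        Pi.single b.chord ((a.sign * b.sign : ℤˣ) : ℤ)) := by
  -- The shells are kept away from the endpoints that move.
  obtain ⟨S, hS, hS0, hSm⟩ := exists_beads hW m fun x => if x = a.chord then !a.isTerminal
    else !b.isTerminal
  have hpt : ∀ s ∈ S, s.pt ≠ a ∧ s.pt ≠ b := by
    refine fun s hs => ⟨?_, ?_⟩ <;>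
    · rintro rfl
      have := (hS0 s hs).1
      simp [hab.symm] at this
  have haW : a ∈ ends W := mem_ends.2 ⟨i, hi.mem_iff.2 (by simp)⟩
  have hbW : b ∈ ends W := mem_ends.2 ⟨i, hi.mem_iff.2 (by simp)⟩
  obtain ⟨l', hl'⟩ := shelled_isRotated hi hpt
  have hp : (ends W).Perm (ends (swapWords a b W)) :=
    ends_perm fun j => (swapWords_perm hW hi j).symm
  have hVs := hW.swapWords hi
  have hSs := hS.of_ends hp
  obtain ⟨N, hN, hSN, -⟩ := exists_name_bound W S []
  set δ := a.sign * b.sign with hδ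
  have hF : Fresh (swapWords a b W) (⟨a, N + 1, δ⟩ :: ⟨b, N, -δ⟩ :: S) := by
    refine ⟨?_, ?_, ?_⟩
    · simp only [List.map_cons, List.nodup_cons, List.mem_cons, List.mem_map, not_or, not_exists,
        not_and]
      refine ⟨⟨by omega, fun s hs => ?_⟩, fun s hs => ?_, hS.nodup⟩
      · have := hSN s hs; omega
      · have := hSN s hs; omega
    · rintro s (_ | ⟨_, _ | ⟨_, hs⟩⟩)
      exacts [hp.mem_iff.1 haW, hp.mem_iff.1 hbW, hSs.mem s hs]
    · rintro s (_ | ⟨_, _ | ⟨_, hs⟩⟩)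
      · exact fun x hx hxc => by have := hN x (hp.mem_iff.2 hx); simp only at hxc; omega
      · exact fun x hx hxc => by have := hN x (hp.mem_iff.2 hx); simp only at hxc; omega
      · exact hSs.new s hs
  have hE : shelled (swapWords a b W) (⟨a, N + 1, δ⟩ :: ⟨b, N, -δ⟩ :: S) =
      addShell a (N + 1) δ (addShell b N (-δ) (swapWords a b (shelled W S))) := by
    rw [swapWords_shelled fun s hs => ⟨(hpt s hs).1, (hpt s hs).2,
      (hS.new s hs a haW).symm, (hS.new s hs b hbW).symm⟩]
    rfl
  have hNc : NewChord N (shelled W S) := newChord_shelled hW hS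
    (fun x hx hxc => by have := hN x hx; omega) fun s hs hsc => by have := hSN s hs; omega
  have hVF := hVs.shelled hF
  rw [hE] at hVF
  rw [← weightedClass_eq hW hS hSm, ← weightedClass_eq hVs hF fun x hx => ?_, hE]
  · exact sClass_s2 (hW.shelled hS) hab hl' hNc hVF
  · have := hSm x (hp.mem_iff.2 hx)
    rw [beadWeight] at this
    rw [beadWeight, signedCount_cons, signedCount_cons, this]
    simp only [Pi.add_apply, Pi.sub_apply, Pi.single_apply, eq_comm (a := x.chord)]
    split_ifs <;> push_cast <;> ring

theorem Fresh.filterWords {W : Words} {S : List Bead} (h : Fresh W S) {p : Endpoint → Bool}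
    (hp : ∀ b ∈ S, p b.pt) : Fresh (filterWords p W) S :=
  ⟨h.nodup, fun b hb => by
    rw [ends_filterWords]
    exact List.mem_filter.2 ⟨h.mem b hb, hp b hb⟩, fun b hb x hx => by
    rw [ends_filterWords] at hx
    exact h.new b hb x (List.mem_filter.1 hx).1⟩

/-- The first Reidemeister move for weighted diagrams. -/
theorem weightedClass_r1 {W : Words} (hW : Valid W) {e : Endpoint} {i : Fin 2} {l : List Endpoint}
    (hi : (W i).IsRotated (e :: e.opp :: l)) {m : ℕ → ℤ} (hm : m e.chord = 0) :
    weightedClass W m = weightedClass (filterWords (fun x => x.chord ≠ e.chord) W) m := by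
  obtain ⟨S, hS, hS0, hSm⟩ := exists_beads hW m fun _ => false
  have heW : e ∈ ends W := mem_ends.2 ⟨i, hi.mem_iff.2 (by simp)⟩
  have hne : ∀ s ∈ S, s.pt.chord ≠ e.chord := fun s hs h => (hS0 s hs).2 (by rw [h, hm])
  obtain ⟨l', hl'⟩ := shelled_isRotated hi (S := S)
    fun s hs => ⟨fun h => hne s hs (by rw [h]), fun h => hne s hs (by rw [h]; rfl)⟩
  rw [← weightedClass_eq hW hS hSm, sClass_r1 (hW.shelled hS) hl',
    filterWords_shelled (fun _ => rfl) fun s hs => ⟨by simpa using hne s hs,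
      decide_eq_true (hS.new s hs e heW).symm⟩]
  refine weightedClass_eq (hW.filterWords fun _ => rfl)
    (hS.filterWords fun s hs => by simpa using hne s hs) fun x hx => hSm x ?_
  rw [ends_filterWords] at hx
  exact (List.mem_filter.1 hx).1

/-- The second Reidemeister move for weighted diagrams. -/
theorem weightedClass_r2 {W : Words} (hW : Valid W) {a b : Endpoint} (ha : a.isTerminal = false)
    (hb : b.isTerminal = false) (hs : b.chordSign = -a.chordSign) {i j : Fin 2}
    {l l' : List Endpoint} (hi : (W i).IsRotated (a :: b :: l))
    (hj : (W j).IsRotated (a.opp :: b.opp :: l')) {m : ℕ → ℤ} (hma : m a.chord = 0)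
    (hmb : m b.chord = 0) : weightedClass W m =
      weightedClass (filterWords (fun x => x.chord ≠ a.chord ∧ x.chord ≠ b.chord) W) m := by
  obtain ⟨S, hS, hS0, hSm⟩ := exists_beads hW m fun _ => false
  have haW : a ∈ ends W := mem_ends.2 ⟨i, hi.mem_iff.2 (by simp)⟩
  have hbW : b ∈ ends W := mem_ends.2 ⟨i, hi.mem_iff.2 (by simp)⟩
  have hne : ∀ s ∈ S, s.pt.chord ≠ a.chord ∧ s.pt.chord ≠ b.chord := fun s hs =>
    ⟨fun h => (hS0 s hs).2 (by rw [h, hma]), fun h => (hS0 s hs).2 (by rw [h, hmb])⟩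
  obtain ⟨l1, hl1⟩ := shelled_isRotated hi (S := S)
    fun s hs => ⟨fun h => (hne s hs).1 (by rw [h]), fun h => (hne s hs).2 (by rw [h])⟩
  obtain ⟨l2, hl2⟩ := shelled_isRotated hj (S := S)
    fun s hs => ⟨fun h => (hne s hs).1 (by rw [h]; rfl), fun h => (hne s hs).2 (by rw [h]; rfl)⟩
  rw [← weightedClass_eq hW hS hSm, sClass_r2 (hW.shelled hS) ha hb hs hl1 (.inl hl2),
    filterWords_shelled (fun _ => rfl) fun s hs => ⟨by simpa using hne s hs,
      decide_eq_true ⟨(hS.new s hs a haW).symm, (hS.new s hs b hbW).symm⟩⟩]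
  refine weightedClass_eq (hW.filterWords fun _ => rfl)
    (hS.filterWords fun s hs => by simpa using hne s hs) fun x hx => hSm x ?_
  rw [ends_filterWords] at hx
  exact (List.mem_filter.1 hx).1

open Function (update)

theorem perm_update {W : Words} {i : Fin 2} {w : List Endpoint} (h : w.Perm (W i)) (j : Fin 2) :
    (update W i w j).Perm (W j) := by
  by_cases hj : j = i
  · subst hj
    simpa using h
  · simp [hj]

theorem Valid.update {W : Words} (hW : Valid W) {i : Fin 2} {w : List Endpoint}
    (h : w.Perm (W i)) : Valid (update W i w) :=
  hW.of_perm (ends_perm fun j => (perm_update h j).symm)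

theorem isRotated_update {W : Words} {i : Fin 2} {w : List Endpoint} (h : w.IsRotated (W i))
    (j : Fin 2) : (update W i w j).IsRotated (W j) := by
  by_cases hj : j = i
  · subst hj
    simpa using h
  · simpa [hj] using List.IsRotated.refl (W j)

theorem swapWords_eq_update {W : Words} (hW : Valid W) {a b : Endpoint} {i : Fin 2}
    {p q : List Endpoint} (hi : W i = p ++ a :: b :: q) :
    swapWords a b W = update W i (p ++ b :: a :: q) := by
  have hr : (W i).IsRotated (a :: b :: (q ++ p)) := by
    rw [hi]
    exact isRotated_append_comm p (a :: b :: q)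
  funext j
  by_cases hj : j = i
  · subst hj
    have hn := hr.perm.nodup_iff.1 (hW.nodup_word j)
    simp only [List.nodup_cons, List.mem_cons, List.mem_append, not_or] at hn
    rw [Function.update_self, swapWords, hi, List.map_append, List.map_cons, List.map_cons,
      Equiv.swap_apply_left, Equiv.swap_apply_right, map_swap_of_not_mem hn.1.2.2 hn.2.1.2,
      map_swap_of_not_mem hn.1.2.1 hn.2.1.1]
  · rw [Function.update_of_ne hj, swapWords_of_ne hW hj hr]

theorem isRotated_of_eq_append {W : Words} {a b : Endpoint} {i : Fin 2}
    {p q : List Endpoint} (hi : W i = p ++ a :: b :: q) :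
    (W i).IsRotated (a :: b :: (q ++ p)) := by
  rw [hi]
  exact isRotated_append_comm p (a :: b :: q)

/-- The chords in a word, each endpoint counted with its sign. -/
def chordSum (w : List Endpoint) : ℕ → ℤ :=
  (w.map fun h => Pi.single h.chord (h.sign : ℤ)).sum

@[simp] theorem chordSum_nil : chordSum [] = 0 := rfl

@[simp] theorem chordSum_cons (h : Endpoint) (w : List Endpoint) :
    chordSum (h :: w) = Pi.single h.chord (h.sign : ℤ) + chordSum w := by simp [chordSum]

theorem chordSum_perm {w w' : List Endpoint} (h : w.Perm w') : chordSum w = chordSum w' :=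
  (h.map _).sum_eq

theorem chordSum_apply_eq_zero {w : List Endpoint} {c : ℕ} (h : ∀ x ∈ w, x.chord ≠ c) :
    chordSum w c = 0 := by
  induction w with
  | nil => rfl
  | cons x w ih =>
    rw [chordSum_cons, Pi.add_apply, ih fun y hy => h y (by simp [hy]),
      Pi.single_eq_of_ne (h x (by simp)).symm, add_zero]

/-- The change of the weights when an endpoint moves past a word `u` of endpoints of other
chords. -/
theorem weightedClass_pass {i : Fin 2} {a : Endpoint} (u : List Endpoint) :
    ∀ {W : Words} {p q : List Endpoint}, Valid W → W i = p ++ a :: (u ++ q) →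
      (∀ x ∈ u, x.chord ≠ a.chord) → ∀ m : ℕ → ℤ, weightedClass W m =
        weightedClass (update W i (p ++ u ++ a :: q))
          (m + Pi.single a.chord (a.sign * signSum u) - (a.sign : ℤ) • chordSum u) := by
  induction u with
  | nil =>
    intro W p q _ hi _ m
    rw [List.append_nil, show p ++ a :: q = W i by simp [hi]]
    simp
  | cons b u ih =>
    intro W p q hW hi hu m
    have hi' : W i = p ++ a :: b :: (u ++ q) := hi
    have hab : a.chord ≠ b.chord := (hu b (by simp)).symm
    have hr := isRotated_of_eq_append hi'
    have hE := swapWords_eq_update hW hi'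
    have hV := hW.swapWords hr
    rw [weightedClass_swap hW hab hr, hE]
    rw [hE] at hV
    rw [ih (p := p ++ [b]) (q := q) hV (by simp) fun x hx => hu x (by simp [hx])]
    rw [Function.update_idem, List.append_assoc p [b] u, List.singleton_append]
    congr 1
    funext x
    simp only [Pi.add_apply, Pi.sub_apply, Pi.smul_apply, chordSum_cons, signSum_cons,
      Pi.single_apply, smul_eq_mul, Units.val_mul]
    split_ifs <;> ring

end GaussDiagram

/-! ### Rearranging the endpoints of a diagram of total sign `-1` -/

namespace GaussDiagram

open Endpoint Function

theorem exists_newChord (W : Words) : ∃ c, NewChord c W := by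
  obtain ⟨N, hN, -, -⟩ := exists_name_bound W [] []
  exact ⟨N, fun x hx h => by have := hN x hx; omega⟩

theorem exists_negative {w : List Endpoint} (h : signSum w < 0) : ∃ e ∈ w, e.sign = -1 := by
  by_contra! H
  have : 0 ≤ signSum w := List.sum_nonneg fun z hz => by
    obtain ⟨e, he, rfl⟩ := List.mem_map.1 hz
    simp [(Int.units_eq_one_or e.sign).resolve_right (H e he)]
  omega

theorem weightedClass_update_isRotated {W : Words} (hW : Valid W) {i : Fin 2} {w w' : List Endpoint}
    (hi : W i = w) (h : w.IsRotated w') (m : ℕ → ℤ) :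
    weightedClass W m = weightedClass (update W i w') m :=
  weightedClass_rotate hW (isRotated_update (by rw [hi]; exact h.symm)) m

/-- A shell on a negative endpoint `e` has a negative endpoint that can be carried over the rest
of the circle; the total sign being `-1`, this returns the shell to `e`, as a free chord, and
changes the weights by the chords on the circle. -/
theorem weightedClass_add_chordSum_aux {W : Words} (hW : Valid W) {i : Fin 2} {e : Endpoint}
    {u : List Endpoint} (hi : W i = e :: u) (he : e.sign = -1) (hT : signSum (W i) = -1)
    (m : ℕ → ℤ) : weightedClass W m = weightedClass W (m + chordSum (W i)) := by
  obtain ⟨c, hc⟩ := exists_newChord W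
  have heW : e ∈ ends W := mem_ends.2 ⟨i, by simp [hi]⟩
  have hec := hc e heW
  have hu : ∀ x ∈ u, x.chord ≠ c := fun x hx => hc x (mem_ends.2 ⟨i, by simp [hi, hx]⟩)
  have hu0 : signSum u = 0 := by
    rw [hi, signSum_cons, he] at hT
    simpa using hT
  set m₀ : ℕ → ℤ := update (m - Pi.single e.chord 1) c 0 with hm₀
  have hc0 : m₀ c = 0 := by simp [hm₀]
  set s := shellStart c 1 e with hs
  have hss : s.opp.sign = -1 := by rw [sign_opp, sign_shellStart, he]; simp
  have hV := hW.addShell heW hc 1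
  have h1 := weightedClass_addShell hW heW hc 1 hc0
  have hWi : addShell e c 1 W i = [s, e] ++ s.opp :: (u ++ []) := by
    rw [addShell_append (hW.nodup_word i) (p := []) hi]
    simp [hs]
  have h2 := weightedClass_pass u hV hWi (fun x hx => by simpa [hs] using hu x hx) m₀
  have hV2 : Valid (update (addShell e c 1 W) i ([s, e] ++ u ++ [s.opp])) := by
    refine hV.update ?_
    rw [hWi, List.append_nil, List.append_assoc]
    exact List.perm_append_comm.append_left [s, e]
  have h3 := weightedClass_r1 hV2 (i := i) (e := s.opp) (l := e :: u)
    (m := m₀ + Pi.single s.opp.chord (s.opp.sign * signSum u) - (s.opp.sign : ℤ) • chordSum u)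
    (by
      rw [update_self, opp_opp]
      exact isRotated_append_comm ([s, e] ++ u) [s.opp])
    (by
      have := chordSum_apply_eq_zero hu
      simp [hs, hu0, hc0, this])
  have h4 : filterWords (fun x => x.chord ≠ s.opp.chord)
      (update (addShell e c 1 W) i ([s, e] ++ u ++ [s.opp])) = W := by
    funext j
    by_cases hj : j = i
    · subst hj
      have : u.filter (fun x => x.chord ≠ c) = u :=
        List.filter_eq_self.2 fun x hx => by simpa using hu x hx
      simp only [ne_eq, decide_not] at this
      simp [filterWords, hs, hec, hi, this]
    · have hej : e ∉ W j := fun h => hj (hW.eq_of_mem h (by simp [hi]))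
      rw [filterWords, update_of_ne hj, addShell_of_not_mem hej]
      exact List.filter_eq_self.2 fun x hx => by simpa [hs] using hc x (mem_ends.2 ⟨j, hx⟩)
  rw [h4] at h3
  rw [h3, h1] at h2
  rw [weightedClass_congr hW fun x hx => ?_, h2, weightedClass_congr hW fun x hx => ?_]
  · have := hc x hx
    rw [hi, chordSum_cons, he, hss, hu0]
    by_cases hxe : x.chord = e.chord
    · simp [hm₀, hec, hxe]
      ring
    · simp [hm₀, this, hxe]
  · have := hc x hx
    simp [hm₀, this]

/-- When the total sign of a circle is `-1`, all the chords on the circle may receive shells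
simultaneously, as many as their endpoints on the circle say. -/
theorem weightedClass_add_chordSum {W : Words} (hW : Valid W) {i : Fin 2}
    (hT : signSum (W i) = -1) (m : ℕ → ℤ) :
    weightedClass W m = weightedClass W (m + chordSum (W i)) := by
  obtain ⟨e, he, hes⟩ := exists_negative (w := W i) (by omega)
  obtain ⟨p, q, hpq⟩ := List.append_of_mem he
  have hr : (W i).IsRotated (e :: (q ++ p)) := by
    rw [hpq]
    exact isRotated_append_comm p (e :: q)
  have h := weightedClass_add_chordSum_aux (W := update W i (e :: (q ++ p)))
    (hW.update hr.perm.symm) (i := i) (update_self ..) hes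
    (by rw [update_self, ← signSum_perm hr.perm, hT]) m
  rw [weightedClass_update_isRotated hW rfl hr, weightedClass_update_isRotated hW rfl hr, h,
    update_self, chordSum_perm hr.perm]

/-- When the total sign of a circle is `-1`, the weight of a nonself-chord that ends on this circle
is immaterial: its endpoint may be carried around the circle. -/
theorem weightedClass_add_single_aux {W : Words} (hW : Valid W) {i : Fin 2}
    (hT : signSum (W i) = -1) {a : Endpoint} (ha : a ∈ W i) (ha' : a.opp ∉ W i) (m : ℕ → ℤ) :
    weightedClass W m = weightedClass W (m + Pi.single a.chord (a.sign : ℤ)) := by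
  obtain ⟨p, q, hpq⟩ := List.append_of_mem ha
  have hr : (W i).IsRotated (a :: (q ++ p)) := by
    rw [hpq]
    exact isRotated_append_comm p (a :: q)
  set u := q ++ p with hu
  have hV := hW.update hr.perm.symm
  have hun : a ∉ u := (List.nodup_cons.1 (hr.perm.nodup_iff.1 (hW.nodup_word i))).1
  have hS : signSum u = -1 - a.sign := by
    rw [signSum_perm hr.perm, signSum_cons] at hT
    omega
  have h1 := weightedClass_pass u (i := i) (q := []) (p := []) (a := a) hV (by simp)
    (fun x hx hc => by
      have hxW : x ∈ W i := hr.mem_iff.2 (by simp [hx])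
      rcases hW.eq_or_eq_opp (mem_ends.2 ⟨i, ha⟩) (mem_ends.2 ⟨i, hxW⟩) hc with rfl | rfl
      exacts [hun hx, ha' hxW]) (m + Pi.single a.chord (a.sign : ℤ))
  rw [update_idem, List.nil_append, ← weightedClass_update_isRotated hW rfl hr,
    ← weightedClass_update_isRotated hW rfl (hr.trans (isRotated_append_comm [a] u))] at h1
  have hV : chordSum (W i) = Pi.single a.chord (a.sign : ℤ) + chordSum u := by
    rw [chordSum_perm hr.perm, chordSum_cons]
  have h2 : m + Pi.single a.chord (a.sign : ℤ) + Pi.single a.chord (a.sign * signSum u) -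
      (a.sign : ℤ) • chordSum u = m - (a.sign : ℤ) • chordSum (W i) := by
    rw [hV, hS]
    funext x
    have := a.sign_mul_self
    simp only [Pi.add_apply, Pi.sub_apply, Pi.smul_apply, Pi.single_apply, smul_eq_mul]
    split_ifs
    · linear_combination 0 * this
    · ring
  rw [h1, h2]
  rcases Int.units_eq_one_or a.sign with hs | hs
  · rw [weightedClass_add_chordSum hW hT (m - _)]
    simp [hs]
  · rw [weightedClass_add_chordSum hW hT m]
    simp [hs]

theorem weightedClass_update {W : Words} (hW : Valid W) {i : Fin 2}
    (hT : signSum (W i) = -1) {a : Endpoint} (ha : a ∈ W i) (ha' : a.opp ∉ W i) (m : ℕ → ℤ)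
    (z : ℤ) : weightedClass W m = weightedClass W (update m a.chord z) := by
  have key := weightedClass_add_single_aux hW hT ha ha'
  have hpos : ∀ m, weightedClass W m = weightedClass W (m + Pi.single a.chord 1) := by
    intro m
    rcases Int.units_eq_one_or a.sign with hs | hs
    · rw [key m, hs]; simp
    · rw [key (m + Pi.single a.chord 1), hs, add_assoc, ← Pi.single_add]; simp
  have hz : ∀ k : ℤ, weightedClass W m = weightedClass W (m + Pi.single a.chord k) := by
    intro k
    induction k with
    | zero => simp
    | succ k ih => rw [ih, hpos, add_assoc, ← Pi.single_add]
    | pred k ih =>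
      rw [ih]
      refine ((hpos _).trans ?_).symm
      rw [add_assoc, ← Pi.single_add, sub_add_cancel]
  rw [hz (z - m a.chord)]
  congr 1
  funext x
  by_cases hx : x = a.chord
  · subst hx; simp
  · simp [hx]

/-- When the total sign of the first circle is `-1`, only the weights of the self-chords matter. -/
theorem weightedClass_eq_of_eq_on_self {W : Words} (hW : Valid W) (hT : signSum (W 0) = -1)
    {m m' : ℕ → ℤ} (h : ∀ i, ∀ e ∈ W i, e.opp ∈ W i → m e.chord = m' e.chord) :
    weightedClass W m = weightedClass W m' := by
  suffices H : ∀ l : List Endpoint, (∀ a ∈ l, a ∈ W 0 ∧ a.opp ∉ W 0) → ∀ m : ℕ → ℤ,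
      (∀ e ∈ ends W, m e.chord ≠ m' e.chord → ∃ a ∈ l, a.chord = e.chord) →
      weightedClass W m = weightedClass W m' by
    refine H ((W 0).filter fun a => a.opp ∉ W 0) (fun a ha => by simpa using ha) m
      fun e he hne => ?_
    obtain ⟨i, hi⟩ := mem_ends.1 he
    have hi' : e.opp ∉ W i := fun h' => hne (h i e hi h')
    obtain ⟨j, hj⟩ := mem_ends.1 (hW.opp_mem e he)
    have hij : j ≠ i := fun h' => hi' (h' ▸ hj)
    by_cases h0 : i = 0
    · subst h0
      exact ⟨e, by simp [hi, hi'], rfl⟩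
    · obtain rfl : j = 0 := by omega
      refine ⟨e.opp, ?_, rfl⟩
      have : e ∉ W 0 := fun h' => hij (hW.eq_of_mem h' hi)
      simp [hj, this]
  intro l
  induction l with
  | nil =>
    intro _ m hm
    refine weightedClass_congr hW fun e he => ?_
    by_contra hne
    simpa using hm e he hne
  | cons a l ih =>
    intro hl m hm
    have ha := hl a (by simp)
    rw [weightedClass_update hW hT ha.1 ha.2 m (m' a.chord)]
    refine ih (fun b hb => hl b (by simp [hb])) _ fun e he hne => ?_
    by_cases hea : e.chord = a.chord
    · simp [hea] at hne
    · rw [update_of_ne hea] at hne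
      obtain ⟨b, hb, hbe⟩ := hm e he hne
      rcases List.mem_cons.1 hb with rfl | hb
      · exact absurd hbe.symm hea
      · exact ⟨b, hb, hbe⟩

/-- The endpoints of `W` can be rearranged along the circles to `W'`: for all weights of the chords
there are new weights that give the same class and the same weighted indices. -/
structure Reorders (W W' : Words) : Prop where
  perm : ∀ i, (W i).Perm (W' i)
  exists_weight : ∀ m, ∃ m', weightedClass W m = weightedClass W' m' ∧
    ∀ i, ∀ g ∈ W i, g.opp ∈ W i → weightedIndex W m i g = weightedIndex W' m' i g

namespace Reorders

variable {W W' W'' : Words}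

theorem refl (W : Words) : Reorders W W := ⟨fun _ => .refl _, fun m => ⟨m, rfl, by simp⟩⟩

theorem trans (h : Reorders W W') (h' : Reorders W' W'') : Reorders W W'' := by
  refine ⟨fun i => (h.perm i).trans (h'.perm i), fun m => ?_⟩
  obtain ⟨m', h1, h2⟩ := h.exists_weight m
  obtain ⟨m'', h3, h4⟩ := h'.exists_weight m'
  refine ⟨m'', h1.trans h3, fun i g hg hg' => ?_⟩
  rw [h2 i g hg hg', h4 i g ((h.perm i).mem_iff.1 hg) ((h.perm i).mem_iff.1 hg')]

theorem of_isRotated (hW : Valid W) (h : ∀ i, (W' i).IsRotated (W i)) : Reorders W W' :=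
  ⟨fun i => (h i).perm.symm, fun m => ⟨m, weightedClass_rotate hW h m, fun i g hg hg' => by
    rw [weightedIndex, weightedIndex, arcSum_congr (hW.nodup_word i) (h i).symm hg hg']⟩⟩

theorem swap_of_ne (hW : Valid W) {a b : Endpoint} {i : Fin 2} {p q : List Endpoint}
    (hi : W i = p ++ a :: b :: q) (hab : a.chord ≠ b.chord) :
    Reorders W (update W i (p ++ b :: a :: q)) := by
  have hr := isRotated_of_eq_append hi
  rw [← swapWords_eq_update hW hi]
  exact ⟨fun j => (swapWords_perm hW hr j).symm, fun m => ⟨_, weightedClass_swap hW hab hr m,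
    fun j g hg hg' => (weightedIndex_swap hW hr hab m hg hg').symm⟩⟩

theorem pass {i : Fin 2} {a : Endpoint} (u : List Endpoint) :
    ∀ {W : Words} {p q : List Endpoint}, Valid W → W i = p ++ a :: (u ++ q) →
      (∀ x ∈ u, x.chord ≠ a.chord) → Reorders W (update W i (p ++ u ++ a :: q)) := by
  induction u with
  | nil =>
    intro W p q _ hi _
    rw [List.append_nil, show p ++ a :: q = W i by simp [hi], update_eq_self]
    exact refl W
  | cons b u ih =>
    intro W p q hW hi hu
    have hi' : W i = p ++ a :: b :: (u ++ q) := hi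
    have h1 := swap_of_ne hW hi' (hu b (by simp)).symm
    have h2 := ih (W := update W i (p ++ b :: a :: (u ++ q))) (p := p ++ [b]) (q := q)
      (hW.of_perm (ends_perm h1.perm)) (by simp) fun x hx => hu x (by simp [hx])
    rw [update_idem, List.append_assoc p [b] u, List.singleton_append] at h2
    exact h1.trans h2

/-- Adjacent endpoints of the same chord are exchanged by carrying one of them around the rest of
the circle. -/
theorem swap (hW : Valid W) {a b : Endpoint} {i : Fin 2} {p q : List Endpoint}
    (hi : W i = p ++ a :: b :: q) : Reorders W (update W i (p ++ b :: a :: q)) := by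
  by_cases hab : a.chord = b.chord
  swap
  · exact swap_of_ne hW hi hab
  have hr : (W i).IsRotated (b :: (q ++ p) ++ [a]) := by
    rw [hi]
    simpa using isRotated_append_comm (p ++ [a]) (b :: q)
  have hn := hr.perm.nodup_iff.1 (hW.nodup_word i)
  have h1 : Reorders W (update W i (b :: (q ++ p) ++ [a])) :=
    of_isRotated hW (isRotated_update hr.symm)
  have hV := hW.of_perm (ends_perm h1.perm)
  have h2 := pass (i := i) (a := b) (q ++ p) (p := []) (q := [a]) hV (by simp) (fun x hx hxb => by
    have mem : ∀ y ∈ b :: (q ++ p) ++ [a], y ∈ ends W := fun y hy =>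
      mem_ends.2 ⟨i, hr.mem_iff.2 hy⟩
    have hxW := mem x (by simp only [List.mem_cons, List.mem_append] at hx ⊢; tauto)
    have hbW := mem b (by simp)
    rw [List.nodup_append, List.nodup_cons] at hn
    rcases hW.eq_or_eq_opp hbW hxW hxb with rfl | h3
    · exact hn.1.1 hx
    · rcases hW.eq_or_eq_opp hbW (mem a (by simp)) hab with rfl | h4
      · exact hn.2.2 a (by simp) a (by simp) rfl
      · exact hn.2.2 x (by simp [hx]) a (by simp) (h3.trans h4.symm))
  rw [update_idem] at h2
  have h3 := of_isRotated (hV.of_perm (ends_perm h2.perm))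
    (W' := update W i (p ++ b :: a :: q)) fun j => by
      by_cases hj : j = i
      · subst hj
        have h4 := isRotated_append_comm (p ++ [b, a]) q
        rw [update_self, update_self]
        simpa using h4
      · rw [update_of_ne hj, update_of_ne hj]
  exact h1.trans (h2.trans h3)

theorem update_append {w w' : List Endpoint} (h : w.Perm w') (i : Fin 2) :
    ∀ {W : Words} {p : List Endpoint}, Valid W → W i = p ++ w →
      Reorders W (update W i (p ++ w')) := by
  induction h with
  | nil =>
    intro W p _ hi
    rw [← hi, update_eq_self]
    exact refl W
  | cons x _ ih =>
    intro W p hW hi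
    simpa using ih (p := p ++ [x]) hW (by simp [hi])
  | swap x y l => exact fun hW hi => swap hW hi
  | trans _ _ ih1 ih2 =>
    intro W p hW hi
    have h1 := ih1 hW hi
    have h2 := ih2 (p := p) (hW.of_perm (ends_perm h1.perm)) (update_self ..)
    rw [update_idem] at h2
    exact h1.trans h2

theorem of_perm (hW : Valid W) (h : ∀ i, (W i).Perm (W' i)) : Reorders W W' := by
  have h1 := update_append (p := []) (h 0) 0 hW rfl
  have h2 := update_append (p := []) (h 1) 1 (hW.of_perm (ends_perm h1.perm)) rfl
  have h3 : update (update W 0 ([] ++ W' 0)) 1 ([] ++ W' 1) = W' := by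
    funext i
    fin_cases i <;> simp
  rw [h3] at h2
  exact h1.trans h2

end Reorders

/-- The total signs of the circles are those of a diagram of virtual linking number one. -/
structure Norm (W : Words) : Prop extends Valid W where
  total_zero : signSum (W 0) = -1
  total_one : signSum (W 1) = 1

theorem Norm.of_perm {W W' : Words} (hW : Norm W) (h : ∀ i, (W i).Perm (W' i)) : Norm W' :=
  ⟨hW.toValid.of_perm (ends_perm h), by rw [← signSum_perm (h 0), hW.total_zero],
    by rw [← signSum_perm (h 1), hW.total_one]⟩

/-- The weights `m` give the self-chords the weighted indices `w`. -/
def HasIndex (W : Words) (m w : ℕ → ℤ) : Prop :=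
  ∀ i, ∀ g ∈ W i, g.opp ∈ W i → g.isTerminal = false → weightedIndex W m i g = w g.chord

theorem exists_hasIndex {W : Words} (hW : Valid W) (w : ℕ → ℤ) : ∃ m, HasIndex W m w ∧
    ∀ i, ∀ e ∈ W i, e.opp ∉ W i → m e.chord = 0 := by
  have key : ∀ x, ∃ v : ℤ, (∀ i, ∀ g ∈ W i, g.opp ∈ W i → g.isTerminal = false → g.chord = x →
      arcSum (W i) g + g.sign * v = w x) ∧ ∀ i, ∀ e ∈ W i, e.opp ∉ W i → e.chord = x → v = 0 := by
    intro x
    by_cases h : ∃ i, ∃ g ∈ W i, g.opp ∈ W i ∧ g.isTerminal = false ∧ g.chord = x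
    · obtain ⟨i, g, hg, hg', hgt, rfl⟩ := h
      refine ⟨g.sign * (w g.chord - arcSum (W i) g), fun j f hf _ hft hfc => ?_,
        fun j e he he' hec => ?_⟩
      · rcases hW.eq_or_eq_opp (mem_ends.2 ⟨i, hg⟩) (mem_ends.2 ⟨j, hf⟩) hfc with rfl | rfl
        · rw [hW.eq_of_mem hf hg]
          linear_combination (w f.chord - arcSum (W i) f) * f.sign_mul_self
        · simp [hgt] at hft
      · rcases hW.eq_or_eq_opp (mem_ends.2 ⟨i, hg⟩) (mem_ends.2 ⟨j, he⟩) hec with rfl | rfl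
        · rw [hW.eq_of_mem he hg] at he'
          exact absurd hg' he'
        · rw [hW.eq_of_mem he hg', opp_opp] at he'
          exact absurd hg he'
    · exact ⟨0, fun i g hg hg' hgt hgx => absurd ⟨i, g, hg, hg', hgt, hgx⟩ h, fun _ _ _ _ _ => rfl⟩
  choose m hm using key
  exact ⟨m, fun i g hg hg' hgt => (hm g.chord).1 i g hg hg' hgt rfl,
    fun i e he he' => (hm e.chord).2 i e he he' rfl⟩

/-- The class of weighted words depends only on the set of endpoints on each circle and on the
weighted indices of the self-chords. -/
theorem weightedClass_eq_of_hasIndex {W W' : Words} (hW : Norm W) (hp : ∀ i, (W i).Perm (W' i))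
    {m m' w w' : ℕ → ℤ} (h : HasIndex W m w) (h' : HasIndex W' m' w')
    (hw : ∀ i, ∀ g ∈ W i, g.opp ∈ W i → w g.chord = w' g.chord) :
    weightedClass W m = weightedClass W' m' := by
  obtain ⟨n, h1, h2⟩ := (Reorders.of_perm hW.toValid hp).exists_weight m
  have hW' := hW.of_perm hp
  rw [h1]
  have key : ∀ i, ∀ e ∈ W' i, e.opp ∈ W' i → e.isTerminal = false → n e.chord = m' e.chord := by
    intro i e he he' het
    have he1 := (hp i).mem_iff.2 he
    have he2 := (hp i).mem_iff.2 he'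
    have h3 := h2 i e he1 he2
    rw [h i e he1 he2 het, hw i e he1 he2, ← h' i e he he' het, weightedIndex, weightedIndex] at h3
    linear_combination -(e.sign : ℤ) * h3 - (n e.chord - m' e.chord) * e.sign_mul_self
  refine weightedClass_eq_of_eq_on_self hW'.toValid hW'.total_zero fun i e he he' => ?_
  rcases het : e.isTerminal with _ | _
  · exact key i e he he' het
  · exact key i e.opp he' (by rwa [opp_opp]) (by simp [het])

/-- The S-class of the diagrams with the endpoints of `W` in which the self-chords have the weighted
indices `w`. Suitable weights exist by `exists_hasIndex` if `W` is valid, and their choice does not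
matter if moreover `Norm W` holds. -/
noncomputable def indexClass (W : Words) (w : ℕ → ℤ) : SClass :=
  weightedClass W (Classical.epsilon fun m => HasIndex W m w)

theorem indexClass_eq {W : Words} (hW : Norm W) {m w : ℕ → ℤ} (h : HasIndex W m w) :
    indexClass W w = weightedClass W m :=
  weightedClass_eq_of_hasIndex hW (fun _ => .refl _)
    (Classical.epsilon_spec (p := fun m => HasIndex W m w) ⟨m, h⟩) h fun _ _ _ _ => rfl

theorem indexClass_congr {W W' : Words} (hW : Norm W) (hp : ∀ i, (W i).Perm (W' i)) {w w' : ℕ → ℤ}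
    (hw : ∀ i, ∀ g ∈ W i, g.opp ∈ W i → w g.chord = w' g.chord) :
    indexClass W w = indexClass W' w' := by
  obtain ⟨m, hm, -⟩ := exists_hasIndex hW.toValid w
  obtain ⟨m', hm', -⟩ := exists_hasIndex (hW.of_perm hp).toValid w'
  rw [indexClass_eq hW hm, indexClass_eq (hW.of_perm hp) hm']
  exact weightedClass_eq_of_hasIndex hW hp hm hm' hw

end GaussDiagram

/-! ### Creating and deleting free chords and shells -/

namespace GaussDiagram

open Endpoint Function

/-- Words with total sign `0` may be inserted at two places without effect on the other chords. -/
theorem arcSum_insert {p q u v : List Endpoint} {e : Endpoint} (hn : (p ++ (u ++ (q ++ v))).Nodup)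
    (hp : signSum p = 0) (hq : signSum q = 0) (he : e ∈ u ++ v) (he' : e.opp ∈ u ++ v) :
    arcSum (p ++ (u ++ (q ++ v))) e = arcSum (u ++ v) e := by
  have hpm : (u ++ (q ++ v)).Perm (q ++ (v ++ u)) := by
    rw [← List.append_assoc q v u]
    exact List.perm_append_comm
  have hn1 : (u ++ (q ++ v)).Nodup := (List.nodup_append.1 hn).2.1
  have hn2 : (q ++ (v ++ u)).Nodup := hpm.nodup_iff.1 hn1
  have hn3 : (v ++ u).Nodup := (List.nodup_append.1 hn2).2.1
  have hm : ∀ {x}, x ∈ u ++ v → x ∈ u ++ (q ++ v) := fun {x} hx => by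
    simp only [List.mem_append] at hx ⊢
    tauto
  have hm' : ∀ {x}, x ∈ u ++ v → x ∈ v ++ u := fun {x} hx => List.perm_append_comm.mem_iff.1 hx
  rw [arcSum_append_congr (q := []) hn hn1 (by simpa using hp) (hm he) (hm he'), List.nil_append,
    arcSum_congr (w' := q ++ (v ++ u)) hn1 (by
      rw [← List.append_assoc q v u]
      exact isRotated_append_comm u (q ++ v)) (hm he) (hm he'),
    arcSum_append_congr (q := []) hn2 hn3 (by simpa using hq) (hm' he) (hm' he'), List.nil_append,
    arcSum_congr hn3 (isRotated_append_comm v u) (hm' he) (hm' he')]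

theorem ends_update_perm {W : Words} {i : Fin 2} {p w : List Endpoint}
    (h : w.Perm (p ++ W i)) : (ends (update W i w)).Perm (p ++ ends W) := by
  fin_cases i
  · simpa [ends] using h.append_right (W 1)
  · have h1 : (W 0 ++ (p ++ W 1)).Perm (p ++ (W 0 ++ W 1)) := by
      rw [← List.append_assoc, ← List.append_assoc]
      exact List.perm_append_comm.append_right _
    simpa [ends] using (h.append_left (W 0)).trans h1

theorem Norm.addPair {W : Words} (hW : Norm W) {x : Endpoint} (hx : NewChord x.chord W)
    (i : Fin 2) : Norm (update W i (x :: x.opp :: W i)) := by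
  have key : ∀ k, signSum (update W i (x :: x.opp :: W i) k) = signSum (W k) := by
    intro k
    by_cases hk : k = i
    · subst hk; simp
    · rw [update_of_ne hk]
  exact ⟨valid_cons_cons hW.toValid (.refl _) hx (ends_update_perm (p := [x, x.opp]) (.refl _)),
    by rw [key, hW.total_zero], by rw [key, hW.total_one]⟩

theorem NewChord.addPair {W : Words} {x : Endpoint} {c : ℕ} (hc : NewChord c W) (hx : x.chord ≠ c)
    (i : Fin 2) : NewChord c (update W i (x :: x.opp :: W i)) := by
  intro y hy
  have hp := ends_update_perm (W := W) (i := i) (p := [x, x.opp]) (.refl _)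
  replace hy := hp.mem_iff.1 hy
  simp only [List.cons_append, List.nil_append, List.mem_cons] at hy
  rcases hy with rfl | rfl | hy
  exacts [hx, hx, hc y hy]

theorem filter_chord_eq_self {W : Words} {c : ℕ} (hc : NewChord c W) (k : Fin 2) :
    (W k).filter (fun x => x.chord ≠ c) = W k :=
  List.filter_eq_self.2 fun x hx => by simpa using hc x (mem_ends.2 ⟨k, hx⟩)

/-- A new chord whose endpoints are adjacent may be added. -/
theorem indexClass_free {W : Words} (hW : Norm W) {x : Endpoint} (hx : NewChord x.chord W)
    {i : Fin 2} {w : ℕ → ℤ} (hw : w x.chord = if x.isTerminal then signSum (W i) else 0) :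
    indexClass (update W i (x :: x.opp :: W i)) w = indexClass W w := by
  obtain ⟨m, hm, -⟩ := exists_hasIndex hW.toValid w
  set U := update W i (x :: x.opp :: W i) with hU
  have hUi : U i = x :: x.opp :: W i := update_self ..
  have hNU := hW.addPair hx i
  have hmW : ∀ e ∈ ends W, m e.chord = update m x.chord 0 e.chord := fun e he => by
    rw [update_of_ne (hx e he)]
  have hI : HasIndex U (update m x.chord 0) w := by
    intro k g hg hg' hgt
    by_cases hgx : g.chord = x.chord
    · have hxU : x ∈ ends U := mem_ends.2 ⟨i, by simp [hUi]⟩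
      have hk : k = i := by
        rcases hNU.eq_or_eq_opp hxU (mem_ends.2 ⟨k, hg⟩) hgx with rfl | rfl
        · exact hNU.eq_of_mem hg (by simp)
        · exact hNU.eq_of_mem hg (by simp)
      subst hk
      rw [weightedIndex, hgx, update_self, mul_zero, add_zero, hw]
      rcases hNU.eq_or_eq_opp hxU (mem_ends.2 ⟨k, hg⟩) hgx with rfl | rfl
      · rw [arcSum_of_isRotated (u := []) (v := W k) (hNU.nodup_word k) (by
          rw [← hU, hUi]; exact .refl _), hgt]
        rfl
      · rw [isTerminal_opp, Bool.not_eq_false'] at hgt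
        rw [arcSum_of_isRotated (u := W k) (v := []) (hNU.nodup_word k) (by
          rw [← hU, hUi, opp_opp]; exact isRotated_append_comm [x] _), hgt]
        rfl
    · have mem : ∀ {y}, y.chord ≠ x.chord → y ∈ U k → y ∈ W k := by
        intro y hyx hy
        by_cases hk : k = i
        · subst hk
          rw [hUi] at hy
          simp only [List.mem_cons] at hy
          rcases hy with rfl | rfl | hy
          exacts [absurd rfl hyx, absurd rfl hyx, hy]
        · rwa [hU, update_of_ne hk] at hy
      rw [← hm k g (mem hgx hg) (mem hgx hg') hgt, weightedIndex, weightedIndex, update_of_ne hgx]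
      by_cases hk : k = i
      · subst hk
        have := arcSum_append_congr (p := [x, x.opp]) (q := []) (l := W k) (e := g)
          (by have := hNU.nodup_word k; rwa [← hU, hUi] at this) (hW.nodup_word k) (by simp)
          (mem hgx hg) (mem hgx hg')
        rw [hUi]
        simpa using this
      · rw [hU, update_of_ne hk]
  rw [indexClass_eq hNU hI, indexClass_eq hW hm, weightedClass_congr hW.toValid hmW,
    weightedClass_r1 hNU.toValid (e := x) (i := i) (l := W i) (by rw [update_self])
      (by simp)]
  congr 1
  funext k
  have := filter_chord_eq_self hx k
  by_cases hk : k = i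
  · subst hk
    simpa [filterWords] using this
  · simpa [filterWords, hk] using this

/-- Weighted indices of chords that do not occur are immaterial. -/
theorem indexClass_update {W : Words} (hW : Norm W) {c : ℕ} (hc : NewChord c W) (w : ℕ → ℤ)
    (z : ℤ) : indexClass W (update w c z) = indexClass W w :=
  indexClass_congr hW (fun _ => .refl _) fun i g hg _ => by
    rw [update_of_ne (hc g (mem_ends.2 ⟨i, hg⟩))]

/-- A self-chord with the weighted index of a shell may be created as a shell on a free chord. -/
theorem indexClass_shell {W : Words} (hW : Norm W) {e : Endpoint} (he : e.isTerminal = false)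
    (hc : NewChord e.chord W) {i : Fin 2} {w : ℕ → ℤ} (s : Bool)
    (hw : w e.chord = if s then 1 else signSum (W i) + 1) :
    indexClass (update W i (e :: e.opp :: W i)) w = indexClass W w := by
  obtain ⟨d, hd⟩ := exists_newChord (update W i (e :: e.opp :: W i))
  have hp2 := ends_update_perm (W := W) (i := i) (p := [e, e.opp]) (.refl _)
  have hed : e.chord ≠ d := hd e (hp2.mem_iff.2 (by simp))
  have hdW : NewChord d W := fun x hx => hd x (hp2.mem_iff.2 (by simp [hx]))
  -- `y` is positive if and only if `s` holds.
  set y : Endpoint := ⟨d, s, 1⟩ with hy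
  have hys : y.sign = 1 ↔ s := by cases s <;> simp [hy, sign]
  set w' := update w d (if s then signSum (W i) else 0) with hw'
  set D := update W i (y :: y.opp :: W i) with hD
  have hND : Norm D := hW.addPair hdW i
  have hcD : NewChord e.chord D := hc.addPair hed.symm i
  obtain ⟨m, hm, -⟩ := exists_hasIndex hND.toValid w'
  have hyD : y ∈ D i := by simp [hD]
  have hyD' : y ∈ ends D := mem_ends.2 ⟨i, hyD⟩
  set S := addShell y e.chord e.chordSign D with hS
  have hVS : Valid S := hND.toValid.addShell hyD' hcD e.chordSign
  set m₁ := update (m - Pi.single d (e.chordSign : ℤ)) e.chord 0 with hm₁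
  have hstart : shellStart e.chord e.chordSign y = e ∨
      shellStart e.chord e.chordSign y = e.opp := by
    obtain ⟨c, t, ε⟩ := e
    simp only at he
    subst he
    cases s <;> simp [shellStart, hy, sign, opp]
  -- The shell, as a pair of endpoints, is the chord of `e`.
  have hpS : ∀ k, (S k).Perm (update (update W i (e :: e.opp :: W i)) i
      (y :: y.opp :: update W i (e :: e.opp :: W i) i) k) := by
    intro k
    by_cases hk : k = i
    · subst hk
      have h1 := addShell_perm (hND.nodup_word k) hyD e.chord e.chordSign
      have h2 : (S k).Perm (e :: e.opp :: D k) := by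
        rcases hstart with h | h
        · rwa [h] at h1
        · rw [h, opp_opp] at h1
          exact h1.trans (.swap _ _ _)
      refine h2.trans ?_
      simp only [hD, update_self]
      exact List.perm_append_comm (l₁ := [e, e.opp]) (l₂ := [y, y.opp]) |>.append_right (W k)
    · have hyk : y ∉ D k := fun h => hk (hND.eq_of_mem h hyD)
      rw [hS, addShell_of_not_mem hyk, hD, update_of_ne hk, update_of_ne hk, update_of_ne hk]
  have hN2 := hW.addPair hc i
  have hNS : Norm S := (hN2.addPair hd i (x := y)).of_perm fun k => (hpS k).symm
  have hweights : ∀ x ∈ ends D,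
      (m₁ + Pi.single y.chord (e.chordSign : ℤ) : ℕ → ℤ) x.chord = m x.chord := by
    intro x hx
    rw [Pi.add_apply, hm₁, update_of_ne (hcD x hx)]
    simp [hy]
  have hI : HasIndex S m₁ w' := by
    intro k g hg hg' hgt
    by_cases hgc : g.chord = e.chord
    · have hk : k = i := by
        by_contra hk
        have hyk : y ∉ D k := fun h => hk (hND.eq_of_mem h hyD)
        rw [hS, addShell_of_not_mem hyk] at hg
        exact hcD g (mem_ends.2 ⟨k, hg⟩) hgc
      subst hk
      rw [weightedIndex, hgc, arcSum_of_shell hND.toValid hcD e.chordSign hyD hg hgc hgt]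
      have : signSum (D k) = signSum (W k) := by simp [hD]
      simp only [hm₁, hw', update_self, update_of_ne hed, mul_zero, add_zero, this, hw, hys]
    · have mem : ∀ {x}, x.chord ≠ e.chord → x ∈ S k → x ∈ D k := by
        intro x hxc hx
        by_cases hyk : y ∈ D k
        · have h1 := (addShell_perm (hND.nodup_word k) hyk e.chord e.chordSign).mem_iff.1 hx
          simp only [List.mem_cons] at h1
          rcases h1 with h1 | h1 | h1
          · exact absurd (by rw [h1]; rfl) hxc
          · exact absurd (by rw [h1]; rfl) hxc
          · exact h1
        · rwa [hS, addShell_of_not_mem hyk] at hx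
      have hgD := mem hgc hg
      rw [hS, weightedIndex_addShell hND.toValid hyD' hcD _ _ hgD (mem hgc hg'),
        ← hm k g hgD (mem hgc hg') hgt, weightedIndex, weightedIndex,
        hweights g (mem_ends.2 ⟨k, hgD⟩)]
  have h1 : indexClass S w' = indexClass D w' := by
    rw [indexClass_eq hNS hI, indexClass_eq hND hm, hS,
      weightedClass_addShell hND.toValid hyD' hcD _ (by simp [hm₁])]
    exact weightedClass_congr hND.toValid hweights
  have h2 : indexClass S w' = indexClass (update W i (e :: e.opp :: W i)) w' := by
    rw [indexClass_congr hNS hpS fun _ _ _ _ => rfl]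
    exact indexClass_free hN2 (x := y) hd (by simp [hw', hy])
  rw [← indexClass_update hN2 hd w (if s then signSum (W i) else 0), ← h2, h1,
    indexClass_free hW (x := y) hdW (by simp [hw', hy]), indexClass_update hW hdW]

/-- Self-chords whose weighted indices are those of free chords or of shells may be deleted. -/
theorem indexClass_delete {W : Words} (hW : Norm W) {e : Endpoint} (he : e.isTerminal = false)
    (hc : NewChord e.chord W) {i : Fin 2} {w : ℕ → ℤ}
    (hw : w e.chord = 0 ∨ w e.chord = 1 ∨ w e.chord = signSum (W i) ∨
      w e.chord = signSum (W i) + 1) :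
    indexClass (update W i (e :: e.opp :: W i)) w = indexClass W w := by
  rcases hw with hw | hw | hw | hw
  · exact indexClass_free hW hc (by simp [hw, he])
  · exact indexClass_shell hW he hc true (by simp [hw])
  · rw [← indexClass_free hW (x := e.opp) hc (i := i) (w := w) (by simp [hw, he]), opp_opp]
    refine indexClass_congr (hW.addPair hc i) (fun k => ?_) fun _ _ _ _ => rfl
    by_cases hk : k = i
    · subst hk
      simpa using .swap _ _ _
    · rw [update_of_ne hk, update_of_ne hk]
  · exact indexClass_shell hW he hc false (by simp [hw])

end GaussDiagram

/-! ### Cancelling chords of opposite signs -/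

namespace GaussDiagram

open Endpoint Function

theorem valid_of_ends_perm {U W : Words} (hW : Valid W) {x y : Endpoint}
    (hx : NewChord x.chord W) (hy : NewChord y.chord W) (hxy : x.chord ≠ y.chord)
    (hp : (ends U).Perm (x :: x.opp :: y :: y.opp :: ends W)) : Valid U := by
  have hp1 := ends_update_perm (W := W) (i := 0) (p := [y, y.opp]) (.refl _)
  have h1 : Valid (update W 0 (y :: y.opp :: W 0)) := valid_cons_cons hW (.refl _) hy hp1
  exact valid_cons_cons h1 hp1 (hx.addPair hxy.symm 0) hp

/-- Two parallel self-chords of opposite signs, each with the required weighted index, may be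
deleted. -/
theorem indexClass_parallel {W : Words} (hW : Norm W) {x y : Endpoint} (hxt : x.isTerminal = false)
    (hyt : y.isTerminal = false) (hs : y.chordSign = -x.chordSign) (hx : NewChord x.chord W)
    (hy : NewChord y.chord W) (hxy : x.chord ≠ y.chord) {w : ℕ → ℤ} (hw : w x.chord = w y.chord)
    {i : Fin 2} {u v : List Endpoint} (hi : W i = u ++ v) (hu : signSum u = w x.chord - y.sign) :
    indexClass (update W i ([x, y] ++ (u ++ ([x.opp, y.opp] ++ v)))) w = indexClass W w := by
  have hsgn : (y.sign : ℤ) = -x.sign := by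
    rw [sign_of_initial hxt, sign_of_initial hyt, hs]
    push_cast
    ring
  set U := update W i ([x, y] ++ (u ++ ([x.opp, y.opp] ++ v))) with hU
  have hUi : U i = [x, y] ++ (u ++ ([x.opp, y.opp] ++ v)) := update_self ..
  have hUk : ∀ {k}, k ≠ i → U k = W k := fun hk => update_of_ne hk _ _
  have hpi : (U i).Perm (x :: x.opp :: y :: y.opp :: W i) := by
    rw [hUi, hi]
    refine .cons x ?_
    have h1 : (y :: (u ++ ([x.opp, y.opp] ++ v))).Perm (y :: ([x.opp, y.opp] ++ (u ++ v))) := by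
      refine .cons y ?_
      rw [← List.append_assoc, ← List.append_assoc]
      exact List.perm_append_comm.append_right v
    exact h1.trans (.swap _ _ _)
  have hVU : Valid U := valid_of_ends_perm hW.toValid hx hy hxy
    (ends_update_perm (p := [x, x.opp, y, y.opp]) (hUi ▸ hpi))
  have hsU : ∀ k, signSum (U k) = signSum (W k) := by
    intro k
    by_cases hk : k = i
    · subst hk
      rw [signSum_perm hpi]
      simp
    · rw [hUk hk]
  have hNU : Norm U := ⟨hVU, by rw [hsU, hW.total_zero], by rw [hsU, hW.total_one]⟩
  have hxi : x ∈ U i := hpi.mem_iff.2 (by simp)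
  have hyi : y ∈ U i := hpi.mem_iff.2 (by simp)
  have eq_of_chord : ∀ {z g k}, z ∈ U i → z.isTerminal = false → g ∈ U k → g.isTerminal = false →
      g.chord = z.chord → g = z ∧ k = i := by
    intro z g k hz hzt hg hgt hgz
    rcases hVU.eq_or_eq_opp (mem_ends.2 ⟨i, hz⟩) (mem_ends.2 ⟨k, hg⟩) hgz with rfl | rfl
    · exact ⟨rfl, hVU.eq_of_mem hg hz⟩
    · simp [hzt] at hgt
  obtain ⟨m, hm, -⟩ := exists_hasIndex hW.toValid w
  set m' := update (update m x.chord 0) y.chord 0 with hm'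
  have hmx : m' x.chord = 0 := by simp [hm', hxy]
  have hmy : m' y.chord = 0 := by simp [hm']
  have hmo : ∀ {c}, c ≠ x.chord → c ≠ y.chord → m' c = m c := fun h1 h2 => by simp [hm', h1, h2]
  have hI : HasIndex U m' w := by
    intro k g hg hg' hgt
    by_cases hgx : g.chord = x.chord
    · obtain ⟨rfl, rfl⟩ := eq_of_chord hxi hxt hg hgt hgx
      rw [weightedIndex, hmx, arcSum_of_isRotated (u := y :: u) (v := y.opp :: v)
        (hVU.nodup_word k) (by rw [hUi]; exact .refl _), signSum_cons, hu]
      ring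
    by_cases hgy : g.chord = y.chord
    · obtain ⟨rfl, rfl⟩ := eq_of_chord hyi hyt hg hgt hgy
      rw [weightedIndex, hmy, arcSum_of_isRotated (u := u ++ [x.opp]) (v := v ++ [x])
        (hVU.nodup_word k) (by
          rw [hUi]
          simpa using isRotated_append_comm [x] (g :: (u ++ x.opp :: g.opp :: v))),
        signSum_append, hu, ← hw]
      simp [hsgn]
    have mem : ∀ {z}, z.chord ≠ x.chord → z.chord ≠ y.chord → z ∈ U k → z ∈ W k := by
      intro z hzx hzy hz
      by_cases hk : k = i
      · subst hk
        have h1 := hpi.mem_iff.1 hz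
        simp only [List.mem_cons] at h1
        rcases h1 with rfl | rfl | rfl | rfl | h1
        exacts [absurd rfl hzx, absurd rfl hzx, absurd rfl hzy, absurd rfl hzy, h1]
      · rwa [hUk hk] at hz
    have h1 := mem hgx hgy hg
    have h2 := mem (z := g.opp) hgx hgy hg'
    rw [← hm k g h1 h2 hgt, weightedIndex, weightedIndex, hmo hgx hgy]
    by_cases hk : k = i
    · subst hk
      have hn := hVU.nodup_word k
      rw [hUi] at hn
      rw [hi] at h1 h2
      rw [hUi, hi, arcSum_insert hn (by simp [hsgn]) (by simp [hsgn]) h1 h2]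
    · rw [hUk hk]
  rw [indexClass_eq hNU hI, indexClass_eq hW hm, weightedClass_r2 hVU hxt hyt hs (i := i) (j := i)
    (l := u ++ ([x.opp, y.opp] ++ v)) (l' := v ++ ([x, y] ++ u)) (by rw [hUi]; exact .refl _)
    (by
      rw [hUi]
      simpa using isRotated_append_comm ([x, y] ++ u) ([x.opp, y.opp] ++ v)) hmx hmy]
  have hf : filterWords (fun z => z.chord ≠ x.chord ∧ z.chord ≠ y.chord) U = W := by
    funext k
    have h1 : (W k).filter (fun z => z.chord ≠ x.chord ∧ z.chord ≠ y.chord) = W k :=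
      List.filter_eq_self.2 fun z hz => by
        simpa using ⟨hx z (mem_ends.2 ⟨k, hz⟩), hy z (mem_ends.2 ⟨k, hz⟩)⟩
    by_cases hk : k = i
    · subst hk
      rw [hi, List.filter_append] at h1
      rw [filterWords, hUi, hi]
      simpa using h1
    · rw [filterWords, hUk hk, h1]
  rw [hf]
  exact weightedClass_congr hW.toValid fun e he => hmo (hx e he) (hy e he)

/-- Two self-chords of opposite signs with the same weighted index cancel. -/
theorem indexClass_cancel_self_aux {x y : Endpoint} (hxt : x.isTerminal = false)
    (hyt : y.isTerminal = false) (hs : y.chordSign = -x.chordSign) (hxy : x.chord ≠ y.chord)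
    (i : Fin 2) (n : ℕ) : ∀ {W : Words} {w : ℕ → ℤ} {u v : List Endpoint}, Norm W →
      NewChord x.chord W → NewChord y.chord W → w x.chord = w y.chord → (W i).Perm (u ++ v) →
      (w x.chord - y.sign - signSum u).natAbs = n →
      indexClass (update W i (x :: x.opp :: y :: y.opp :: W i)) w = indexClass W w := by
  have norm_pair : ∀ {W : Words}, Norm W → NewChord x.chord W → NewChord y.chord W →
      Norm (update W i (x :: x.opp :: y :: y.opp :: W i)) := by
    intro W hW hx hy
    have h := (hW.addPair hy i).addPair (hx.addPair hxy.symm i) i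
    rwa [update_self, update_idem] at h
  induction n with
  | zero =>
    intro W w u v hW hx hy hw hp hn
    have hN : Norm (update W i (u ++ v)) := hW.of_perm fun k => (perm_update hp.symm k).symm
    have hE := ends_perm fun k => perm_update hp.symm k
    have h1 := indexClass_parallel (i := i) hN hxt hyt hs
      (fun z hz => hx z (hE.mem_iff.1 hz)) (fun z hz => hy z (hE.mem_iff.1 hz)) hxy hw
      (update_self ..) (by omega)
    rw [update_idem] at h1
    rw [indexClass_congr hW (fun k => (perm_update hp.symm k).symm) fun _ _ _ _ => rfl, ← h1]
    refine indexClass_congr (norm_pair hW hx hy) (fun k => ?_) fun _ _ _ _ => rfl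
    by_cases hk : k = i
    · subst hk
      simp only [update_self]
      refine .cons x ?_
      have h2 : (y :: x.opp :: y.opp :: W k).Perm (y :: (u ++ ([x.opp, y.opp] ++ v))) := by
        refine .cons y (((hp.cons _).cons _).trans ?_)
        change ([x.opp, y.opp] ++ (u ++ v)).Perm _
        rw [← List.append_assoc, ← List.append_assoc]
        exact List.perm_append_comm.append_right v
      exact (List.Perm.swap _ _ _).trans h2
    · rw [update_of_ne hk, update_of_ne hk]
  | succ n ih =>
    intro W w u v hW hx hy hw hp hn
    -- One endpoint of an auxiliary free chord moves the total sign of `u` one step.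
    obtain ⟨d, hd⟩ := exists_newChord (update W i (x :: x.opp :: y :: y.opp :: W i))
    have hmem := ends_update_perm (W := W) (i := i) (p := [x, x.opp, y, y.opp]) (.refl _)
    have hdx : x.chord ≠ d := hd x (hmem.mem_iff.2 (by simp))
    have hdy : y.chord ≠ d := hd y (hmem.mem_iff.2 (by simp))
    have hdW : NewChord d W := fun z hz => hd z (hmem.mem_iff.2 (by simp [hz]))
    set e : Endpoint := ⟨d, false, 1⟩ with he
    have hes : (e.sign : ℤ) = -1 := by simp [he, sign]
    set w' := update w d 0 with hw'
    have hwx : w' x.chord = w x.chord := update_of_ne hdx _ _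
    have hwy : w' y.chord = w y.chord := update_of_ne hdy _ _
    have hNe := hW.addPair (x := e) hdW i
    have h1 : indexClass (update (update W i (e :: e.opp :: W i)) i
        (x :: x.opp :: y :: y.opp :: update W i (e :: e.opp :: W i) i)) w' =
        indexClass (update W i (e :: e.opp :: W i)) w' := by
      by_cases hpos : 0 < w x.chord - y.sign - signSum u
      · refine ih (u := e.opp :: u) (v := e :: v) hNe (hx.addPair hdx.symm i)
          (hy.addPair hdy.symm i) (by rw [hwx, hwy, hw]) ?_ ?_
        · rw [update_self]
          refine ((hp.cons _).cons _).trans ((List.Perm.swap _ _ _).trans ?_)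
          exact .cons _ List.perm_middle.symm
        · rw [signSum_cons, sign_opp, Units.val_neg, hes, hwx]
          omega
      · refine ih (u := e :: u) (v := e.opp :: v) hNe (hx.addPair hdx.symm i)
          (hy.addPair hdy.symm i) (by rw [hwx, hwy, hw]) ?_ ?_
        · rw [update_self]
          exact ((hp.cons _).cons _).trans (.cons _ List.perm_middle.symm)
        · rw [signSum_cons, hes, hwx]
          omega
    have hN2 := norm_pair hW hx hy
    have h2 := indexClass_free hN2 (x := e) (i := i) (w := w') hd (by simp [hw', he])
    have h3 := indexClass_free hW (x := e) (i := i) (w := w') hdW (by simp [hw', he])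
    rw [← indexClass_update hN2 hd w 0, ← h2, ← indexClass_update hW hdW w 0, ← h3, ← h1]
    refine indexClass_congr (hN2.addPair (x := e) hd i) (fun k => ?_) fun _ _ _ _ => rfl
    by_cases hk : k = i
    · subst hk
      simp only [update_self]
      exact List.perm_append_comm (l₁ := [e, e.opp]) (l₂ := [x, x.opp, y, y.opp])
        |>.append_right (W k)
    · simp only [update_of_ne hk]
      exact .refl _

theorem indexClass_cancel_self {W : Words} (hW : Norm W) {x y : Endpoint}
    (hxt : x.isTerminal = false) (hyt : y.isTerminal = false) (hs : y.chordSign = -x.chordSign)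
    (hx : NewChord x.chord W) (hy : NewChord y.chord W) (hxy : x.chord ≠ y.chord) {w : ℕ → ℤ}
    (hw : w x.chord = w y.chord) (i : Fin 2) :
    indexClass (update W i (x :: x.opp :: y :: y.opp :: W i)) w = indexClass W w :=
  indexClass_cancel_self_aux hxt hyt hs hxy i _ (u := []) (v := W i) hW hx hy hw (.refl _) rfl

/-- Two nonself-chords of opposite signs with the same direction cancel: their endpoints may be
brought together and their weights are immaterial. -/
theorem indexClass_cancel_cross {W : Words} (hW : Norm W) {x y : Endpoint}
    (hxt : x.isTerminal = false) (hyt : y.isTerminal = false) (hs : y.chordSign = -x.chordSign)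
    (hx : NewChord x.chord W) (hy : NewChord y.chord W) (hxy : x.chord ≠ y.chord) (w : ℕ → ℤ)
    {i j : Fin 2} (hij : i ≠ j) : indexClass (update (update W i (x :: y :: W i)) j
      (x.opp :: y.opp :: W j)) w = indexClass W w := by
  have hsgn : (y.sign : ℤ) = -x.sign := by
    rw [sign_of_initial hxt, sign_of_initial hyt, hs]
    push_cast
    ring
  set U := update (update W i (x :: y :: W i)) j (x.opp :: y.opp :: W j) with hU
  have hUi : U i = x :: y :: W i := by rw [hU, update_of_ne hij, update_self]
  have hUj : U j = x.opp :: y.opp :: W j := update_self ..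
  have hk : ∀ k, k = i ∨ k = j := by omega
  have hVU : Valid U := by
    refine valid_of_ends_perm hW.toValid hx hy hxy ?_
    have h1 : (ends U).Perm ([x.opp, y.opp] ++ ([x, y] ++ ends W)) := by
      refine (ends_update_perm (W := update W i (x :: y :: W i)) (p := [x.opp, y.opp]) ?_).trans
        ((ends_update_perm (p := [x, y]) (.refl _)).append_left _)
      rw [update_of_ne hij.symm]
      exact .refl _
    refine h1.trans ((List.perm_append_comm_assoc ..).trans (.cons x ?_))
    exact .swap _ _ _
  have hsU : ∀ k, signSum (U k) = signSum (W k) := by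
    intro k
    rcases hk k with rfl | rfl
    · simp [hUi, hsgn]
    · simp [hUj, hsgn]
  have hNU : Norm U := ⟨hVU, by rw [hsU, hW.total_zero], by rw [hsU, hW.total_one]⟩
  have nonself : ∀ {k z g}, z ∈ U i → z.opp ∈ U j → g ∈ U k → g.opp ∈ U k → g.chord ≠ z.chord := by
    intro k z g hz hz' hg hg' hgz
    rcases hVU.eq_or_eq_opp (mem_ends.2 ⟨i, hz⟩) (mem_ends.2 ⟨k, hg⟩) hgz with rfl | rfl
    · exact hij ((hVU.eq_of_mem hz hg).trans (hVU.eq_of_mem hg' hz'))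
    · rw [opp_opp] at hg'
      exact hij ((hVU.eq_of_mem hz hg').trans (hVU.eq_of_mem hg hz'))
  obtain ⟨m, hm, -⟩ := exists_hasIndex hW.toValid w
  set m' := update (update m x.chord 0) y.chord 0 with hm'
  have hmx : m' x.chord = 0 := by simp [hm', hxy]
  have hmy : m' y.chord = 0 := by simp [hm']
  have hmo : ∀ {c}, c ≠ x.chord → c ≠ y.chord → m' c = m c := fun h1 h2 => by simp [hm', h1, h2]
  have mem : ∀ {k z}, z.chord ≠ x.chord → z.chord ≠ y.chord → z ∈ U k → z ∈ W k := by
    intro k z hzx hzy hz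
    rcases hk k with rfl | rfl
    · rw [hUi] at hz
      simp only [List.mem_cons] at hz
      rcases hz with rfl | rfl | hz
      exacts [absurd rfl hzx, absurd rfl hzy, hz]
    · rw [hUj] at hz
      simp only [List.mem_cons] at hz
      rcases hz with rfl | rfl | hz
      exacts [absurd rfl hzx, absurd rfl hzy, hz]
  have hI : HasIndex U m' w := by
    intro k g hg hg' hgt
    have hgx : g.chord ≠ x.chord := nonself (by simp [hUi]) (by simp [hUj]) hg hg'
    have hgy : g.chord ≠ y.chord := nonself (by simp [hUi]) (by simp [hUj]) hg hg'
    have h1 := mem hgx hgy hg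
    have h2 := mem (z := g.opp) hgx hgy hg'
    rw [← hm k g h1 h2 hgt, weightedIndex, weightedIndex, hmo hgx hgy]
    have hn := hVU.nodup_word k
    congr 1
    rcases hk k with rfl | rfl
    · rw [hUi] at hn ⊢
      exact arcSum_append_congr (p := [x, y]) (q := []) hn (hW.nodup_word k) (by simp [hsgn]) h1 h2
    · rw [hUj] at hn ⊢
      exact arcSum_append_congr (p := [x.opp, y.opp]) (q := []) hn (hW.nodup_word k)
        (by simp [hsgn]) h1 h2
  rw [indexClass_eq hNU hI, indexClass_eq hW hm, weightedClass_r2 hVU hxt hyt hs (i := i) (j := j)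
    (l := W i) (l' := W j) (by rw [hUi]) (by rw [hUj]) hmx hmy]
  have hf : filterWords (fun z => z.chord ≠ x.chord ∧ z.chord ≠ y.chord) U = W := by
    funext k
    have h1 : (W k).filter (fun z => z.chord ≠ x.chord ∧ z.chord ≠ y.chord) = W k :=
      List.filter_eq_self.2 fun z hz => by
        simpa using ⟨hx z (mem_ends.2 ⟨k, hz⟩), hy z (mem_ends.2 ⟨k, hz⟩)⟩
    rcases hk k with rfl | rfl
    · rw [filterWords, hUi]
      simpa using h1
    · rw [filterWords, hUj]
      simpa using h1
  rw [hf]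
  exact weightedClass_congr hW.toValid fun e he => hmo (hx e he) (hy e he)

end GaussDiagram

/-! ### Diagrams as lists of chords -/

namespace GaussDiagram

open Endpoint Function

/-- A chord of a diagram on two circles: its name, the circles of its initial and of its terminal
endpoint, and its sign. -/
structure ChordRecord where
  name : ℕ
  src : Fin 2
  tgt : Fin 2
  sgn : ℤˣ

namespace ChordRecord

/-- The initial endpoint of the chord. -/
def start (r : ChordRecord) : Endpoint := ⟨r.name, false, r.sgn⟩

@[simp] theorem chord_start (r : ChordRecord) : r.start.chord = r.name := rfl

@[simp] theorem sign_start (r : ChordRecord) : r.start.sign = -r.sgn := rfl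

/-- The endpoints of the chord on the circle `k`. -/
def word (r : ChordRecord) (k : Fin 2) : List Endpoint :=
  (if r.src = k then [r.start] else []) ++ if r.tgt = k then [r.start.opp] else []

/-- The data of a chord that are compared when chords are cancelled, given the indices `w` of the
self-chords: the circles of its endpoints, and its index if it is a self-chord. -/
def key (w : ℕ → ℤ) (r : ChordRecord) : Fin 2 × Fin 2 × ℤ :=
  (r.src, r.tgt, if r.src = r.tgt then w r.name else 0)

end ChordRecord

/-- Words with the given chords, in the order of the list. -/
def chordWords (l : List ChordRecord) : Words := fun k => l.flatMap fun r => r.word k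

theorem chordWords_cons (r : ChordRecord) (l : List ChordRecord) (k : Fin 2) :
    chordWords (r :: l) k = r.word k ++ chordWords l k := rfl

theorem chordWords_perm {l l' : List ChordRecord} (h : l.Perm l') (k : Fin 2) :
    (chordWords l k).Perm (chordWords l' k) := h.flatMap_right _

theorem chordWords_cons_self {r : ChordRecord} (hr : r.src = r.tgt) (l : List ChordRecord) :
    chordWords (r :: l) = update (chordWords l) r.src
      (r.start :: r.start.opp :: chordWords l r.src) := by
  funext k
  rw [chordWords_cons, ChordRecord.word]
  by_cases hk : k = r.src
  · subst hk
    simp [hr]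
  · rw [if_neg (Ne.symm hk), if_neg (by rw [← hr]; exact Ne.symm hk), update_of_ne hk]
    rfl

theorem chordWords_cons_cross {r : ChordRecord} (hr : r.src ≠ r.tgt) (l : List ChordRecord) :
    chordWords (r :: l) = update (update (chordWords l) r.src (r.start :: chordWords l r.src))
      r.tgt (r.start.opp :: chordWords l r.tgt) := by
  funext k
  rw [chordWords_cons, ChordRecord.word]
  by_cases hk : k = r.tgt
  · subst hk
    simp [hr]
  · rw [update_of_ne hk, if_neg (c := r.tgt = k) (Ne.symm hk)]
    by_cases hk' : k = r.src
    · subst hk'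
      simp
    · rw [update_of_ne hk', if_neg (Ne.symm hk')]
      rfl

theorem ends_chordWords_cons (r : ChordRecord) (l : List ChordRecord) :
    (ends (chordWords (r :: l))).Perm (r.start :: r.start.opp :: ends (chordWords l)) := by
  by_cases hr : r.src = r.tgt
  · rw [chordWords_cons_self hr]
    exact ends_update_perm (p := [r.start, r.start.opp]) (.refl _)
  · rw [chordWords_cons_cross hr]
    have h1 := ends_update_perm (W := chordWords l) (i := r.src) (p := [r.start]) (.refl _)
    have h2 := ends_update_perm (i := r.tgt) (p := [r.start.opp])
      (W := update (chordWords l) r.src ([r.start] ++ chordWords l r.src))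
      (w := r.start.opp :: chordWords l r.tgt) (by
        rw [update_of_ne (Ne.symm hr)]
        exact .refl _)
    exact h2.trans ((h1.append_left _).trans (.swap _ _ _))

theorem newChord_chordWords {l : List ChordRecord} {c : ℕ} (h : ∀ r ∈ l, r.name ≠ c) :
    NewChord c (chordWords l) := by
  induction l with
  | nil => exact fun x hx => by simp [ends, chordWords] at hx
  | cons r l ih =>
    intro x hx
    have hx := (ends_chordWords_cons r l).mem_iff.1 hx
    simp only [List.mem_cons] at hx
    rcases hx with rfl | rfl | hx
    exacts [h r (by simp), h r (by simp), ih (fun r hr => h r (by simp [hr])) x hx]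

theorem newChord_of_nodup {r : ChordRecord} {l : List ChordRecord}
    (h : ((r :: l).map ChordRecord.name).Nodup) : NewChord r.start.chord (chordWords l) :=
  newChord_chordWords fun s hs hsr =>
    (List.nodup_cons.1 h).1 (List.mem_map.2 ⟨s, hs, hsr⟩)

theorem valid_chordWords {l : List ChordRecord} (h : (l.map ChordRecord.name).Nodup) :
    Valid (chordWords l) := by
  induction l with
  | nil =>
    exact ⟨by simp [ends, chordWords], by simp [ends, chordWords], by simp [ends, chordWords]⟩
  | cons r l ih =>
    exact valid_cons_cons (ih (List.nodup_cons.1 h).2) (.refl _) (newChord_of_nodup h)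
      (ends_chordWords_cons r l)

/-- The contribution of a chord to the total sign of the circle `k`. -/
theorem signSum_word (r : ChordRecord) (k : Fin 2) : signSum (r.word k) =
    (if r.tgt = k then (r.sgn : ℤ) else 0) - if r.src = k then (r.sgn : ℤ) else 0 := by
  rw [ChordRecord.word, signSum_append]
  split_ifs <;> simp

theorem signSum_chordWords (l : List ChordRecord) (k : Fin 2) : signSum (chordWords l k) =
    (l.map fun r => signSum (r.word k)).sum := by
  induction l with
  | nil => rfl
  | cons r l ih => rw [chordWords_cons, signSum_append, ih, List.map_cons, List.sum_cons]

/-- The chords have different names and yield the total signs of virtual linking number one. -/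
structure NormChords (l : List ChordRecord) : Prop where
  nodup : (l.map ChordRecord.name).Nodup
  total_zero : signSum (chordWords l 0) = -1
  total_one : signSum (chordWords l 1) = 1

namespace NormChords

variable {l l' : List ChordRecord}

theorem norm (h : NormChords l) : Norm (chordWords l) :=
  ⟨valid_chordWords h.nodup, h.total_zero, h.total_one⟩

theorem perm (h : NormChords l) (hp : l.Perm l') : NormChords l' :=
  ⟨(hp.map _).nodup_iff.1 h.nodup, by rw [← signSum_perm (chordWords_perm hp 0), h.total_zero],
    by rw [← signSum_perm (chordWords_perm hp 1), h.total_one]⟩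

theorem of_append (h : NormChords (l' ++ l)) (hl : ∀ k, signSum (chordWords l' k) = 0) :
    NormChords l := by
  have key : ∀ k, signSum (chordWords (l' ++ l) k) = signSum (chordWords l k) := by
    intro k
    have := hl k
    rw [signSum_chordWords] at this ⊢
    rw [List.map_append, List.sum_append, this, zero_add, signSum_chordWords]
  refine ⟨?_, by rw [← key, h.total_zero], by rw [← key, h.total_one]⟩
  have := h.nodup
  rw [List.map_append, List.nodup_append] at this
  exact this.2.1

end NormChords

theorem indexClass_chordWords_cancel {a b : ChordRecord} {l : List ChordRecord} {w : ℕ → ℤ}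
    (h : NormChords (a :: b :: l)) (hk : b.key w = a.key w) (hs : b.sgn = -a.sgn) :
    NormChords l ∧ indexClass (chordWords (a :: b :: l)) w = indexClass (chordWords l) w := by
  simp only [ChordRecord.key, Prod.mk.injEq] at hk
  obtain ⟨h1, h2, h3⟩ := hk
  have hl : NormChords l := h.of_append (l' := [a, b]) fun k => by
    rw [signSum_chordWords]
    simp only [List.map_cons, List.map_nil, List.sum_cons, List.sum_nil, signSum_word, h1, h2, hs]
    split_ifs <;> simp
  refine ⟨hl, ?_⟩
  have hn := h.nodup
  rw [List.map_cons, List.nodup_cons, List.map_cons, List.mem_cons, not_or, List.nodup_cons] at hn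
  have ha : NewChord a.start.chord (chordWords l) :=
    newChord_of_nodup (List.nodup_cons.2 ⟨hn.1.2, hn.2.2⟩)
  have hb : NewChord b.start.chord (chordWords l) := newChord_of_nodup (List.nodup_cons.2 hn.2)
  by_cases hr : a.src = a.tgt
  · have hr' : b.src = b.tgt := by rw [h1, h2, hr]
    rw [if_pos hr, if_pos hr'] at h3
    rw [chordWords_cons_self hr, chordWords_cons_self hr', h1, update_self, update_idem]
    exact indexClass_cancel_self hl.norm rfl rfl hs ha hb hn.1.1 h3.symm _
  · rw [← indexClass_cancel_cross hl.norm rfl rfl hs ha hb hn.1.1 w hr]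
    refine indexClass_congr h.norm (fun k => ?_) fun _ _ _ _ => rfl
    rw [chordWords_cons, chordWords_cons]
    by_cases hk : k = a.tgt
    · subst hk
      simp [ChordRecord.word, h1, h2, hr]
    · obtain rfl : k = a.src := by omega
      simp [ChordRecord.word, h1, h2, Ne.symm hr, hr]

/-- The keys of the self-chords that do not contribute to the S-class. -/
def removable : Set (Fin 2 × Fin 2 × ℤ) :=
  {k | k.1 = k.2.1 ∧ (k.1 = 0 → k.2.2 = 0 ∨ k.2.2 = 1 ∨ k.2.2 = -1) ∧
    (k.1 = 1 → k.2.2 = 0 ∨ k.2.2 = 1 ∨ k.2.2 = 2)}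

theorem indexClass_chordWords_delete {a : ChordRecord} {l : List ChordRecord} {w : ℕ → ℤ}
    (h : NormChords (a :: l)) (hk : a.key w ∈ removable) :
    NormChords l ∧ indexClass (chordWords (a :: l)) w = indexClass (chordWords l) w := by
  obtain ⟨hr, hw0, hw1⟩ := hk
  simp only [ChordRecord.key] at hr hw0 hw1
  rw [if_pos hr] at hw0 hw1
  have hl : NormChords l := h.of_append (l' := [a]) fun k => by
    rw [signSum_chordWords]
    simp [signSum_word, hr]
  refine ⟨hl, ?_⟩
  rw [chordWords_cons_self hr]
  refine indexClass_delete hl.norm rfl (newChord_of_nodup h.nodup) ?_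
  rw [ChordRecord.chord_start]
  by_cases h0 : a.src = 0
  · have := hw0 h0
    rw [h0, hl.total_zero]
    omega
  · have h1 : a.src = 1 := by omega
    have := hw1 h1
    rw [h1, hl.total_one]
    omega

/-- The chord with its name changed by `f` and its sign multiplied by `ε`. -/
def renamed (f : ℕ → ℕ) (ε : ℤˣ) (r : ChordRecord) : ChordRecord :=
  ⟨f r.name, r.src, r.tgt, ε * r.sgn⟩

theorem signSum_renamed (f : ℕ → ℕ) (ε : ℤˣ) (l : List ChordRecord) (k : Fin 2) :
    signSum (chordWords (l.map (renamed f ε)) k) = ε * signSum (chordWords l k) := by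
  rw [signSum_chordWords, signSum_chordWords, ← List.sum_map_mul_left, List.map_map]
  refine congrArg List.sum (List.map_congr_left fun r _ => ?_)
  rw [Function.comp_apply, signSum_word, signSum_word]
  change ((if r.tgt = k then ((ε * r.sgn : ℤˣ) : ℤ) else 0) -
    if r.src = k then ((ε * r.sgn : ℤˣ) : ℤ) else 0) = _
  split_ifs <;> push_cast <;> ring

theorem NormChords.renamed {l : List ChordRecord} (h : NormChords l) {f : ℕ → ℕ}
    (hf : Injective f) : NormChords (l.map (renamed f 1)) := by
  refine ⟨?_, by simp [signSum_renamed, h.total_zero], by simp [signSum_renamed, h.total_one]⟩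
  have := h.nodup.map hf
  rwa [List.map_map] at this ⊢

/-- The class of a list `l` of chords is that of a renamed copy of any list `l'` with the same
signed numbers of chords, up to removable self-chords. -/
theorem indexClass_chordWords_eq_renamed {l l' : List ChordRecord} {w w' : ℕ → ℤ} {B : ℕ}
    (hl : NormChords l) (hl' : NormChords l') (hB : ∀ r ∈ l, r.name < B)
    (hw : ∀ k ∉ removable, signedCount (ChordRecord.key w) ChordRecord.sgn l k =
      signedCount (ChordRecord.key w') ChordRecord.sgn l' k) :
    indexClass (chordWords l) w =
      indexClass (chordWords (l'.map (renamed (fun c => B + (2 * c + 1)) 1)))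
        fun c => w' ((c - B) / 2) := by
  set v : ℕ → ℤ := fun c => if c < B then w c else w' ((c - B) / 2) with hv
  have hcount : ∀ k, signedCount (ChordRecord.key v) ChordRecord.sgn l k =
      signedCount (ChordRecord.key w) ChordRecord.sgn l k := fun k => by
    refine congrArg List.sum (List.map_congr_left fun r hr => ?_)
    have : r.key v = r.key w := by simp [ChordRecord.key, hv, hB r hr]
    rw [this]
  have hneg := signedCount_map_neg (key := ChordRecord.key w') (sgn := ChordRecord.sgn)
    (key' := ChordRecord.key v) (sgn' := ChordRecord.sgn) (renamed (fun c => B + 2 * c) (-1))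
    (fun r => by simp [ChordRecord.key, renamed, hv]) (fun r => by simp [renamed]) l'
  have hpos : ∀ k, signedCount (ChordRecord.key v) ChordRecord.sgn
      (l'.map (renamed (fun c => B + (2 * c + 1)) 1)) k =
      signedCount (ChordRecord.key w') ChordRecord.sgn l' k := fun k => by
    rw [signedCount, List.map_map]
    refine congrArg List.sum (List.map_congr_left fun r _ => ?_)
    have h1 : (2 * r.name + 1) / 2 = r.name := by omega
    have h2 : (renamed (fun c => B + (2 * c + 1)) 1 r).key v = r.key w' := by
      simp [ChordRecord.key, renamed, hv, h1]
    rw [Function.comp_apply, h2]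
    simp [renamed]
  have hgood : NormChords ((l'.map (renamed (fun c => B + 2 * c) (-1)) ++
      l'.map (renamed (fun c => B + (2 * c + 1)) 1)) ++ l) := by
    have hs : ∀ k, signSum (chordWords ((l'.map (renamed (fun c => B + 2 * c) (-1)) ++
        l'.map (renamed (fun c => B + (2 * c + 1)) 1)) ++ l) k) = signSum (chordWords l k) := by
      intro k
      have h1 := signSum_renamed (fun c => B + 2 * c) (-1) l' k
      have h2 := signSum_renamed (fun c => B + (2 * c + 1)) 1 l' k
      simp only [chordWords, List.flatMap_append, signSum_append] at h1 h2 ⊢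
      rw [h1, h2]
      simp
    refine ⟨?_, by rw [hs, hl.total_zero], by rw [hs, hl.total_one]⟩
    have hn : ∀ f : ℕ → ℕ, Injective f → ∀ ε,
        ((l'.map (renamed f ε)).map ChordRecord.name).Nodup := fun f hf ε => by
      have := hl'.nodup.map hf
      rwa [List.map_map] at this ⊢
    rw [List.map_append, List.map_append, List.nodup_append', List.nodup_append']
    refine ⟨⟨hn _ (fun a b h => by omega) _,
      hn _ (fun a b h => by omega) _, ?_⟩, hl.nodup, ?_⟩
    · intro c hc hc'
      simp only [List.map_map, List.mem_map, Function.comp_apply, renamed] at hc hc'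
      obtain ⟨r, -, rfl⟩ := hc
      obtain ⟨s, -, hs⟩ := hc'
      omega
    · intro c hc hc'
      obtain ⟨r, hr, rfl⟩ := List.mem_map.1 hc'
      have := hB r hr
      simp only [List.map_map, List.mem_map, List.mem_append, Function.comp_apply, renamed] at hc
      rcases hc with ⟨s, -, hs⟩ | ⟨s, -, hs⟩ <;> omega
  have hmain := eq_of_signedCount_eq (key := ChordRecord.key v) (sgn := ChordRecord.sgn)
    (F := fun l => indexClass (chordWords l) v) (Good := NormChords) (R := removable)
    (l := l) (N := l'.map (renamed (fun c => B + 2 * c) (-1)))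
    (P := l'.map (renamed (fun c => B + (2 * c + 1)) 1))
    (fun _ _ hp hg => ⟨hg.perm hp, indexClass_congr hg.norm (chordWords_perm hp)
      fun _ _ _ _ => rfl⟩)
    (fun _ _ _ hg hk hs => indexClass_chordWords_cancel hg hk hs)
    (fun _ _ hg hk => indexClass_chordWords_delete hg hk)
    (fun k _ => by rw [hneg, hpos]; ring) (fun k hk => by rw [hneg, hcount, hw k hk]; ring) hgood
  have hlv : indexClass (chordWords l) w = indexClass (chordWords l) v := by
    refine indexClass_congr hl.norm (fun _ => .refl _) fun i g hg _ => ?_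
    have hgB : g.chord < B := by
      by_contra hgB
      exact newChord_chordWords (l := l) (c := g.chord)
        (fun r hr h => hgB (h ▸ hB r hr)) g (mem_ends.2 ⟨i, hg⟩) rfl
    simp [hv, hgB]
  have hP := hl'.renamed (f := fun c => B + (2 * c + 1)) fun a b h => by simp only at h; omega
  rw [hlv, hmain]
  refine indexClass_congr hP.norm (fun _ => .refl _) fun i g hg _ => ?_
  have hgB : ¬ g.chord < B := by
    intro hgB
    refine newChord_chordWords (l := l'.map (renamed (fun c => B + (2 * c + 1)) 1)) (c := g.chord)
      (fun r hr h => ?_) g (mem_ends.2 ⟨i, hg⟩) rfl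
    obtain ⟨s, -, rfl⟩ := List.mem_map.1 hr
    simp only [renamed] at h
    omega
  simp [hv, hgB]

end GaussDiagram

/-! ### The invariants determine the S-class -/

namespace GaussDiagram

open Endpoint Function

/-- The chord with the initial endpoint `e`. -/
def recordOf (W : Words) (e : Endpoint) : ChordRecord :=
  ⟨e.chord, if e ∈ W 0 then 0 else 1, if e.opp ∈ W 0 then 0 else 1, e.chordSign⟩

/-- The chords of the words. -/
def chordsOf (W : Words) : List ChordRecord :=
  ((ends W).filter fun e => e.isTerminal = false).map (recordOf W)

section

variable {W : Words}

theorem ite_mem_eq_iff (hW : Valid W) {e : Endpoint} (he : e ∈ ends W) (k : Fin 2) :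
    (if e ∈ W 0 then 0 else 1) = k ↔ e ∈ W k := by
  obtain ⟨i, hi⟩ := mem_ends.1 he
  have h : ∀ j, e ∈ W j ↔ i = j := fun j => ⟨hW.eq_of_mem hi, fun h => h ▸ hi⟩
  rw [h k]
  simp only [h 0]
  split_ifs <;> omega

theorem src_recordOf (hW : Valid W) {e : Endpoint} (he : e ∈ ends W) (k : Fin 2) :
    (recordOf W e).src = k ↔ e ∈ W k := ite_mem_eq_iff hW he k

theorem tgt_recordOf (hW : Valid W) {e : Endpoint} (he : e ∈ ends W) (k : Fin 2) :
    (recordOf W e).tgt = k ↔ e.opp ∈ W k := ite_mem_eq_iff hW (hW.opp_mem e he) k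

theorem start_recordOf {e : Endpoint} (he : e.isTerminal = false) : (recordOf W e).start = e := by
  obtain ⟨c, t, ε⟩ := e
  simp only at he
  subst he
  rfl

theorem nodup_chordsOf (hW : Valid W) : ((chordsOf W).map ChordRecord.name).Nodup := by
  rw [chordsOf, List.map_map]
  refine (hW.nodup.filter _).map_on fun x hx y hy hxy => ?_
  simp only [List.mem_filter, decide_eq_true_eq] at hx hy
  rcases hW.eq_or_eq_opp hx.1 hy.1 hxy.symm with rfl | rfl
  · rfl
  · simp [hx.2] at hy

theorem mem_chordWords {l : List ChordRecord} {k : Fin 2} {x : Endpoint} :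
    x ∈ chordWords l k ↔ ∃ r ∈ l, (r.src = k ∧ x = r.start) ∨ (r.tgt = k ∧ x = r.start.opp) := by
  simp only [chordWords, List.mem_flatMap, ChordRecord.word, List.mem_append]
  refine exists_congr fun r => and_congr_right fun _ => or_congr ?_ ?_ <;>
  · split_ifs with h <;> simp [h]

theorem chordWords_chordsOf_perm (hW : Valid W) (k : Fin 2) :
    (W k).Perm (chordWords (chordsOf W) k) := by
  refine (List.perm_ext_iff_of_nodup (hW.nodup_word k)
    ((valid_chordWords (nodup_chordsOf hW)).nodup_word k)).2 fun x => ?_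
  simp only [mem_chordWords, chordsOf, List.mem_map, List.mem_filter, decide_eq_true_eq]
  constructor
  · intro hx
    have hxW : x ∈ ends W := mem_ends.2 ⟨k, hx⟩
    rcases hxt : x.isTerminal with _ | _
    · exact ⟨_, ⟨x, ⟨hxW, hxt⟩, rfl⟩, .inl ⟨(src_recordOf hW hxW k).2 hx,
        (start_recordOf hxt).symm⟩⟩
    · have hxt' : x.opp.isTerminal = false := by simp [hxt]
      refine ⟨_, ⟨x.opp, ⟨hW.opp_mem x hxW, hxt'⟩, rfl⟩, .inr ⟨?_, ?_⟩⟩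
      · rw [tgt_recordOf hW (hW.opp_mem x hxW), opp_opp]
        exact hx
      · rw [start_recordOf hxt', opp_opp]
  · rintro ⟨_, ⟨e, ⟨he, het⟩, rfl⟩, ⟨h, rfl⟩ | ⟨h, rfl⟩⟩
    · rw [start_recordOf het]
      exact (src_recordOf hW he k).1 h
    · rw [start_recordOf het]
      exact (tgt_recordOf hW he k).1 h

theorem sum_chordsOf (f : ChordRecord → ℤ) : ((chordsOf W).map f).sum =
    ((ends W).map fun e => if e.isTerminal = false then f (recordOf W e) else 0).sum := by
  rw [chordsOf, List.map_map, sum_map_filter_eq]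
  simp

/-- A sum over the chords that start on the circle `i` as a sum over the endpoints there. -/
theorem sum_chordsOf_src (hW : Valid W) (i : Fin 2) (f : ChordRecord → ℤ) :
    ((chordsOf W).map fun r => if r.src = i then f r else 0).sum =
      ((W i).map fun e => if e.isTerminal = false then f (recordOf W e) else 0).sum := by
  have key : ∀ k, ((W k).map fun e => if e.isTerminal = false then
      (if (recordOf W e).src = i then f (recordOf W e) else 0) else 0).sum = if k = i then
      ((W i).map fun e => if e.isTerminal = false then f (recordOf W e) else 0).sum else 0 := by
    intro k
    have h1 : ∀ e ∈ W k, ((recordOf W e).src = i ↔ k = i) := fun e he => by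
      rw [src_recordOf hW (mem_ends.2 ⟨k, he⟩)]
      exact ⟨fun h => hW.eq_of_mem he h, fun h => h ▸ he⟩
    split_ifs with hk
    · subst hk
      refine congrArg List.sum (List.map_congr_left fun e he => ?_)
      rw [if_pos ((h1 e he).2 rfl)]
    · refine List.sum_eq_zero fun z hz => ?_
      obtain ⟨e, he, rfl⟩ := List.mem_map.1 hz
      rw [if_neg fun h => hk ((h1 e he).1 h), ite_self]
  rw [sum_chordsOf, ends, List.map_append, List.sum_append, key, key]
  fin_cases i <;> simp

theorem crossSum_eq_sum_chordsOf (hW : Valid W) (i j : Fin 2) : crossSum W i j =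
    ((chordsOf W).map fun r => if r.src = i ∧ r.tgt = j then (r.sgn : ℤ) else 0).sum := by
  simp only [ite_and]
  rw [sum_chordsOf_src hW i fun r => if r.tgt = j then (r.sgn : ℤ) else 0, crossSum]
  refine congrArg List.sum (List.map_congr_left fun e he => ?_)
  rw [← ite_and]
  exact if_congr (and_congr_right fun _ => (tgt_recordOf hW (mem_ends.2 ⟨i, he⟩) j).symm) rfl rfl

theorem signedCount_self (hW : Valid W) {w : ℕ → ℤ} (hw : HasIndex W 0 w) (i : Fin 2) (n : ℤ) :
    signedCount (ChordRecord.key w) ChordRecord.sgn (chordsOf W) (i, i, n) =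
      weightedWrithe W 0 i n := by
  have h1 : signedCount (ChordRecord.key w) ChordRecord.sgn (chordsOf W) (i, i, n) =
      ((chordsOf W).map fun r => if r.src = i then
        (if r.tgt = i ∧ w r.name = n then (r.sgn : ℤ) else 0) else 0).sum := by
    refine congrArg List.sum (List.map_congr_left fun r _ => ?_)
    rw [← ite_and]
    refine if_congr ?_ rfl rfl
    simp only [ChordRecord.key, Prod.mk.injEq]
    refine and_congr_right fun h2 => and_congr_right fun h3 => ?_
    rw [if_pos (h2.trans h3.symm)]
  rw [h1, sum_chordsOf_src hW i fun r => if r.tgt = i ∧ w r.name = n then (r.sgn : ℤ) else 0,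
    weightedWrithe]
  refine congrArg List.sum (List.map_congr_left fun e he => ?_)
  rw [← ite_and]
  refine if_congr (and_congr_right fun het => ?_) rfl rfl
  rw [tgt_recordOf hW (mem_ends.2 ⟨i, he⟩) i]
  refine and_congr_right fun he' => ?_
  rw [hw i e he he' het]
  rfl

theorem signedCount_cross (hW : Valid W) (w : ℕ → ℤ) {i j : Fin 2} (hij : i ≠ j) (n : ℤ) :
    signedCount (ChordRecord.key w) ChordRecord.sgn (chordsOf W) (i, j, n) =
      if n = 0 then crossSum W i j else 0 := by
  rw [crossSum_eq_sum_chordsOf hW]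
  have key : ∀ r : ChordRecord, r.key w = (i, j, n) ↔ (r.src = i ∧ r.tgt = j) ∧ n = 0 := by
    intro r
    simp only [ChordRecord.key, Prod.mk.injEq, ← and_assoc]
    refine and_congr_right fun ⟨h1, h2⟩ => ?_
    rw [if_neg (by rw [h1, h2]; exact hij)]
    exact eq_comm
  simp only [signedCount, key]
  split_ifs with h
  · simp [h]
  · simp [h]

/-- The total sign of a circle is the difference of the linking numbers. -/
theorem signSum_eq_crossSum (hW : Valid W) {i j : Fin 2} (hij : i ≠ j) :
    signSum (W i) = crossSum W j i - crossSum W i j := by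
  rw [signSum_perm (chordWords_chordsOf_perm hW i), signSum_chordWords,
    crossSum_eq_sum_chordsOf hW, crossSum_eq_sum_chordsOf hW]
  induction chordsOf W with
  | nil => rfl
  | cons r l ih =>
    rw [List.map_cons, List.sum_cons, ih, signSum_word, List.map_cons, List.map_cons, List.sum_cons,
      List.sum_cons]
    have h1 : r.src = i ∨ r.src = j := by omega
    have h2 : r.tgt = i ∨ r.tgt = j := by omega
    rcases h1 with h1 | h1 <;> rcases h2 with h2 | h2 <;> simp [h1, h2, hij, hij.symm] <;> ring

end

theorem exists_index (G : GaussDiagram 2) : ∃ w, HasIndex G.circle 0 w := by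
  have hW := valid_circle G
  have key : ∀ x, ∃ v : ℤ, ∀ i, ∀ g ∈ G.circle i, g.opp ∈ G.circle i → g.isTerminal = false →
      g.chord = x → weightedIndex G.circle 0 i g = v := by
    intro x
    by_cases h : ∃ i, ∃ g ∈ G.circle i, g.isTerminal = false ∧ g.chord = x
    · obtain ⟨i, g, hg, hgt, rfl⟩ := h
      refine ⟨weightedIndex G.circle 0 i g, fun j f hf _ hft hfc => ?_⟩
      rcases hW.eq_or_eq_opp (mem_ends.2 ⟨i, hg⟩) (mem_ends.2 ⟨j, hf⟩) hfc with rfl | rfl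
      · rw [hW.eq_of_mem hf hg]
      · simp [hgt] at hft
    · exact ⟨0, fun i g hg _ hgt hgx => absurd ⟨i, g, hg, hgt, hgx⟩ h⟩
  choose w hw using key
  exact ⟨w, fun i g hg hg' hgt => hw g.chord i g hg hg' hgt rfl⟩

theorem norm_circle {G : GaussDiagram 2} (h : G.virtualLinkingNumber = 1) : Norm G.circle := by
  have hW := valid_circle G
  rw [virtualLinkingNumber, linkingNumber_eq_crossSum, linkingNumber_eq_crossSum] at h
  refine ⟨hW, ?_, ?_⟩
  · rw [signSum_eq_crossSum hW (j := 1) (by decide)]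
    omega
  · rw [signSum_eq_crossSum hW (j := 0) (by decide)]
    omega

theorem normChords_chordsOf {W : Words} (hW : Norm W) : NormChords (chordsOf W) :=
  ⟨nodup_chordsOf hW.toValid,
    by rw [← signSum_perm (chordWords_chordsOf_perm hW.toValid 0), hW.total_zero],
    by rw [← signSum_perm (chordWords_chordsOf_perm hW.toValid 1), hW.total_one]⟩

theorem sClass_eq_indexClass {W : Words} (hW : Norm W) {w : ℕ → ℤ} (hw : HasIndex W 0 w) :
    sClass W = indexClass (chordWords (chordsOf W)) w := by
  rw [← weightedClass_zero hW.toValid, ← indexClass_eq hW hw]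
  exact indexClass_congr hW (chordWords_chordsOf_perm hW.toValid) fun _ _ _ _ => rfl

/-- The invariants determine the S-class of a diagram of virtual linking number one. -/
theorem sClass_eq_of_invariants {G H : GaussDiagram 2} (hG : G.virtualLinkingNumber = 1)
    (hH : H.virtualLinkingNumber = 1)
    (h0 : ∀ n : ℤ, n ≠ 0 → n ≠ 1 → n ≠ -1 → G.writhe 0 n = H.writhe 0 n)
    (h1 : ∀ n : ℤ, n ≠ 0 → n ≠ 1 → n ≠ 2 → G.writhe 1 n = H.writhe 1 n)
    (hF : G.linkingClass = H.linkingClass) : sClass G.circle = sClass H.circle := by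
  have hGN := norm_circle hG
  have hHN := norm_circle hH
  obtain ⟨w, hw⟩ := exists_index G
  obtain ⟨w', hw'⟩ := exists_index H
  have hcount : ∀ k ∉ removable,
      signedCount (ChordRecord.key w) ChordRecord.sgn (chordsOf G.circle) k =
      signedCount (ChordRecord.key w') ChordRecord.sgn (chordsOf H.circle) k := by
    rintro ⟨i, j, n⟩ hk
    by_cases hij : i = j
    · subst hij
      rw [signedCount_self hGN.toValid hw, signedCount_self hHN.toValid hw',
        ← writhe_eq_weightedWrithe, ← writhe_eq_weightedWrithe]
      simp only [removable, Set.mem_ofPred_eq, true_and, not_and_or] at hk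
      rcases hk with hk | hk
      · push Not at hk
        obtain ⟨rfl, h2, h3, h4⟩ := hk
        exact h0 n h2 h3 h4
      · push Not at hk
        obtain ⟨rfl, h2, h3, h4⟩ := hk
        exact h1 n h2 h3 h4
    · rw [signedCount_cross hGN.toValid w hij, signedCount_cross hHN.toValid w' hij]
      simp only [linkingClass, Prod.mk.injEq, linkingNumber_eq_crossSum] at hF
      have : crossSum G.circle i j = crossSum H.circle i j := by
        have hc : (i = 0 ∧ j = 1) ∨ (i = 1 ∧ j = 0) := by omega
        rcases hc with ⟨rfl, rfl⟩ | ⟨rfl, rfl⟩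
        exacts [hF.1, hF.2]
      rw [this]
  obtain ⟨B, hB⟩ : ∃ B, ∀ r ∈ chordsOf G.circle ++ chordsOf H.circle, r.name < B := by
    let L := (chordsOf G.circle ++ chordsOf H.circle).map ChordRecord.name
    exact ⟨L.sum + 1, fun r hr => Nat.lt_succ_of_le
      (List.single_le_sum (by simp) _ (List.mem_map.2 ⟨r, hr, rfl⟩))⟩
  rw [sClass_eq_indexClass hGN hw, sClass_eq_indexClass hHN hw',
    indexClass_chordWords_eq_renamed (normChords_chordsOf hGN) (normChords_chordsOf hHN)
      (fun r hr => hB r (List.mem_append_left _ hr)) hcount,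
    indexClass_chordWords_eq_renamed (normChords_chordsOf hHN) (normChords_chordsOf hHN)
      (fun r hr => hB r (List.mem_append_right _ hr)) fun _ _ => rfl]

/-- S-equivalent diagrams have the same invariants. -/
theorem SEquiv.invariants {G H : GaussDiagram 2} (h : SEquiv G H)
    (hG : G.virtualLinkingNumber = 1) :
    (∀ n : ℤ, n ≠ 0 → n ≠ 1 → n ≠ -1 → G.writhe 0 n = H.writhe 0 n) ∧
      (∀ n : ℤ, n ≠ 0 → n ≠ 1 → n ≠ 2 → G.writhe 1 n = H.writhe 1 n) ∧
      G.linkingClass = H.linkingClass := by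
  have hI := h.sameInvariants
  have hN := norm_circle hG
  refine ⟨fun n h0 h1 h2 => ?_, fun n h0 h1 h2 => ?_, ?_⟩
  · rw [writhe_eq_weightedWrithe, writhe_eq_weightedWrithe]
    exact hI.writhe 0 n h0 h1 (by rwa [hN.total_zero]) (by rw [hN.total_zero]; omega)
  · rw [writhe_eq_weightedWrithe, writhe_eq_weightedWrithe]
    exact hI.writhe 1 n h0 h1 (by rwa [hN.total_one]) (by rw [hN.total_one]; omega)
  · simp only [linkingClass, linkingNumber_eq_crossSum]
    rw [hI.cross 0 1 (by decide), hI.cross 1 0 (by decide)]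

/-- Diagrams of the same virtual link are S-equivalent. -/
theorem Presents.sEquiv {G H : GaussDiagram 2} {L : VirtualLink 2} (hG : G.Presents L)
    (hH : H.Presents L) : SEquiv G H :=
  Relation.EqvGen.mono (r := ReidemeisterMove) (fun _ _ h => SMove.reidemeister h) _ _
    (Quotient.exact (hG.symm.trans hH))

end GaussDiagram

open GaussDiagram in
theorem theorem1p3 (L L' : VirtualLink 2) (G G' : GaussDiagram 2)
    (hG : G.Presents L) (hG' : G'.Presents L')
    (hlam : G.virtualLinkingNumber = 1) (hlam' : G'.virtualLinkingNumber = 1) :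
    L.SEquiv L' ↔
      (∀ n : ℤ, n ≠ 0 → n ≠ 1 → n ≠ -1 → G.writhe 0 n = G'.writhe 0 n) ∧
      (∀ n : ℤ, n ≠ 0 → n ≠ 1 → n ≠ 2 → G.writhe 1 n = G'.writhe 1 n) ∧
      G.linkingClass = G'.linkingClass := by
  constructor
  · rintro ⟨H, H', hH, hH', h⟩
    have h1 : GaussDiagram.SEquiv G G' :=
      .trans _ _ _ (hG.sEquiv hH) (.trans _ _ _ h (hH'.sEquiv hG'))
    exact h1.invariants hlam
  · rintro ⟨h0, h1, hF⟩
    have h := GaussDiagram.sClass_eq_of_invariants hlam hlam' h0 h1 hF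
    rw [GaussDiagram.sClass_circle, GaussDiagram.sClass_circle] at h
    exact ⟨G, G', hG, hG', Quotient.exact h⟩
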